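/- Setting. Let $m,n$ be integers with $m\ge 1$, $\lambda>0$, and for $i=1,\dots,m$ let $\mathbb P^i$ be a probability distribution on a sample space $\Xi$ and $\ell^i:\mathbb R^n\times\Xi\to\mathbb R$ a loss. Let $f:[0,\infty)\to(-\infty,+\infty]$ and let $f^*(s)=\sup_{t\ge0}(st-f(t))$ be its conjugate. Put $$L^i(\theta,\eta;\xi)=\lambda f^*\Big(\frac{\ell^i(\theta;\xi)-\eta}{\lambda}\Big)+\eta,\quad L^i(\theta,\eta)=\mathbb E_{\xi\sim\mathbb P^i}L^i(\theta,\eta;\xi),\quad \phi^i(\theta)=\inf_{\eta\in\mathbb R}L^i(\theta,\eta),$$ $\nabla\Phi(\theta)w=\sum_i w^i\nabla\phi^i(\theta)$, and let $\mathcal W\subset\mathbb R^m$ be the probability simplex. Assumptions. There are $G,L,M>0$, $\kappa\ge0$ such that: each $\ell^i(\cdot;\xi)$ is $G$-Lipschitz and $L$-smooth; each $\ell^i(\theta;\cdot)$ has variance at most $\kappa^2$ under $\mathbb P^i$; $f$ is convex, $f(1)=0$, $f(0)=\lim_{t\to0^+}f(t)$, and $f^*$ is finite and $M$-smooth; each $\phi^i$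 is bounded below, with infimum $\phi^{i,*}$. Let $\Delta_{\theta_0}=\max_i(\phi^i(\theta_0)-\phi^{i,*})$. Algorithm (double-loop MGDA). Start from $\theta_0\in\mathbb R^n$, $w_0\in\mathcal W$, $\eta_{0,0}\in\mathbb R^m$. For $t=0,\dots,T-1$: for $d=0,\dots,D-1$ and each $i$ draw $\xi^i_{t,d}\sim\mathbb P^i$ and set $\eta^i_{t,d+1}=\eta^i_{t,d}-\gamma\,\partial_\eta L^i(\theta_t,\eta^i_{t,d};\xi^i_{t,d})$; draw three indices $d,\bar d,\tilde d$ uniformly from $\{0,\dots,D-1\}$ and three samples $\xi_t,\bar\xi_t,\tilde\xi_t$ (with $i$-th components distributed as $\mathbb P^i$), all independent of each other and of all other draws; let $Y_t,\bar Y_t,\tilde Y_t\in\mathbb R^{n\times m}$ have $i$-th columns $\nabla_\theta L^i(\theta_t,\eta^i_{t,d};\xi^i_t)$, $\nabla_\theta L^i(\theta_t,\eta^i_{t,\bar d};\bar\xi^i_t)$, $\nabla_\theta L^i(\theta_t,\eta^i_{t,\tilde d};\tilde\xi^i_t)$; and set $$\theta_{t+1}=\theta_t-\alpha Y_tw_t,\qquad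 w_{t+1}=\Pi_{\mathcal W}\big(w_t-\beta(\bar Y_t^\top\tilde Y_tw_t+\rho w_t)\big).$$ The next inner loop starts at $\eta_{t+1,0}=r(\eta_{t,D})$ for a fixed measurable map $r$ (for instance $r=\mathrm{id}$, or $r\equiv\eta_{0,0}$). The $m$ components of one sample may be dependent, with the same joint law for all samples. Theorem. The functions $\phi^i$ are differentiable. There are constants $c_\rho,c_\alpha,c_\beta,c_\gamma,c_T,c_D>0$ depending only on $m,G,L,M,\lambda,\kappa$ such that for all $0<\epsilon,\delta<1$ the following holds. Put $$\rho=c_\rho\delta^2\epsilon^2,\quad \alpha=c_\alpha\delta^2\epsilon^2,\quad \beta=c_\beta\delta^2\epsilon^2,\quad \gamma=c_\gamma\delta^2\epsilon^4,\quad T=\big\lceil c_T\max\{\Delta_{\theta_0}\alpha^{-1}\delta^{-1}\epsilon^{-2},\ \beta^{-1}\delta^{-1}\epsilon^{-2}\}\big\rceil$$ (so $T=\Theta(\delta^{-3}\epsilon^{-4})$ for a fixed problem), let $\Delta_\eta\ge0$ and $D=\max\{1,\lceil c_D\,\Delta_\eta\gamma^{-1}\delta^{-2}\epsilon^{-4}\rceil\}$.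 If the algorithm run with these parameters satisfies $\mathbb E\big[L^i(\theta_t,\eta^i_{t,0})-\phi^i(\theta_t)\big]\le\Delta_\eta$ for all $t<T$ and all $i$, then with probability at least $1-\delta$ $$\frac1T\sum_{t=0}^{T-1}\|\nabla\Phi(\theta_t)w_t\|^2\le 78\,\epsilon^2,$$ and some $\theta_t$ with $t<T$ is $\sqrt{78}\,\epsilon$-distributionally robust Pareto-stationary, that is, $\|\nabla\Phi(\theta_t)w\|\le\sqrt{78}\,\epsilon$ for some $w\in\mathcal W$. -/

import Mathlib

open MeasureTheory ProbabilityTheory Filter Topology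
open scoped NNReal ENNReal

noncomputable section

namespace DRMOO

/-- The convex conjugate `f*(s) = sup_{t ≥ 0} (s t - f(t))` of `f : [0,∞) → (-∞,+∞]`. -/
def conj (f : ℝ≥0 → EReal) (s : ℝ) : EReal :=
  ⨆ t : ℝ≥0, ((s * (t : ℝ) : ℝ) : EReal) - f t

/-- The convex conjugate as a real function (used only where it is finite). -/
def conjR (f : ℝ≥0 → EReal) (s : ℝ) : ℝ := (conj f s).toReal

/-- `f : [0,∞) → (-∞,+∞]` is convex with `f 1 = 0` and `f 0 = lim_{t → 0+} f t`, and its convex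
conjugate is (finite and) `M`-smooth. -/
structure IsDivergenceGenerator (f : ℝ≥0 → EReal) (M : ℝ) : Prop where
  ne_bot : ∀ t, f t ≠ ⊥
  convex : ∀ s t a b : ℝ≥0, a + b = 1 →
    f (a * s + b * t) ≤ ((a : ℝ) : EReal) * f s + ((b : ℝ) : EReal) * f t
  map_one : f 1 = 0
  tendsto_zero : Tendsto f (𝓝[>] 0) (𝓝 (f 0))
  conj_ne_top : ∀ s, conj f s ≠ ⊤
  conj_differentiable : Differentiable ℝ (conjR f)
  conj_smooth : ∀ s s', |deriv (conjR f) s - deriv (conjR f) s'| ≤ M * |s - s'|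

/-- The data of a distributionally robust multi-objective problem with `m` objectives, parameter
space `ℝⁿ`, regularization parameter `lam` and samples in `Ξ`. -/
structure Problem (n m : ℕ) (lam : ℝ) (Ξ : Type*) [MeasurableSpace Ξ] where
  /-- the losses `ℓ^i(θ; ξ)` -/
  loss : Fin m → EuclideanSpace ℝ (Fin n) → Ξ → ℝ
  /-- the nominal distributions `ℙ^i` -/
  P : Fin m → Measure Ξ
  /-- the generator of the divergence -/
  f : ℝ≥0 → EReal

variable {n m : ℕ} {lam : ℝ} {Ξ : Type*} [MeasurableSpace Ξ]

/-- The standing assumptions on the losses, the nominal distributions and the divergence. -/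
structure Problem.Regular (p : Problem n m lam Ξ) (G L M κ : ℝ) : Prop where
  isProbabilityMeasure : ∀ i, IsProbabilityMeasure (p.P i)
  measurable : ∀ i θ, Measurable (p.loss i θ)
  lipschitz : ∀ i ξ θ θ', |p.loss i θ ξ - p.loss i θ' ξ| ≤ G * ‖θ - θ'‖
  differentiable : ∀ i ξ, Differentiable ℝ (fun θ => p.loss i θ ξ)
  smooth : ∀ i ξ θ θ',
    ‖gradient (fun θ => p.loss i θ ξ) θ - gradient (fun θ => p.loss i θ ξ) θ'‖ ≤ L * ‖θ - θ'‖
  memLp : ∀ i θ, MemLp (p.loss i θ) 2 (p.P i)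
  variance_le : ∀ i θ, Var[p.loss i θ; p.P i] ≤ κ ^ 2
  generator : IsDivergenceGenerator p.f M

/-- The sampled dual objective `L^i(θ, η; ξ) = λ f*((ℓ^i(θ;ξ) - η)/λ) + η`. -/
def Problem.sampleObj (p : Problem n m lam Ξ) (i : Fin m) (θ : EuclideanSpace ℝ (Fin n))
    (η : ℝ) (ξ : Ξ) : ℝ :=
  lam * conjR p.f ((p.loss i θ ξ - η) / lam) + η

/-- The dual objective `L^i(θ, η) = λ 𝔼_{ξ ∼ ℙ^i} f*((ℓ^i(θ;ξ) - η)/λ) + η`. -/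
def Problem.obj (p : Problem n m lam Ξ) (i : Fin m) (θ : EuclideanSpace ℝ (Fin n)) (η : ℝ) : ℝ :=
  lam * (∫ ξ, conjR p.f ((p.loss i θ ξ - η) / lam) ∂(p.P i)) + η

/-- `φ^i(θ) = inf_η L^i(θ, η)`. -/
def Problem.phi (p : Problem n m lam Ξ) (i : Fin m) (θ : EuclideanSpace ℝ (Fin n)) : ℝ :=
  ⨅ η : ℝ, p.obj i θ η

/-- The initial gap `max_i (φ^i(θ) - inf φ^i)`. -/
def Problem.gap (p : Problem n m lam Ξ) (θ : EuclideanSpace ℝ (Fin n)) : ℝ :=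
  ⨆ i : Fin m, (p.phi i θ - ⨅ θ', p.phi i θ')

/-- `∇Φ(θ) w = ∑ i, w^i ∇φ^i(θ)`. -/
def Problem.gradPhi (p : Problem n m lam Ξ) (θ : EuclideanSpace ℝ (Fin n))
    (w : EuclideanSpace ℝ (Fin m)) : EuclideanSpace ℝ (Fin n) :=
  ∑ i, w i • gradient (p.phi i) θ

/-- The probability simplex `𝒲` in `ℝᵐ`. -/
def simplex (m : ℕ) : Set (EuclideanSpace ℝ (Fin m)) :=
  {w | (∀ i, 0 ≤ w i) ∧ ∑ i, w i = 1}

/-- `θ` is an `ε`-distributionally robust Pareto-stationary point. -/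
def Problem.IsParetoStationary (p : Problem n m lam Ξ) (ε : ℝ)
    (θ : EuclideanSpace ℝ (Fin n)) : Prop :=
  ∃ w ∈ simplex m, ‖p.gradPhi θ w‖ ≤ ε

/-- The Euclidean projection onto the probability simplex: the nearest point of the simplex. -/
def proj (v : EuclideanSpace ℝ (Fin m)) : EuclideanSpace ℝ (Fin m) :=
  Classical.epsilon fun u => u ∈ simplex m ∧ ∀ u' ∈ simplex m, ‖v - u‖ ≤ ‖v - u'‖

/-- The projection really is a nearest point of the simplex (which is nonempty for `m > 0`). -/
theorem proj_spec (h : 0 < m) (v : EuclideanSpace ℝ (Fin m)) :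
    proj v ∈ simplex m ∧ ∀ u' ∈ simplex m, ‖v - proj v‖ ≤ ‖v - u'‖ := by
  have hcl : IsClosed (simplex m) := by
    have : simplex m = (⋂ i, {w | 0 ≤ w i}) ∩ {w | ∑ i, w i = 1} := by
      ext w; simp [simplex]
    rw [this]
    refine IsClosed.inter (isClosed_iInter fun i => isClosed_le continuous_const (by fun_prop))
      (isClosed_eq (by fun_prop) continuous_const)
  have hne : (simplex m).Nonempty := by
    refine ⟨EuclideanSpace.single ⟨0, h⟩ 1, fun i => ?_, ?_⟩
    · by_cases hi : i = ⟨0, h⟩ <;> simp [hi]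
    · simp
  obtain ⟨u, hu, hmin⟩ := hcl.exists_infDist_eq_dist hne v
  refine Classical.epsilon_spec (p := fun u => u ∈ simplex m ∧ ∀ u' ∈ simplex m,
    ‖v - u‖ ≤ ‖v - u'‖) ⟨u, hu, fun u' hu' => ?_⟩
  rw [← dist_eq_norm, ← dist_eq_norm, ← hmin]
  exact Metric.infDist_le_dist_of_mem hu'

/-- The stochastic gradient `∇_θ L^i(θ, η; ξ)`. -/
def Problem.gradTheta (p : Problem n m lam Ξ) (i : Fin m) (θ : EuclideanSpace ℝ (Fin n))
    (η : ℝ) (ξ : Ξ) : EuclideanSpace ℝ (Fin n) :=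
  gradient (fun θ' => p.sampleObj i θ' η ξ) θ

/-- The stochastic derivative `∇_η L^i(θ, η; ξ)`. -/
def Problem.gradEta (p : Problem n m lam Ξ) (i : Fin m) (θ : EuclideanSpace ℝ (Fin n))
    (η : ℝ) (ξ : Ξ) : ℝ :=
  deriv (fun η' => p.sampleObj i θ η' ξ) η

/-- The parameters of the double-loop algorithm. -/
structure Params where
  /-- step size of `θ` -/
  α : ℝ
  /-- step size of `w` -/
  β : ℝ
  /-- step size of the inner loop -/
  γ : ℝ
  /-- regularization of the `w`-step -/
  ρ : ℝ

/-- The random draws of one outer iteration: the inner samples `ξ^i_{t,d}`, the three outer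
samples `ξ_t, ξ̄_t, ξ̃_t` and the three inner-loop indices `d, d̄, d̃`. -/
abbrev Batch (m D : ℕ) (Ξ : Type*) : Type _ :=
  (Fin D → Fin m → Ξ) × (Fin 3 → Fin m → Ξ) × (Fin 3 → Fin D)

/-- The law of the draws of one outer iteration: all samples and indices are independent, each
sample vector `(ξ^i)_i` has law `ν`, each index is uniform on `{0, …, D-1}`. -/
def batchLaw (ν : Measure (Fin m → Ξ)) (D : ℕ) : Measure (Batch m D Ξ) :=
  (Measure.pi fun _ : Fin D => ν).prod
    ((Measure.pi fun _ : Fin 3 => ν).prod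
      (Measure.pi fun _ : Fin 3 => uniformOn (Set.univ : Set (Fin D))))

/-- The inner SGD iterates `η_{t,d}`, started at `η₀`. -/
def Problem.inner (p : Problem n m lam Ξ) (γ : ℝ) {D : ℕ} (θ : EuclideanSpace ℝ (Fin n))
    (η₀ : Fin m → ℝ) (x : Fin D → Fin m → Ξ) : ℕ → Fin m → ℝ
  | 0 => η₀
  | d + 1 => fun i =>
      if h : d < D then
        p.inner γ θ η₀ x d i - γ * p.gradEta i θ (p.inner γ θ η₀ x d i) (x ⟨d, h⟩ i)
      else p.inner γ θ η₀ x d i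

/-- The state `(θ_t, w_t, η_{t,0})` at the beginning of an outer iteration. -/
abbrev State (n m : ℕ) : Type :=
  EuclideanSpace ℝ (Fin n) × EuclideanSpace ℝ (Fin m) × (Fin m → ℝ)

/-- The stochastic gradient matrix `∇_θ L(θ_t, η_{t,d}; ξ)` (its columns), for the `j`-th of the
three independent pairs of index and sample. -/
def Problem.estimate (p : Problem n m lam Ξ) (γ : ℝ) {D : ℕ} (s : State n m) (b : Batch m D Ξ)
    (j : Fin 3) (i : Fin m) : EuclideanSpace ℝ (Fin n) :=
  p.gradTheta i s.1 (p.inner γ s.1 s.2.2 b.1 (b.2.2 j) i) (b.2.1 j i)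

/-- One outer iteration. With `Y, Ȳ, Ỹ` the three estimates,
`θ⁺ = θ - α Y w` and `w⁺ = Π_𝒲(w - β (Ȳᵀ Ỹ w + ρ w))`; the next inner loop starts at
`start η_{t,D}` (`start = id`: warm start; `start` constant: restart at a fixed point). -/
def Problem.step (p : Problem n m lam Ξ) (a : Params) (start : (Fin m → ℝ) → Fin m → ℝ) {D : ℕ}
    (s : State n m) (b : Batch m D Ξ) : State n m :=
  (s.1 - a.α • ∑ i, s.2.1 i • p.estimate a.γ s b 0 i,
   proj (s.2.1 - a.β •
    (WithLp.toLp 2 (fun i =>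
        Inner.inner ℝ (p.estimate a.γ s b 1 i) (∑ k, s.2.1 k • p.estimate a.γ s b 2 k))
      + a.ρ • s.2.1)),
   start (p.inner a.γ s.1 s.2.2 b.1 D))

/-- The state at the beginning of outer iteration `t`, driven by the draws `b 0, b 1, …`. -/
def Problem.run (p : Problem n m lam Ξ) (a : Params) (start : (Fin m → ℝ) → Fin m → ℝ) {D : ℕ}
    (s₀ : State n m) (b : ℕ → Batch m D Ξ) : ℕ → State n m
  | 0 => s₀
  | t + 1 => p.step a start (p.run a start s₀ b t) (b t)

end DRMOO

end

noncomputable section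

namespace DRMOO

/-! ### Smooth functions and the conjugate -/

/-! Write `N = M / lam`. The derivatives of the sampled dual objective are governed by the weight
`(f*)'((ℓ - η)/λ)`: the `η`-derivative is `1 - weight`, and the `θ`-gradient is the weight times the
gradient of the loss. Since `f` lives on `[0,∞)`, `f*` is monotone and convex, so weights are
nonnegative and decrease in `η`. Let `d` be the mean `η`-derivative. It controls everything that an
inexact `η` can spoil.

Bias: for `η ≤ η'` the difference of weights has a sign, so the two `θ`-gradients differ by at most
`G` times the difference of their values of `d` (`norm_meanGradTheta_sub_le`). Along a minimizing
sequence in `η` one has `d → 0`, hence the `θ`-gradients converge. Their limit is `∇φ`, which is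
Lipschitz, and the bias at any `η` is at most `G |d|` (`hasGradientAt_phi`,
`norm_meanGradTheta_sub_gradient_le`). Noise: a weight has mean `1 - d` and variance at most
`(Nκ)²`, so second moments grow only like `1 + d²`. The inner loop is SGD on a smooth function of
`η`; telescoping bounds the expectation of `q`, the sum over the tasks of the average of `d²` along
the loop (`lintegral_innerError_le`).

For the outer loop fix `u` in the simplex and use the potential `∑ uᵢ(φⁱ - inf φⁱ)/α + ‖w -
u‖²/(2β)`. Let `V`, `V'` be the mean estimates combined with `w`, `u`. The descent inequality
contributes `-⟪∇Φ u, V⟫` and the projected step, by independence of its two factors, contributes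
`-⟪V - V', V⟫`. Because `V'` is close to `∇Φ u`, the terms in `u` nearly cancel and `-‖V‖²` remains,
which is comparable to `-‖∇Φ w‖²` (`neg_inner_sub_inner_le`).

The second moment of the `w`-direction is quadratic in `1 + q`, whereas only the mean of `q` is
controlled. For `q > 1` the bound coming from the diameter of the simplex is therefore used, which
is linear in `q` (`norm_proj_sub_sq_le`, `lintegral_potential_step_fixed_inner_le`). Summing over
`t` with `u = w₀` and applying Markov's inequality gives the theorem. Expectations are mostly kept
in `ℝ≥0∞`, with the decrease on the left-hand side, so neither subtraction nor integrability along
the run is needed. -/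

theorem abs_sub_sub_inner_gradient_le {E : Type*} [NormedAddCommGroup E] [InnerProductSpace ℝ E]
    [CompleteSpace E] {g : E → ℝ} {K : ℝ} (hK : 0 ≤ K) (hg : Differentiable ℝ g)
    (hsm : ∀ x y, ‖gradient g x - gradient g y‖ ≤ K * ‖x - y‖) (x y : E) :
    |g y - g x - inner ℝ (gradient g x) (y - x)| ≤ K * ‖y - x‖ ^ 2 := by
  -- The mean value inequality on the segment gives the constant `K`; the sharper `K / 2` would need
  -- an integral along the segment and is not needed.
  have key := Convex.norm_image_sub_le_of_norm_fderiv_le' (𝕜 := ℝ) (f := g) (C := K * ‖y - x‖)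
    (s := segment ℝ x y) (x := x) (y := y) (φ := fderiv ℝ g x) (fun z _ => hg z) (fun z hz => ?_)
    (convex_segment x y) (left_mem_segment ℝ x y) (right_mem_segment ℝ x y)
  · have h1 : fderiv ℝ g x (y - x) = inner ℝ (gradient g x) (y - x) := by
      rw [gradient, InnerProductSpace.toDual_symm_apply]
    rw [h1, Real.norm_eq_abs] at key
    calc _ ≤ _ := key
      _ = _ := by ring
  · have h2 : ‖fderiv ℝ g z - fderiv ℝ g x‖ = ‖gradient g z - gradient g x‖ := by
      rw [gradient, gradient, ← map_sub, LinearIsometryEquiv.norm_map]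
    rw [h2]
    refine (hsm z x).trans (mul_le_mul_of_nonneg_left ?_ hK)
    have := norm_sub_le_of_mem_segment hz
    simpa [norm_sub_rev] using this

namespace IsDivergenceGenerator

variable {f : ℝ≥0 → EReal} {M : ℝ}

theorem coe_conjR (hf : IsDivergenceGenerator f M) (s : ℝ) : ((conjR f s : ℝ) : EReal) = conj f s := by
  refine EReal.coe_toReal (hf.conj_ne_top s) ?_
  have h1 : ((s * ((1 : ℝ≥0) : ℝ) : ℝ) : EReal) - f 1 ≤ conj f s :=
    le_iSup (fun t : ℝ≥0 => ((s * (t : ℝ) : ℝ) : EReal) - f t) 1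
  rw [hf.map_one, sub_zero] at h1
  intro h2
  rw [h2] at h1
  exact absurd (le_bot_iff.1 h1) (EReal.coe_ne_bot _)

theorem sub_le_conjR (hf : IsDivergenceGenerator f M) (s : ℝ) {t : ℝ≥0} {r : ℝ}
    (ht : f t = (r : EReal)) : s * t - r ≤ conjR f s := by
  have h1 : ((s * (t : ℝ) : ℝ) : EReal) - f t ≤ conj f s :=
    le_iSup (fun t : ℝ≥0 => ((s * (t : ℝ) : ℝ) : EReal) - f t) t
  rw [ht, ← hf.coe_conjR, ← EReal.coe_sub, EReal.coe_le_coe_iff] at h1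
  exact h1

theorem conjR_le (hf : IsDivergenceGenerator f M) {s c : ℝ}
    (h : ∀ (t : ℝ≥0) (r : ℝ), f t = (r : EReal) → s * t - r ≤ c) : conjR f s ≤ c := by
  rw [← EReal.coe_le_coe_iff, hf.coe_conjR]
  refine iSup_le fun t => ?_
  rcases eq_or_ne (f t) ⊤ with h1 | h1
  · rw [h1]; simp
  · have h2 := EReal.coe_toReal h1 (hf.ne_bot t)
    rw [← h2, ← EReal.coe_sub, EReal.coe_le_coe_iff]
    exact h t _ h2.symm

/-- The term `t = 1` of the supremum, where `f` vanishes. This bounds the dual objective below by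
the mean loss. -/
theorem le_conjR (hf : IsDivergenceGenerator f M) (s : ℝ) : s ≤ conjR f s := by
  simpa using hf.sub_le_conjR s (t := 1) (r := 0) (by simpa using hf.map_one)

theorem monotone_conjR (hf : IsDivergenceGenerator f M) : Monotone (conjR f) := fun s s' hs =>
  hf.conjR_le fun t r ht => by
    have h1 := hf.sub_le_conjR s' ht
    have h2 := mul_le_mul_of_nonneg_right hs t.2
    change s * (t : ℝ) ≤ s' * t at h2
    linarith

theorem convexOn_conjR (hf : IsDivergenceGenerator f M) : ConvexOn ℝ Set.univ (conjR f) := by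
  refine ⟨convex_univ, fun s _ s' _ a b ha hb hab => hf.conjR_le fun t r ht => ?_⟩
  have h1 := mul_le_mul_of_nonneg_left (hf.sub_le_conjR s ht) ha
  have h2 := mul_le_mul_of_nonneg_left (hf.sub_le_conjR s' ht) hb
  simp only [smul_eq_mul]
  have h3 : r = a * r + b * r := by rw [← add_mul, hab, one_mul]
  linarith

theorem monotone_deriv_conjR (hf : IsDivergenceGenerator f M) : Monotone (deriv (conjR f)) := by
  have := hf.convexOn_conjR.monotoneOn_deriv (fun x _ => hf.conj_differentiable x)
  rwa [monotoneOn_univ] at this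

theorem deriv_conjR_nonneg (hf : IsDivergenceGenerator f M) (s : ℝ) : 0 ≤ deriv (conjR f) s :=
  hf.monotone_conjR.deriv_nonneg

theorem continuous_deriv_conjR (hf : IsDivergenceGenerator f M) :
    Continuous (deriv (conjR f)) := by
  refine (LipschitzWith.of_dist_le_mul (K := M.toNNReal) fun s s' => ?_).continuous
  rw [Real.dist_eq, Real.dist_eq]
  exact (hf.conj_smooth s s').trans
    (mul_le_mul_of_nonneg_right (Real.le_coe_toNNReal M) (abs_nonneg _))

theorem abs_conjR_sub_le (hf : IsDivergenceGenerator f M) (hM : 0 ≤ M) (s s' : ℝ) :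
    |conjR f s' - conjR f s - deriv (conjR f) s * (s' - s)| ≤ M * (s' - s) ^ 2 := by
  have hgr : ∀ x, gradient (conjR f) x = deriv (conjR f) x := fun x =>
    (hf.conj_differentiable x).hasGradientAt.hasDerivAt'.deriv.symm ▸ by simp
  have := abs_sub_sub_inner_gradient_le hM hf.conj_differentiable (fun x y => ?_) s s'
  · simpa [hgr, mul_comm] using this
  · simpa [hgr] using hf.conj_smooth x y

theorem abs_mul_conjR_div_sub_le (hf : IsDivergenceGenerator f M) (hM : 0 ≤ M) {lam : ℝ}
    (hlam : 0 < lam) (a a' : ℝ) :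
    |lam * conjR f (a' / lam) - lam * conjR f (a / lam) - deriv (conjR f) (a / lam) * (a' - a)| ≤
      M / lam * (a' - a) ^ 2 := by
  have h3 := mul_le_mul_of_nonneg_left (hf.abs_conjR_sub_le hM (a / lam) (a' / lam)) hlam.le
  have h4 : lam * |conjR f (a' / lam) - conjR f (a / lam) -
      deriv (conjR f) (a / lam) * (a' / lam - a / lam)| =
      |lam * conjR f (a' / lam) - lam * conjR f (a / lam) -
        deriv (conjR f) (a / lam) * (a' - a)| := by
    conv_lhs => enter [1]; rw [← abs_of_pos hlam]
    rw [← abs_mul]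
    congr 1
    field_simp
  rw [h4] at h3
  refine h3.trans (le_of_eq ?_)
  field_simp

end IsDivergenceGenerator

/-! ### The dual objective of a single task -/

variable {n m : ℕ} {lam : ℝ} {Ξ : Type*} [MeasurableSpace Ξ]

/-- The weight `(f*)'((ℓ^i(θ;ξ) - η)/λ)` of the sample `ξ`. -/
def Problem.weight (p : Problem n m lam Ξ) (i : Fin m) (θ : EuclideanSpace ℝ (Fin n)) (η : ℝ)
    (ξ : Ξ) : ℝ :=
  deriv (conjR p.f) ((p.loss i θ ξ - η) / lam)

/-- The gradient of the loss of the `i`-th task. -/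
def Problem.lossGrad (p : Problem n m lam Ξ) (i : Fin m) (θ : EuclideanSpace ℝ (Fin n))
    (ξ : Ξ) : EuclideanSpace ℝ (Fin n) :=
  gradient (fun θ => p.loss i θ ξ) θ

/-- The derivative `∂_η L^i(θ, η)`. -/
def Problem.meanGradEta (p : Problem n m lam Ξ) (i : Fin m) (θ : EuclideanSpace ℝ (Fin n))
    (η : ℝ) : ℝ :=
  1 - ∫ ξ, p.weight i θ η ξ ∂(p.P i)

/-- The gradient `∇_θ L^i(θ, η)`. -/
def Problem.meanGradTheta (p : Problem n m lam Ξ) (i : Fin m) (θ : EuclideanSpace ℝ (Fin n))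
    (η : ℝ) : EuclideanSpace ℝ (Fin n) :=
  ∫ ξ, p.weight i θ η ξ • p.lossGrad i θ ξ ∂(p.P i)

namespace Problem.Regular

variable {p : Problem n m lam Ξ} {G L M κ : ℝ}

theorem gradEta_eq (h : p.Regular G L M κ) (hlam : lam ≠ 0) (i : Fin m)
    (θ : EuclideanSpace ℝ (Fin n)) (η : ℝ) (ξ : Ξ) :
    p.gradEta i θ η ξ = 1 - p.weight i θ η ξ := by
  have h1 : HasDerivAt (fun η' => (p.loss i θ ξ - η') / lam) (-1 / lam) η :=
    ((hasDerivAt_id η).const_sub _).div_const lam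
  have h2 := ((h.generator.conj_differentiable _).hasDerivAt.comp η h1).const_mul lam
  have h3 := (h2.add (hasDerivAt_id η)).deriv
  have h4 : p.gradEta i θ η ξ = lam * (p.weight i θ η ξ * (-1 / lam)) + 1 := h3
  rw [h4]
  field_simp
  ring

theorem gradTheta_eq (h : p.Regular G L M κ) (hlam : lam ≠ 0) (i : Fin m)
    (θ : EuclideanSpace ℝ (Fin n)) (η : ℝ) (ξ : Ξ) :
    p.gradTheta i θ η ξ = p.weight i θ η ξ • p.lossGrad i θ ξ := by
  have h0 : HasFDerivAt (fun θ' => p.loss i θ' ξ)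
    (InnerProductSpace.toDual ℝ _ (p.lossGrad i θ ξ)) θ :=
    (h.differentiable i ξ θ).hasGradientAt.hasFDerivAt
  have h1 : HasFDerivAt (fun θ' => (p.loss i θ' ξ - η) / lam) _ θ :=
    ((h0.sub_const η).mul_const lam⁻¹)
  have h2 := (((h.generator.conj_differentiable _).hasDerivAt.comp_hasFDerivAt θ h1).const_mul
    lam).add_const η
  refine HasGradientAt.gradient ?_
  rw [hasGradientAt_iff_hasFDerivAt]
  refine h2.congr_fderiv ?_
  rw [map_smul, smul_smul, smul_smul]
  congr 1
  rw [weight]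
  field_simp

theorem weight_nonneg (h : p.Regular G L M κ) (i : Fin m)
    (θ : EuclideanSpace ℝ (Fin n)) (η : ℝ) (ξ : Ξ) : 0 ≤ p.weight i θ η ξ :=
  h.generator.deriv_conjR_nonneg _

theorem weight_antitone (h : p.Regular G L M κ) (hlam : 0 < lam) (i : Fin m)
    (θ : EuclideanSpace ℝ (Fin n)) (ξ : Ξ) {η η' : ℝ} (hη : η ≤ η') :
    p.weight i θ η' ξ ≤ p.weight i θ η ξ :=
  h.generator.monotone_deriv_conjR (by gcongr)

theorem abs_weight_sub_le (h : p.Regular G L M κ) (hlam : 0 < lam) (i : Fin m)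
    (θ θ' : EuclideanSpace ℝ (Fin n)) (η η' : ℝ) (ξ ξ' : Ξ) :
    |p.weight i θ η ξ - p.weight i θ' η' ξ'| ≤
      M / lam * |(p.loss i θ ξ - η) - (p.loss i θ' ξ' - η')| := by
  refine (h.generator.conj_smooth _ _).trans (le_of_eq ?_)
  rw [← sub_div, abs_div, abs_of_pos hlam]
  ring

theorem norm_lossGrad_le (h : p.Regular G L M κ) (hG : 0 ≤ G) (i : Fin m)
    (θ : EuclideanSpace ℝ (Fin n)) (ξ : Ξ) : ‖p.lossGrad i θ ξ‖ ≤ G := by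
  have h1 : LipschitzWith ⟨G, hG⟩ (fun θ => p.loss i θ ξ) :=
    LipschitzWith.of_dist_le_mul fun x y => by
      rw [Real.dist_eq, dist_eq_norm]; exact h.lipschitz i ξ x y
  have h2 := norm_fderiv_le_of_lipschitz ℝ (x₀ := θ) h1
  rw [lossGrad, gradient, LinearIsometryEquiv.norm_map]
  exact h2

theorem abs_loss_sub_le (h : p.Regular G L M κ) (hL : 0 ≤ L) (i : Fin m)
    (θ θ' : EuclideanSpace ℝ (Fin n)) (ξ : Ξ) :
    |p.loss i θ' ξ - p.loss i θ ξ - Inner.inner ℝ (p.lossGrad i θ ξ) (θ' - θ)| ≤ L * ‖θ' - θ‖ ^ 2 :=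
  abs_sub_sub_inner_gradient_le hL (h.differentiable i ξ) (h.smooth i ξ) θ θ'

theorem continuous_loss (h : p.Regular G L M κ) (i : Fin m) (ξ : Ξ) :
    Continuous fun θ => p.loss i θ ξ :=
  (h.differentiable i ξ).continuous

theorem continuous_lossGrad (h : p.Regular G L M κ) (i : Fin m) (ξ : Ξ) :
    Continuous fun θ => p.lossGrad i θ ξ := by
  refine (LipschitzWith.of_dist_le_mul (K := L.toNNReal) fun θ θ' => ?_).continuous
  rw [dist_eq_norm, dist_eq_norm]
  exact (h.smooth i ξ θ θ').trans
    (mul_le_mul_of_nonneg_right (Real.le_coe_toNNReal L) (norm_nonneg _))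

/-! ### Measurability and integrability of losses, weights and gradients -/

theorem measurable_loss_uncurry (h : p.Regular G L M κ) (i : Fin m) :
    Measurable fun x : EuclideanSpace ℝ (Fin n) × Ξ => p.loss i x.1 x.2 :=
  measurable_uncurry_of_continuous_of_measurable (u := fun θ ξ => p.loss i θ ξ)
    (h.continuous_loss i) (h.measurable i)

theorem measurable_weight_uncurry (h : p.Regular G L M κ) (i : Fin m) :
    Measurable fun x : EuclideanSpace ℝ (Fin n) × ℝ × Ξ => p.weight i x.1 x.2.1 x.2.2 := by
  refine h.generator.continuous_deriv_conjR.measurable.comp ?_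
  have := (h.measurable_loss_uncurry i).comp
    (measurable_fst.prodMk (measurable_snd.comp measurable_snd) :
      Measurable fun x : EuclideanSpace ℝ (Fin n) × ℝ × Ξ => (x.1, x.2.2))
  exact (this.sub (measurable_fst.comp measurable_snd)).div_const lam

theorem measurable_weight (h : p.Regular G L M κ) (i : Fin m) (θ : EuclideanSpace ℝ (Fin n))
    (η : ℝ) : Measurable (p.weight i θ η) :=
  (h.measurable_weight_uncurry i).comp
    (measurable_const.prodMk (measurable_const.prodMk measurable_id))

/-- Each coordinate is a directional derivative, hence the pointwise limit of difference quotients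
with increments `1/(k+1)`, which are measurable in `ξ`. -/
theorem measurable_lossGrad (h : p.Regular G L M κ) (i : Fin m) (θ : EuclideanSpace ℝ (Fin n)) :
    Measurable (p.lossGrad i θ) := by
  have key : ∀ j, Measurable fun ξ => p.lossGrad i θ ξ j := by
    intro j
    have e : ∀ ξ, p.lossGrad i θ ξ j
        = deriv (fun r : ℝ => p.loss i (θ + r • EuclideanSpace.single j (1 : ℝ)) ξ) 0 := by
      intro ξ
      have h0 : HasFDerivAt (fun θ' => p.loss i θ' ξ)
        (InnerProductSpace.toDual ℝ _ (p.lossGrad i θ ξ)) (θ + (0 : ℝ) • EuclideanSpace.single j (1 : ℝ)) := by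
        rw [zero_smul, add_zero]
        exact (h.differentiable i ξ θ).hasGradientAt.hasFDerivAt
      have h1 : HasDerivAt (fun r : ℝ => θ + r • EuclideanSpace.single j (1 : ℝ))
          (EuclideanSpace.single j (1 : ℝ)) 0 := by
        simpa using ((hasDerivAt_id (0 : ℝ)).smul_const
          (EuclideanSpace.single j (1 : ℝ))).const_add θ
      have h2 := (h0.comp_hasDerivAt (0 : ℝ) h1).deriv
      rw [Function.comp_def] at h2
      rw [h2]
      simp [EuclideanSpace.inner_single_right]
    refine measurable_of_tendsto_metrizable (f := fun (k : ℕ) ξ =>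
      ((1 : ℝ) / (k + 1))⁻¹ * (p.loss i (θ + ((1 : ℝ) / (k + 1)) • EuclideanSpace.single j (1 : ℝ)) ξ
        - p.loss i θ ξ))
      (fun k => ((h.measurable i _).sub (h.measurable i _)).const_mul _) ?_
    rw [tendsto_pi_nhds]
    intro ξ
    rw [e]
    have hd : DifferentiableAt ℝ
        (fun r : ℝ => p.loss i (θ + r • EuclideanSpace.single j (1 : ℝ)) ξ) 0 :=
      (h.differentiable i ξ).differentiableAt.comp _ (by fun_prop)
    have h2 := hd.hasDerivAt.tendsto_slope_zero
    have h3 : Tendsto (fun k : ℕ => (1 : ℝ) / (k + 1)) atTop (𝓝[≠] 0) := by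
      refine tendsto_nhdsWithin_iff.2 ⟨tendsto_one_div_add_atTop_nhds_zero_nat, ?_⟩
      refine Eventually.of_forall fun k => ?_
      have : (0 : ℝ) < 1 / (k + 1) := by positivity
      exact this.ne'
    have h4 := h2.comp h3
    simpa [Function.comp_def] using h4
  have : Measurable fun ξ => WithLp.ofLp (p.lossGrad i θ ξ) := measurable_pi_iff.2 key
  exact (WithLp.measurable_toLp 2 _).comp this

theorem measurable_lossGrad_uncurry (h : p.Regular G L M κ) (i : Fin m) :
    Measurable fun x : EuclideanSpace ℝ (Fin n) × Ξ => p.lossGrad i x.1 x.2 :=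
  measurable_uncurry_of_continuous_of_measurable (u := fun θ ξ => p.lossGrad i θ ξ)
    (h.continuous_lossGrad i) (h.measurable_lossGrad i)

theorem memLp_loss_sub (h : p.Regular G L M κ) (i : Fin m) (θ : EuclideanSpace ℝ (Fin n))
    (η : ℝ) : MemLp (fun ξ => (p.loss i θ ξ - η) / lam) 2 (p.P i) := by
  have := h.isProbabilityMeasure i
  have h1 := ((h.memLp i θ).sub (memLp_const η)).const_mul lam⁻¹
  refine h1.ae_eq (Eventually.of_forall fun ξ => ?_)
  simp [div_eq_inv_mul]

/-- The derivative of `f*` is Lipschitz, so a weight grows at most linearly in the loss, which is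
square integrable. -/
theorem memLp_weight (h : p.Regular G L M κ) (i : Fin m) (θ : EuclideanSpace ℝ (Fin n))
    (η : ℝ) : MemLp (p.weight i θ η) 2 (p.P i) := by
  have := h.isProbabilityMeasure i
  refine MemLp.of_le (((memLp_const |deriv (conjR p.f) 0|).add
    ((h.memLp_loss_sub i θ η).norm.const_mul M)))
    (h.measurable_weight i θ η).aestronglyMeasurable (Eventually.of_forall fun ξ => ?_)
  have h1 := h.generator.conj_smooth ((p.loss i θ ξ - η) / lam) 0
  rw [sub_zero] at h1
  have h2 := abs_sub_abs_le_abs_sub (p.weight i θ η ξ) (deriv (conjR p.f) 0)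
  simp only [Pi.add_apply, Real.norm_eq_abs]
  refine le_trans ?_ (le_abs_self _)
  have h3 : |p.weight i θ η ξ - deriv (conjR p.f) 0| ≤ M * |(p.loss i θ ξ - η) / lam| := h1
  linarith

theorem integrable_weight (h : p.Regular G L M κ) (i : Fin m) (θ : EuclideanSpace ℝ (Fin n))
    (η : ℝ) : Integrable (p.weight i θ η) (p.P i) := by
  have := h.isProbabilityMeasure i
  exact (h.memLp_weight i θ η).integrable one_le_two

theorem integrable_conjR (h : p.Regular G L M κ) (hM : 0 ≤ M) (i : Fin m)
    (θ : EuclideanSpace ℝ (Fin n)) (η : ℝ) :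
    Integrable (fun ξ => conjR p.f ((p.loss i θ ξ - η) / lam)) (p.P i) := by
  have := h.isProbabilityMeasure i
  have hu := h.memLp_loss_sub i θ η
  have hi : Integrable (fun ξ => |conjR p.f 0| + |deriv (conjR p.f) 0| *
      |(p.loss i θ ξ - η) / lam| + M * ((p.loss i θ ξ - η) / lam) ^ 2) (p.P i) :=
    ((integrable_const _).add ((hu.integrable one_le_two).abs.const_mul _)).add
      (hu.integrable_sq.const_mul M)
  refine hi.mono' ?_ (Eventually.of_forall fun ξ => ?_)
  · exact (h.generator.conj_differentiable.continuous.measurable.comp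
      (((h.measurable i θ).sub_const η).div_const lam)).aestronglyMeasurable
  · have h1 := h.generator.abs_conjR_sub_le hM 0 ((p.loss i θ ξ - η) / lam)
    rw [sub_zero] at h1
    rw [Real.norm_eq_abs, ← abs_mul]
    set u := (p.loss i θ ξ - η) / lam
    have h2 : conjR p.f u = conjR p.f 0 + deriv (conjR p.f) 0 * u +
      (conjR p.f u - conjR p.f 0 - deriv (conjR p.f) 0 * u) := by ring
    rw [h2]
    refine (abs_add_le _ _).trans (add_le_add ((abs_add_le _ _)) h1)

theorem integrable_weight_smul (h : p.Regular G L M κ) (hG : 0 ≤ G) (i : Fin m)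
    (θ θ' : EuclideanSpace ℝ (Fin n)) (η : ℝ) :
    Integrable (fun ξ => p.weight i θ η ξ • p.lossGrad i θ' ξ) (p.P i) := by
  refine ((h.integrable_weight i θ η).norm.mul_const G).mono'
    ((h.measurable_weight i θ η).smul (h.measurable_lossGrad i θ')).aestronglyMeasurable
    (Eventually.of_forall fun ξ => ?_)
  rw [norm_smul]
  exact mul_le_mul_of_nonneg_left (h.norm_lossGrad_le hG i θ' ξ) (norm_nonneg _)

/-! ### Smoothness of the dual objective in `η` -/

theorem integral_loss_le_obj (h : p.Regular G L M κ) (hlam : 0 < lam) (hM : 0 ≤ M) (i : Fin m)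
    (θ : EuclideanSpace ℝ (Fin n)) (η : ℝ) : ∫ ξ, p.loss i θ ξ ∂(p.P i) ≤ p.obj i θ η := by
  have := h.isProbabilityMeasure i
  have hl := (h.memLp i θ).integrable one_le_two
  have h1 : ∫ ξ, p.loss i θ ξ - η ∂(p.P i) ≤
      ∫ ξ, lam * conjR p.f ((p.loss i θ ξ - η) / lam) ∂(p.P i) := by
    refine integral_mono (hl.sub (integrable_const _)) ((h.integrable_conjR hM i θ η).const_mul lam)
      fun ξ => ?_
    have h2 := mul_le_mul_of_nonneg_left (h.generator.le_conjR ((p.loss i θ ξ - η) / lam)) hlam.le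
    rwa [mul_div_cancel₀ _ hlam.ne'] at h2
  rw [integral_sub hl (integrable_const _), integral_const_mul] at h1
  simp at h1
  rw [obj]
  linarith

theorem bddBelow_obj (h : p.Regular G L M κ) (hlam : 0 < lam) (hM : 0 ≤ M) (i : Fin m)
    (θ : EuclideanSpace ℝ (Fin n)) : BddBelow (Set.range (p.obj i θ)) :=
  ⟨_, by rintro _ ⟨η, rfl⟩; exact h.integral_loss_le_obj hlam hM i θ η⟩

theorem phi_le_obj (h : p.Regular G L M κ) (hlam : 0 < lam) (hM : 0 ≤ M) (i : Fin m)
    (θ : EuclideanSpace ℝ (Fin n)) (η : ℝ) : p.phi i θ ≤ p.obj i θ η :=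
  ciInf_le (h.bddBelow_obj hlam hM i θ) η

theorem abs_obj_sub_le (h : p.Regular G L M κ) (hlam : 0 < lam) (hM : 0 ≤ M) (i : Fin m)
    (θ : EuclideanSpace ℝ (Fin n)) (η η' : ℝ) :
    |p.obj i θ η' - p.obj i θ η - p.meanGradEta i θ η * (η' - η)| ≤ M / lam * (η' - η) ^ 2 := by
  have := h.isProbabilityMeasure i
  have i1 := h.integrable_conjR hM i θ η'
  have i2 := h.integrable_conjR hM i θ η
  have i3 := h.integrable_weight i θ η
  have i4 : Integrable (fun ξ => lam * conjR p.f ((p.loss i θ ξ - η') / lam) -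
      lam * conjR p.f ((p.loss i θ ξ - η) / lam)) (p.P i) := (i1.const_mul _).sub (i2.const_mul _)
  have e : p.obj i θ η' - p.obj i θ η - p.meanGradEta i θ η * (η' - η) =
      ∫ ξ, (lam * conjR p.f ((p.loss i θ ξ - η') / lam) -
        lam * conjR p.f ((p.loss i θ ξ - η) / lam)) - p.weight i θ η ξ * (η - η') ∂(p.P i) := by
    rw [integral_sub i4 (i3.mul_const _),
      integral_sub (i1.const_mul _) (i2.const_mul _), integral_const_mul, integral_const_mul,
      integral_mul_const, obj, obj, meanGradEta]
    ring
  rw [e]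
  refine (abs_integral_le_integral_abs).trans ?_
  have h2 : ∀ ξ, |(lam * conjR p.f ((p.loss i θ ξ - η') / lam) -
        lam * conjR p.f ((p.loss i θ ξ - η) / lam)) - p.weight i θ η ξ * (η - η')| ≤
        M / lam * (η' - η) ^ 2 := by
    intro ξ
    have h3 := h.generator.abs_mul_conjR_div_sub_le hM hlam (p.loss i θ ξ - η) (p.loss i θ ξ - η')
    have e1 : p.loss i θ ξ - η' - (p.loss i θ ξ - η) = η - η' := by ring
    rw [e1] at h3
    refine h3.trans (le_of_eq ?_)
    ring
  refine (integral_mono_of_nonneg (Eventually.of_forall fun ξ => abs_nonneg _)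
    (integrable_const _) (Eventually.of_forall h2)).trans ?_
  simp

/-- A gradient step from `η` cannot go below the infimum, so a nearly optimal `η` has a small
derivative. -/
theorem meanGradEta_sq_le (h : p.Regular G L M κ) (hlam : 0 < lam) (hM : 0 < M) (i : Fin m)
    (θ : EuclideanSpace ℝ (Fin n)) (η : ℝ) :
    p.meanGradEta i θ η ^ 2 ≤ 4 * (M / lam) * (p.obj i θ η - p.phi i θ) := by
  have hN : 0 < M / lam := by positivity
  set N := M / lam
  set d := p.meanGradEta i θ η
  -- The step length `d / (2N)` minimizes the quadratic upper bound.
  have h1 := (abs_le.1 (h.abs_obj_sub_le hlam hM.le i θ η (η - d / (2 * N)))).2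
  have h2 := h.phi_le_obj hlam hM.le i θ (η - d / (2 * N))
  have e : η - d / (2 * N) - η = - (d / (2 * N)) := by ring
  rw [e] at h1
  have e2 : N * (-(d / (2 * N))) ^ 2 = d ^ 2 / (4 * N) := by field_simp; norm_num
  have e3 : p.meanGradEta i θ η * (-(d / (2 * N))) = - (2 * (d ^ 2 / (4 * N))) := by
    change d * _ = _
    field_simp; norm_num
  rw [e2, e3] at h1
  have h3 : d ^ 2 / (4 * N) ≤ p.obj i θ η - p.phi i θ := by linarith
  rw [div_le_iff₀ (by positivity)] at h3
  linarith

/-- Weights are antitone in `η`, so the integral of the absolute difference of two weights equals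
the absolute difference of their integrals, that is, of the two `η`-derivatives. Bounding the loss
gradient by `G` finishes. No estimate of `|η - η'|` enters, so no strong convexity in `η` is needed.
-/
theorem norm_meanGradTheta_sub_le (h : p.Regular G L M κ) (hG : 0 ≤ G) (hlam : 0 < lam)
    (i : Fin m) (θ : EuclideanSpace ℝ (Fin n)) (η η' : ℝ) :
    ‖p.meanGradTheta i θ η - p.meanGradTheta i θ η'‖ ≤
      G * |p.meanGradEta i θ η - p.meanGradEta i θ η'| := by
  wlog hη : η ≤ η' generalizing η η'
  · rw [norm_sub_rev, abs_sub_comm]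
    exact this η' η (le_of_not_ge hη)
  rw [meanGradTheta, meanGradTheta,
    ← integral_sub (h.integrable_weight_smul hG i θ θ η) (h.integrable_weight_smul hG i θ θ η')]
  have i1 := h.integrable_weight i θ η
  have i2 := h.integrable_weight i θ η'
  refine (norm_integral_le_of_norm_le ((i1.sub i2).const_mul G)
    (Eventually.of_forall fun ξ => ?_)).trans ?_
  · rw [← sub_smul, norm_smul, mul_comm, Real.norm_eq_abs,
      abs_of_nonneg (sub_nonneg.2 (h.weight_antitone hlam i θ ξ hη))]
    exact mul_le_mul_of_nonneg_right (h.norm_lossGrad_le hG i θ ξ)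
      (sub_nonneg.2 (h.weight_antitone hlam i θ ξ hη))
  · rw [integral_const_mul]
    refine mul_le_mul_of_nonneg_left ?_ hG
    simp only [Pi.sub_apply]
    rw [integral_sub i1 i2, meanGradEta, meanGradEta, abs_sub_comm]
    exact (le_of_eq (by ring)).trans (le_abs_self _)

end Problem.Regular

namespace Problem.Regular

variable {p : Problem n m lam Ξ} {G L M κ : ℝ}

/-! ### Differentiability of the robust objectives -/

/-- The infimum over `η` need not be attained (for `f*(s) = log(1 + eˢ)` it is approached only as `η
→ -∞`), so a minimizing sequence replaces the minimizer. -/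
theorem exists_seq_tendsto_phi (h : p.Regular G L M κ) (hlam : 0 < lam) (hM : 0 < M) (i : Fin m)
    (θ : EuclideanSpace ℝ (Fin n)) :
    ∃ e : ℕ → ℝ, Tendsto (fun k => p.obj i θ (e k)) atTop (𝓝 (p.phi i θ)) ∧
      Tendsto (fun k => p.meanGradEta i θ (e k)) atTop (𝓝 0) := by
  obtain ⟨u, -, hu, hmem⟩ := exists_seq_tendsto_sInf (Set.range_nonempty (p.obj i θ))
    (h.bddBelow_obj hlam hM.le i θ)
  choose e he using hmem
  have h1 : Tendsto (fun k => p.obj i θ (e k)) atTop (𝓝 (p.phi i θ)) := by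
    simp_rw [he]; exact hu
  refine ⟨e, h1, ?_⟩
  have h2 : Tendsto (fun k => 4 * (M / lam) * (p.obj i θ (e k) - p.phi i θ)) atTop (𝓝 0) := by
    simpa using (h1.sub_const (p.phi i θ)).const_mul (4 * (M / lam))
  have h3 : Tendsto (fun k => p.meanGradEta i θ (e k) ^ 2) atTop (𝓝 0) :=
    squeeze_zero (fun k => sq_nonneg _) (fun k => h.meanGradEta_sq_le hlam hM i θ _) h2
  have h4 := h3.sqrt
  simp_rw [Real.sqrt_sq_eq_abs, Real.sqrt_zero] at h4
  exact (tendsto_zero_iff_abs_tendsto_zero _).2 h4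

/-- Along a minimizing sequence the `η`-derivatives tend to zero, so the `θ`-gradients are Cauchy by
`norm_meanGradTheta_sub_le`. The limit `g` is the candidate for `∇φ`; the inequality, valid for all
`η`, characterizes it and is the only property used until differentiability is proved. -/
theorem exists_norm_meanGradTheta_sub_le (h : p.Regular G L M κ) (hG : 0 ≤ G) (hlam : 0 < lam)
    (hM : 0 < M) (i : Fin m) (θ : EuclideanSpace ℝ (Fin n)) :
    ∃ g : EuclideanSpace ℝ (Fin n), ∀ η, ‖p.meanGradTheta i θ η - g‖ ≤
      G * |p.meanGradEta i θ η| := by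
  obtain ⟨e, -, he⟩ := h.exists_seq_tendsto_phi hlam hM i θ
  have hc : CauchySeq fun k => p.meanGradTheta i θ (e k) := by
    rw [Metric.cauchySeq_iff]
    intro r hr
    obtain ⟨k₀, hk₀⟩ := Metric.cauchySeq_iff.1 he.cauchySeq (r / (G + 1)) (by positivity)
    refine ⟨k₀, fun k hk l hl => ?_⟩
    have h1 := hk₀ k hk l hl
    rw [Real.dist_eq, lt_div_iff₀ (by positivity)] at h1
    rw [dist_eq_norm]
    refine (h.norm_meanGradTheta_sub_le hG hlam i θ _ _).trans_lt (lt_of_le_of_lt ?_ h1)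
    rw [mul_comm]
    exact mul_le_mul_of_nonneg_left (by linarith) (abs_nonneg _)
  obtain ⟨g, hg⟩ := cauchySeq_tendsto_of_complete hc
  refine ⟨g, fun η => ?_⟩
  have h1 : Tendsto (fun k => ‖p.meanGradTheta i θ η - p.meanGradTheta i θ (e k)‖) atTop
      (𝓝 ‖p.meanGradTheta i θ η - g‖) := (tendsto_const_nhds.sub hg).norm
  have h2 : Tendsto (fun k => G * |p.meanGradEta i θ η - p.meanGradEta i θ (e k)|) atTop
      (𝓝 (G * |p.meanGradEta i θ η - 0|)) := ((tendsto_const_nhds.sub he).abs).const_mul G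
  rw [sub_zero] at h2
  exact le_of_tendsto_of_tendsto' h1 h2 fun k => h.norm_meanGradTheta_sub_le hG hlam i θ _ _

theorem tendsto_meanGradTheta {i : Fin m} {θ g : EuclideanSpace ℝ (Fin n)}
    (hg : ∀ η, ‖p.meanGradTheta i θ η - g‖ ≤ G * |p.meanGradEta i θ η|) {e : ℕ → ℝ}
    (he : Tendsto (fun k => p.meanGradEta i θ (e k)) atTop (𝓝 0)) :
    Tendsto (fun k => p.meanGradTheta i θ (e k)) atTop (𝓝 g) := by
  rw [tendsto_iff_norm_sub_tendsto_zero]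
  exact squeeze_zero (fun k => norm_nonneg _) (fun k => hg (e k)) (by simpa using he.abs.const_mul G)

theorem integral_weight (i : Fin m) (θ : EuclideanSpace ℝ (Fin n)) (η : ℝ) :
    ∫ ξ, p.weight i θ η ξ ∂(p.P i) = 1 - p.meanGradEta i θ η := by
  rw [meanGradEta]; ring

/-- Expand `f*` to first order in the loss and the loss to first order in `θ`. The second error is
multiplied by the weight, whose mean is `1 - d`; the first is at most `N` times the squared change
of the loss. -/
theorem obj_le_obj_add_inner (h : p.Regular G L M κ) (hG : 0 ≤ G) (hL : 0 ≤ L) (hlam : 0 < lam)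
    (hM : 0 ≤ M) (i : Fin m) (θ θ' : EuclideanSpace ℝ (Fin n)) (η : ℝ) :
    p.obj i θ' η ≤ p.obj i θ η + Inner.inner ℝ (p.meanGradTheta i θ η) (θ' - θ) +
      ((1 - p.meanGradEta i θ η) * L + G ^ 2 * (M / lam)) * ‖θ' - θ‖ ^ 2 := by
  have := h.isProbabilityMeasure i
  have i1 := h.integrable_conjR hM i θ' η
  have i2 := h.integrable_conjR hM i θ η
  have i3 := h.integrable_weight i θ η
  have i4 := h.integrable_weight_smul hG i θ θ η
  have i5 : Integrable (fun ξ => Inner.inner ℝ (p.weight i θ η ξ • p.lossGrad i θ ξ) (θ' - θ)) (p.P i) :=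
    i4.inner_const _
  have i6 : Integrable (fun ξ => lam * conjR p.f ((p.loss i θ ξ - η) / lam) +
      Inner.inner ℝ (p.weight i θ η ξ • p.lossGrad i θ ξ) (θ' - θ)) (p.P i) := (i2.const_mul _).add i5
  have i7 : Integrable (fun ξ => lam * conjR p.f ((p.loss i θ ξ - η) / lam) +
      Inner.inner ℝ (p.weight i θ η ξ • p.lossGrad i θ ξ) (θ' - θ) +
      p.weight i θ η ξ * (L * ‖θ' - θ‖ ^ 2)) (p.P i) := i6.add (i3.mul_const _)
  have key : ∫ ξ, lam * conjR p.f ((p.loss i θ' ξ - η) / lam) ∂(p.P i) ≤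
      ∫ ξ, lam * conjR p.f ((p.loss i θ ξ - η) / lam) +
        Inner.inner ℝ (p.weight i θ η ξ • p.lossGrad i θ ξ) (θ' - θ) +
        p.weight i θ η ξ * (L * ‖θ' - θ‖ ^ 2) + G ^ 2 * (M / lam) * ‖θ' - θ‖ ^ 2 ∂(p.P i) := by
    refine integral_mono (i1.const_mul _) (i7.add (integrable_const _)) fun ξ => ?_
    have h1 := (abs_le.1 (h.generator.abs_mul_conjR_div_sub_le hM hlam (p.loss i θ ξ - η)
      (p.loss i θ' ξ - η))).2
    have e1 : p.loss i θ' ξ - η - (p.loss i θ ξ - η) = p.loss i θ' ξ - p.loss i θ ξ := by ring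
    rw [e1] at h1
    have h2 := (abs_le.1 (h.abs_loss_sub_le hL i θ θ' ξ)).2
    have h3 := mul_le_mul_of_nonneg_left h2 (h.weight_nonneg i θ η ξ)
    have h4 : (p.loss i θ' ξ - p.loss i θ ξ) ^ 2 ≤ (G * ‖θ' - θ‖) ^ 2 :=
      sq_le_sq.2 ((h.lipschitz i ξ θ' θ).trans (le_abs_self _))
    have h5 := mul_le_mul_of_nonneg_left h4 (by positivity : 0 ≤ M / lam)
    rw [real_inner_smul_left]
    change lam * conjR p.f ((p.loss i θ' ξ - η) / lam) -
      lam * conjR p.f ((p.loss i θ ξ - η) / lam) -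
      p.weight i θ η ξ * (p.loss i θ' ξ - p.loss i θ ξ) ≤ _ at h1
    beta_reduce
    linarith
  rw [integral_add i7 (integrable_const _), integral_add i6 (i3.mul_const _),
    integral_add (i2.const_mul _) i5, integral_const_mul, integral_const_mul, integral_mul_const,
    integral_weight] at key
  have e2 : ∫ ξ, Inner.inner ℝ (p.weight i θ η ξ • p.lossGrad i θ ξ) (θ' - θ) ∂(p.P i) =
      Inner.inner ℝ (p.meanGradTheta i θ η) (θ' - θ) := by
    rw [real_inner_comm, meanGradTheta, ← integral_inner i4]
    exact integral_congr_ae (Eventually.of_forall fun ξ => real_inner_comm _ _)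
  rw [e2] at key
  simp only [integral_const, probReal_univ, one_smul] at key
  rw [obj, obj]
  linarith

/-- Fix `η` from a minimizing sequence at `θ`: it is also admissible at `θ'`, and in the limit the
factor `1 - d` becomes `1`. -/
theorem phi_le (h : p.Regular G L M κ) (hG : 0 ≤ G) (hL : 0 ≤ L) (hlam : 0 < lam)
    (hM : 0 < M) {i : Fin m} {θ g : EuclideanSpace ℝ (Fin n)}
    (hg : ∀ η, ‖p.meanGradTheta i θ η - g‖ ≤ G * |p.meanGradEta i θ η|)
    (θ' : EuclideanSpace ℝ (Fin n)) :
    p.phi i θ' ≤ p.phi i θ + Inner.inner ℝ g (θ' - θ) + (L + G ^ 2 * (M / lam)) * ‖θ' - θ‖ ^ 2 := by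
  obtain ⟨e, he, he'⟩ := h.exists_seq_tendsto_phi hlam hM i θ
  have h1 := tendsto_meanGradTheta hg he'
  have h2 : Tendsto (fun k => p.obj i θ (e k) + Inner.inner ℝ (p.meanGradTheta i θ (e k)) (θ' - θ) +
      ((1 - p.meanGradEta i θ (e k)) * L + G ^ 2 * (M / lam)) * ‖θ' - θ‖ ^ 2) atTop
      (𝓝 (p.phi i θ + Inner.inner ℝ g (θ' - θ) +
        ((1 - 0) * L + G ^ 2 * (M / lam)) * ‖θ' - θ‖ ^ 2)) :=
    (he.add (h1.inner tendsto_const_nhds)).add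
      ((((tendsto_const_nhds.sub he').mul_const L).add_const _).mul_const _)
  rw [sub_zero, one_mul] at h2
  exact ge_of_tendsto' h2 fun k =>
    (h.phi_le_obj hlam hM.le i θ' (e k)).trans (h.obj_le_obj_add_inner hG hL hlam hM.le i θ θ' (e k))

/-- Both gradients are compared at the same `η`, nearly optimal for `θ`. At `θ'` this `η` has
derivative at most `N G ‖θ' - θ‖` in the limit, which costs one term `G² N`; the change of the
weight costs the other, and the change of the loss gradient costs `L`. -/
theorem norm_sub_le_of_meanGradTheta (h : p.Regular G L M κ) (hG : 0 ≤ G)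
    (hlam : 0 < lam) (hM : 0 < M) {i : Fin m} {θ θ' g g' : EuclideanSpace ℝ (Fin n)}
    (hg : ∀ η, ‖p.meanGradTheta i θ η - g‖ ≤ G * |p.meanGradEta i θ η|)
    (hg' : ∀ η, ‖p.meanGradTheta i θ' η - g'‖ ≤ G * |p.meanGradEta i θ' η|) :
    ‖g' - g‖ ≤ (L + 2 * (G ^ 2 * (M / lam))) * ‖θ' - θ‖ := by
  have := h.isProbabilityMeasure i
  have hN : 0 ≤ M / lam := by positivity
  obtain ⟨e, he, he'⟩ := h.exists_seq_tendsto_phi hlam hM i θ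
  have hw : ∀ η ξ, |p.weight i θ' η ξ - p.weight i θ η ξ| ≤ M / lam * (G * ‖θ' - θ‖) := by
    intro η ξ
    refine (h.abs_weight_sub_le hlam i θ' θ η η ξ ξ).trans (mul_le_mul_of_nonneg_left ?_ hN)
    rw [sub_sub_sub_cancel_right]
    exact h.lipschitz i ξ θ' θ
  have hd : ∀ η, |p.meanGradEta i θ' η - p.meanGradEta i θ η| ≤ M / lam * (G * ‖θ' - θ‖) := by
    intro η
    rw [meanGradEta, meanGradEta, sub_sub_sub_cancel_left, abs_sub_comm,
      ← integral_sub (h.integrable_weight i θ' η) (h.integrable_weight i θ η)]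
    refine (norm_integral_le_of_norm_le (integrable_const (M / lam * (G * ‖θ' - θ‖)))
      (Eventually.of_forall fun ξ => (Real.norm_eq_abs _).trans_le (hw η ξ))).trans ?_
    simp
  have hdist : ∀ η, ‖p.meanGradTheta i θ' η - p.meanGradTheta i θ η‖ ≤
      M / lam * (G * ‖θ' - θ‖) * G + (1 - p.meanGradEta i θ η) * (L * ‖θ' - θ‖) := by
    intro η
    rw [meanGradTheta, meanGradTheta,
      ← integral_sub (h.integrable_weight_smul hG i θ' θ' η) (h.integrable_weight_smul hG i θ θ η)]
    refine (norm_integral_le_of_norm_le ((integrable_const (M / lam * (G * ‖θ' - θ‖) * G)).add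
      ((h.integrable_weight i θ η).mul_const (L * ‖θ' - θ‖)))
      (Eventually.of_forall fun ξ => ?_)).trans ?_
    · have e1 : p.weight i θ' η ξ • p.lossGrad i θ' ξ - p.weight i θ η ξ • p.lossGrad i θ ξ =
          (p.weight i θ' η ξ - p.weight i θ η ξ) • p.lossGrad i θ' ξ +
          p.weight i θ η ξ • (p.lossGrad i θ' ξ - p.lossGrad i θ ξ) := by
        rw [sub_smul, smul_sub]; abel
      rw [e1]
      refine (norm_add_le _ _).trans (add_le_add ?_ ?_)
      · rw [norm_smul]
        exact mul_le_mul (hw η ξ) (h.norm_lossGrad_le hG i θ' ξ) (norm_nonneg _) (by positivity)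
      · rw [norm_smul, Real.norm_eq_abs, abs_of_nonneg (h.weight_nonneg i θ η ξ)]
        exact mul_le_mul_of_nonneg_left (h.smooth i ξ θ' θ) (h.weight_nonneg i θ η ξ)
    · simp only [Pi.add_apply]
      rw [integral_add (integrable_const _) ((h.integrable_weight i θ η).mul_const _),
        integral_const, integral_mul_const, integral_weight]
      simp
  have h1 := (tendsto_const_nhds (x := g')).sub (tendsto_meanGradTheta hg he')
  have h2 : Tendsto (fun k => G * (|p.meanGradEta i θ (e k)| + M / lam * (G * ‖θ' - θ‖)) +
      (M / lam * (G * ‖θ' - θ‖) * G + (1 - p.meanGradEta i θ (e k)) * (L * ‖θ' - θ‖))) atTop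
      (𝓝 (G * (|0| + M / lam * (G * ‖θ' - θ‖)) +
      (M / lam * (G * ‖θ' - θ‖) * G + (1 - 0) * (L * ‖θ' - θ‖)))) :=
    ((he'.abs.add_const _).const_mul G).add
      (((tendsto_const_nhds.sub he').mul_const _).const_add _)
  refine (le_of_tendsto_of_tendsto' h1.norm h2 fun k => ?_).trans (le_of_eq ?_)
  · have h3 := norm_sub_le_norm_sub_add_norm_sub g' (p.meanGradTheta i θ' (e k))
      (p.meanGradTheta i θ (e k))
    have h6 := hg' (e k)
    rw [norm_sub_rev] at h6
    refine h3.trans (add_le_add (h6.trans (mul_le_mul_of_nonneg_left ?_ hG)) (hdist _))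
    have h4 := hd (e k)
    have h5 := abs_sub_abs_le_abs_sub (p.meanGradEta i θ' (e k)) (p.meanGradEta i θ (e k))
    linarith
  · rw [abs_zero]; ring

/-- The upper bound is `phi_le` at `θ`. The lower bound is `phi_le` at `θ'` with the roles
exchanged, after replacing `g'` by `g` through the Lipschitz estimate; together the error is
quadratic. -/
theorem hasGradientAt_phi (h : p.Regular G L M κ) (hG : 0 ≤ G) (hL : 0 ≤ L)
    (hlam : 0 < lam) (hM : 0 < M) {i : Fin m} {θ g : EuclideanSpace ℝ (Fin n)}
    (hg : ∀ η, ‖p.meanGradTheta i θ η - g‖ ≤ G * |p.meanGradEta i θ η|) :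
    HasGradientAt (p.phi i) g θ := by
  have hN : 0 ≤ M / lam := by positivity
  rw [hasGradientAt_iff_isLittleO]
  refine Asymptotics.IsBigO.trans_isLittleO
    (g := fun θ' => ‖θ' - θ‖ ^ 2) ?_ (Asymptotics.isLittleO_pow_sub_sub θ one_lt_two)
  refine Asymptotics.IsBigO.of_bound (2 * L + 3 * (G ^ 2 * (M / lam)))
    (Eventually.of_forall fun θ' => ?_)
  obtain ⟨g', hg'⟩ := h.exists_norm_meanGradTheta_sub_le hG hlam hM i θ'
  have h1 := h.phi_le hG hL hlam hM hg θ'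
  have h2 := h.phi_le hG hL hlam hM hg' θ
  have h3 := h.norm_sub_le_of_meanGradTheta hG hlam hM hg hg'
  have h4 : |Inner.inner ℝ (g' - g) (θ' - θ)| ≤ (L + 2 * (G ^ 2 * (M / lam))) * ‖θ' - θ‖ * ‖θ' - θ‖ :=
    (abs_real_inner_le_norm _ _).trans (mul_le_mul_of_nonneg_right h3 (norm_nonneg _))
  rw [inner_sub_left] at h4
  have e1 : Inner.inner ℝ g' (θ - θ') = - Inner.inner ℝ g' (θ' - θ) := by rw [← inner_neg_right, neg_sub]
  rw [e1, norm_sub_rev] at h2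
  rw [Real.norm_eq_abs, Real.norm_eq_abs, abs_of_nonneg (sq_nonneg ‖θ' - θ‖)]
  have h5 : 0 ≤ L * ‖θ' - θ‖ ^ 2 := by positivity
  have h6 : 0 ≤ G ^ 2 * (M / lam) * ‖θ' - θ‖ ^ 2 := by positivity
  obtain ⟨h7, h8⟩ := abs_le.1 h4
  rw [abs_le]
  constructor <;> nlinarith

theorem norm_meanGradTheta_sub_gradient_le (h : p.Regular G L M κ) (hG : 0 ≤ G) (hL : 0 ≤ L)
    (hlam : 0 < lam) (hM : 0 < M) (i : Fin m) (θ : EuclideanSpace ℝ (Fin n)) (η : ℝ) :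
    ‖p.meanGradTheta i θ η - gradient (p.phi i) θ‖ ≤ G * |p.meanGradEta i θ η| := by
  obtain ⟨g, hg⟩ := h.exists_norm_meanGradTheta_sub_le hG hlam hM i θ
  rw [(h.hasGradientAt_phi hG hL hlam hM hg).gradient]
  exact hg η

theorem differentiable_phi (h : p.Regular G L M κ) (hG : 0 ≤ G) (hL : 0 ≤ L)
    (hlam : 0 < lam) (hM : 0 < M) (i : Fin m) : Differentiable ℝ (p.phi i) := fun θ => by
  obtain ⟨g, hg⟩ := h.exists_norm_meanGradTheta_sub_le hG hlam hM i θ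
  exact (h.hasGradientAt_phi hG hL hlam hM hg).differentiableAt

/-! ### Moments of the stochastic gradients and one step of the inner loop -/

/-- Variance is at most the mean square about any point; the point chosen is the weight at the mean
loss, from which the weight deviates by at most `N` times the deviation of the loss. -/
theorem variance_weight_le (h : p.Regular G L M κ) (i : Fin m)
    (θ : EuclideanSpace ℝ (Fin n)) (η : ℝ) :
    Var[p.weight i θ η; p.P i] ≤ (M / lam * κ) ^ 2 := by
  have := h.isProbabilityMeasure i
  set c : ℝ := deriv (conjR p.f) ((∫ ξ, p.loss i θ ξ ∂(p.P i) - η) / lam) with hc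
  have hm := (h.measurable_weight i θ η).aestronglyMeasurable (μ := p.P i)
  have hl := h.memLp i θ
  rw [← variance_sub_const hm c]
  refine (variance_le_expectation_sq (hm.sub aestronglyMeasurable_const)).trans ?_
  have i1 : Integrable (fun ξ => (p.loss i θ ξ - ∫ ξ', p.loss i θ ξ' ∂(p.P i)) ^ 2) (p.P i) :=
    (hl.sub (memLp_const _)).integrable_sq
  have h1 : ∫ ξ, ((fun ω => p.weight i θ η ω - c) ^ 2) ξ ∂(p.P i) ≤
      ∫ ξ, (M / lam) ^ 2 * (p.loss i θ ξ - ∫ ξ', p.loss i θ ξ' ∂(p.P i)) ^ 2 ∂(p.P i) := by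
    refine integral_mono_of_nonneg (Eventually.of_forall fun ξ => sq_nonneg _)
      (i1.const_mul _) (Eventually.of_forall fun ξ => ?_)
    have h2 := h.generator.conj_smooth ((p.loss i θ ξ - η) / lam)
      ((∫ ξ, p.loss i θ ξ ∂(p.P i) - η) / lam)
    rw [← sub_div, sub_sub_sub_cancel_right] at h2
    simp only [Pi.pow_apply]
    rw [← mul_pow, ← sq_abs]
    refine (pow_le_pow_left₀ (abs_nonneg _) h2 2).trans (le_of_eq ?_)
    rw [mul_pow, sq_abs]
    ring
  refine h1.trans ?_
  rw [integral_const_mul, mul_pow, ← variance_eq_integral hl.aestronglyMeasurable.aemeasurable]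
  exact mul_le_mul_of_nonneg_left (h.variance_le i θ) (sq_nonneg _)

/-- Weights are unbounded, so this is what keeps the gradient noise under control: the mean is `1 -
d`, and the variance is uniform in `η`. -/
theorem integral_weight_sq_le (h : p.Regular G L M κ) (i : Fin m)
    (θ : EuclideanSpace ℝ (Fin n)) (η : ℝ) :
    ∫ ξ, p.weight i θ η ξ ^ 2 ∂(p.P i) ≤ (1 - p.meanGradEta i θ η) ^ 2 + (M / lam * κ) ^ 2 := by
  have := h.isProbabilityMeasure i
  have h1 := h.variance_weight_le i θ η
  rw [variance_eq_sub (h.memLp_weight i θ η), integral_weight] at h1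
  simp only [Pi.pow_apply] at h1
  linarith

theorem integral_norm_weight_smul_sq_le (h : p.Regular G L M κ) (hG : 0 ≤ G)
    (i : Fin m) (θ : EuclideanSpace ℝ (Fin n)) (η : ℝ) :
    ∫ ξ, ‖p.weight i θ η ξ • p.lossGrad i θ ξ‖ ^ 2 ∂(p.P i) ≤
      G ^ 2 * (2 + (M / lam * κ) ^ 2 + 2 * p.meanGradEta i θ η ^ 2) := by
  have h1 : ∫ ξ, ‖p.weight i θ η ξ • p.lossGrad i θ ξ‖ ^ 2 ∂(p.P i) ≤
      ∫ ξ, G ^ 2 * p.weight i θ η ξ ^ 2 ∂(p.P i) := by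
    refine integral_mono_of_nonneg (Eventually.of_forall fun ξ => sq_nonneg _)
      ((h.memLp_weight i θ η).integrable_sq.const_mul _) (Eventually.of_forall fun ξ => ?_)
    simp only
    rw [norm_smul, mul_pow, mul_comm, Real.norm_eq_abs, sq_abs]
    exact mul_le_mul_of_nonneg_right
      (pow_le_pow_left₀ (norm_nonneg _) (h.norm_lossGrad_le hG i θ ξ) 2) (sq_nonneg _)
  refine h1.trans ?_
  rw [integral_const_mul]
  refine mul_le_mul_of_nonneg_left ((h.integral_weight_sq_le i θ η).trans ?_) (sq_nonneg _)
  nlinarith [sq_nonneg (1 + p.meanGradEta i θ η)]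

/-- The SGD descent inequality. The mean square of the step is `γ²(d² + Var)`, and `N γ ≤ 1/2` lets
half of the decrease `γ d²` absorb `N γ² d²`. -/
theorem lintegral_obj_sgd_step_le (h : p.Regular G L M κ) (hlam : 0 < lam) (hM : 0 < M)
    {γ : ℝ} (hγ : 0 ≤ γ) (hγN : M / lam * γ ≤ 1 / 2) (i : Fin m)
    (θ : EuclideanSpace ℝ (Fin n)) (η : ℝ) :
    ∫⁻ ξ, ENNReal.ofReal (p.obj i θ (η - γ * (1 - p.weight i θ η ξ)) - p.phi i θ) ∂(p.P i) +
      ENNReal.ofReal (γ / 2 * p.meanGradEta i θ η ^ 2) ≤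
    ENNReal.ofReal (p.obj i θ η - p.phi i θ) +
      ENNReal.ofReal (M / lam * γ ^ 2 * (M / lam * κ) ^ 2) := by
  have := h.isProbabilityMeasure i
  set N := M / lam with hN
  have hN0 : 0 < N := by positivity
  set d := p.meanGradEta i θ η
  have i1 := h.integrable_weight i θ η
  have i2 : Integrable (fun ξ => p.weight i θ η ξ ^ 2) (p.P i) :=
    (h.memLp_weight i θ η).integrable_sq
  set a := p.obj i θ η - p.phi i θ with ha
  have ha0 : 0 ≤ a := sub_nonneg.2 (h.phi_le_obj hlam hM.le i θ η)
  -- The quadratic upper bound after the step `γ(1 - weight)`, expanded in powers of the weight so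
  -- that only its first two moments enter.
  set R : Ξ → ℝ := fun ξ => (a - d * γ + N * γ ^ 2) +
    (d * γ - 2 * N * γ ^ 2) * p.weight i θ η ξ + N * γ ^ 2 * p.weight i θ η ξ ^ 2 with hR
  have hle : ∀ ξ, p.obj i θ (η - γ * (1 - p.weight i θ η ξ)) - p.phi i θ ≤ R ξ := by
    intro ξ
    have h1 := (abs_le.1 (h.abs_obj_sub_le hlam hM.le i θ η
      (η - γ * (1 - p.weight i θ η ξ)))).2
    rw [sub_sub_cancel_left] at h1
    change p.obj i θ (η - γ * (1 - p.weight i θ η ξ)) - p.obj i θ η -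
      d * -(γ * (1 - p.weight i θ η ξ)) ≤ N * (-(γ * (1 - p.weight i θ η ξ))) ^ 2 at h1
    rw [hR]
    simp only
    linarith
  have i3 : Integrable (fun ξ => (a - d * γ + N * γ ^ 2) +
      (d * γ - 2 * N * γ ^ 2) * p.weight i θ η ξ) (p.P i) :=
    (integrable_const _).add (i1.const_mul _)
  have iR : Integrable R (p.P i) :=
    i3.add (i2.const_mul _)
  have hR0 : ∀ ξ, 0 ≤ R ξ := fun ξ =>
    (sub_nonneg.2 (h.phi_le_obj hlam hM.le i θ _)).trans (hle ξ)
  have hint : ∫ ξ, R ξ ∂(p.P i) ≤ a - γ / 2 * d ^ 2 + N * γ ^ 2 * (N * κ) ^ 2 := by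
    have e1 : ∫ ξ, R ξ ∂(p.P i) = (a - d * γ + N * γ ^ 2) +
        (d * γ - 2 * N * γ ^ 2) * (1 - d) + N * γ ^ 2 * ∫ ξ, p.weight i θ η ξ ^ 2 ∂(p.P i) := by
      rw [hR, integral_add i3 (i2.const_mul _),
        integral_add (integrable_const _) (i1.const_mul _), integral_const_mul,
        integral_const_mul, integral_weight]
      simp only [integral_const, probReal_univ, one_smul]
      rfl
    rw [e1]
    have h2 := mul_le_mul_of_nonneg_left (h.integral_weight_sq_le i θ η)
      (by positivity : 0 ≤ N * γ ^ 2)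
    change _ ≤ N * γ ^ 2 * ((1 - d) ^ 2 + (N * κ) ^ 2) at h2
    have h3 : N * γ * (γ * d ^ 2) ≤ 1 / 2 * (γ * d ^ 2) :=
      mul_le_mul_of_nonneg_right hγN (by positivity)
    linarith
  calc _ ≤ ∫⁻ ξ, ENNReal.ofReal (R ξ) ∂(p.P i) + ENNReal.ofReal (γ / 2 * d ^ 2) :=
        add_le_add_left (lintegral_mono fun ξ => ENNReal.ofReal_le_ofReal (hle ξ)) _
    _ = ENNReal.ofReal (∫ ξ, R ξ ∂(p.P i) + γ / 2 * d ^ 2) := by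
        rw [← ofReal_integral_eq_lintegral_ofReal iR (Eventually.of_forall hR0),
          ENNReal.ofReal_add (integral_nonneg hR0) (by positivity)]
    _ ≤ ENNReal.ofReal (a + N * γ ^ 2 * (N * κ) ^ 2) :=
        ENNReal.ofReal_le_ofReal (by linarith)
    _ = _ := ENNReal.ofReal_add ha0 (by positivity)

/-! ### Measurability -/

section Measurable

variable {A : Type*} [MeasurableSpace A] {θ : A → EuclideanSpace ℝ (Fin n)} {η : A → ℝ}
  {ξ : A → Ξ}

theorem measurable_loss_comp (h : p.Regular G L M κ) (i : Fin m) (hθ : Measurable θ)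
    (hξ : Measurable ξ) : Measurable fun a => p.loss i (θ a) (ξ a) :=
  (h.measurable_loss_uncurry i).comp (hθ.prodMk hξ)

theorem measurable_weight_comp (h : p.Regular G L M κ) (i : Fin m) (hθ : Measurable θ)
    (hη : Measurable η) (hξ : Measurable ξ) : Measurable fun a => p.weight i (θ a) (η a) (ξ a) :=
  (h.measurable_weight_uncurry i).comp (hθ.prodMk (hη.prodMk hξ))

theorem measurable_obj_comp (h : p.Regular G L M κ) (i : Fin m) (hθ : Measurable θ)
    (hη : Measurable η) : Measurable fun a => p.obj i (θ a) (η a) := by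
  have := h.isProbabilityMeasure i
  have h1 : Measurable fun y : A × Ξ => conjR p.f ((p.loss i (θ y.1) y.2 - η y.1) / lam) :=
    h.generator.conj_differentiable.continuous.measurable.comp
      (((h.measurable_loss_comp i (hθ.comp measurable_fst) measurable_snd).sub
        (hη.comp measurable_fst)).div_const lam)
  exact ((h1.stronglyMeasurable.integral_prod_right' (ν := p.P i)).measurable.const_mul lam).add hη

theorem measurable_meanGradEta_comp (h : p.Regular G L M κ) (i : Fin m) (hθ : Measurable θ)
    (hη : Measurable η) : Measurable fun a => p.meanGradEta i (θ a) (η a) := by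
  have := h.isProbabilityMeasure i
  have h1 : Measurable fun y : A × Ξ => p.weight i (θ y.1) (η y.1) y.2 :=
    h.measurable_weight_comp i (hθ.comp measurable_fst) (hη.comp measurable_fst) measurable_snd
  exact measurable_const.sub (h1.stronglyMeasurable.integral_prod_right' (ν := p.P i)).measurable

theorem measurable_gradTheta_comp (h : p.Regular G L M κ) (hlam : lam ≠ 0) (i : Fin m)
    (hθ : Measurable θ) (hη : Measurable η) (hξ : Measurable ξ) :
    Measurable fun a => p.gradTheta i (θ a) (η a) (ξ a) := by
  simp_rw [h.gradTheta_eq hlam]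
  exact (h.measurable_weight_comp i hθ hη hξ).smul
    ((h.measurable_lossGrad_uncurry i).comp (hθ.prodMk hξ))

end Measurable

end Problem.Regular

/-! ### The projection onto the simplex -/

theorem convex_simplex : Convex ℝ (simplex m) := by
  intro x hx y hy a b ha hb hab
  refine ⟨fun i => ?_, ?_⟩
  · have := hx.1 i
    have := hy.1 i
    simp only [PiLp.add_apply, PiLp.smul_apply, smul_eq_mul]
    positivity
  · simp only [PiLp.add_apply, PiLp.smul_apply, smul_eq_mul, Finset.sum_add_distrib,
      ← Finset.mul_sum, hx.2, hy.2]
    linarith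

/-- The variational inequality characterizing the nearest point of a convex set. -/
theorem inner_sub_proj_le (hm : 0 < m) (v : EuclideanSpace ℝ (Fin m))
    {u : EuclideanSpace ℝ (Fin m)} (hu : u ∈ simplex m) :
    Inner.inner ℝ (v - proj v) (u - proj v) ≤ 0 := by
  obtain ⟨h1, h2⟩ := proj_spec hm v
  refine (norm_eq_iInf_iff_real_inner_le_zero convex_simplex h1).1 ?_ u hu
  have : Nonempty (simplex m) := ⟨⟨_, h1⟩⟩
  refine le_antisymm (le_ciInf fun w => h2 w w.2) ?_
  exact ciInf_le ⟨0, by rintro _ ⟨w, rfl⟩; exact norm_nonneg _⟩ (⟨proj v, h1⟩ : simplex m)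

/-- Adding the variational inequalities at `v` and `v'` shows that the projection is nonexpansive.
Continuity serves the measurability of the iterates. -/
theorem continuous_proj (hm : 0 < m) : Continuous (proj (m := m)) := by
  refine (LipschitzWith.of_dist_le_mul (K := 1) fun v v' => ?_).continuous
  rw [dist_eq_norm, dist_eq_norm, NNReal.coe_one, one_mul]
  have h1 := inner_sub_proj_le hm v (proj_spec hm v').1
  have h2 := inner_sub_proj_le hm v' (proj_spec hm v).1
  have h3 : ‖proj v - proj v'‖ ^ 2 ≤ Inner.inner ℝ (v - v') (proj v - proj v') := by
    rw [← real_inner_self_eq_norm_sq]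
    have e : Inner.inner ℝ (v - v') (proj v - proj v') -
          Inner.inner ℝ (proj v - proj v') (proj v - proj v') =
        - Inner.inner ℝ (v - proj v) (proj v' - proj v) -
          Inner.inner ℝ (v' - proj v') (proj v - proj v') := by
      simp only [inner_sub_left, inner_sub_right]
      ring
    linarith
  have h4 := h3.trans (real_inner_le_norm _ _)
  rcases (norm_nonneg (proj v - proj v')).eq_or_lt with h5 | h5
  · rw [← h5]; exact norm_nonneg _
  · nlinarith

theorem norm_le_one_of_mem_simplex {w : EuclideanSpace ℝ (Fin m)} (hw : w ∈ simplex m) :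
    ‖w‖ ≤ 1 := by
  have h1 : ∀ i, w i ≤ 1 := fun i =>
    hw.2 ▸ Finset.single_le_sum (f := fun i => w i) (fun j _ => hw.1 j) (Finset.mem_univ i)
  have h2 : ‖w‖ ^ 2 ≤ 1 := by
    rw [EuclideanSpace.norm_sq_eq, ← hw.2]
    refine Finset.sum_le_sum fun i _ => ?_
    rw [Real.norm_eq_abs, sq_abs]
    nlinarith [h1 i, hw.1 i]
  nlinarith [norm_nonneg w]

/-! ### Independence of one coordinate of a product measure -/

/-- A coordinate on which `F` does not depend through its first argument acts as a fresh sample. The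
integral over coordinate `d` is carried out first; both sides have the same marginal there. -/
theorem lintegral_pi_eq_lintegral_lintegral {ι X : Type*} [Fintype ι] [DecidableEq ι]
    [MeasurableSpace X] (ν : Measure X) [IsProbabilityMeasure ν] (d : ι)
    {F : (ι → X) → X → ℝ≥0∞} (hF : Measurable (Function.uncurry F))
    (hinv : ∀ x y z, F (Function.update x d y) z = F x z) :
    ∫⁻ x, F x (x d) ∂(Measure.pi fun _ : ι => ν) =
      ∫⁻ x, ∫⁻ y, F x y ∂ν ∂(Measure.pi fun _ : ι => ν) := by
  have hX : Nonempty X := nonempty_of_isProbabilityMeasure ν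
  set x₀ : ι → X := fun _ => hX.some
  have hf : Measurable fun x : ι → X => F x (x d) :=
    hF.comp (measurable_id.prodMk (measurable_pi_apply d))
  have hH : Measurable fun x : ι → X => ∫⁻ y, F x y ∂ν := hF.lintegral_prod_right
  have e1 : (∫⋯∫⁻_{d}, (fun x : ι → X => F x (x d)) ∂(fun _ => ν)) =
      fun x => ∫⁻ y, F x y ∂ν := by
    rw [lmarginal_singleton]
    funext x
    simp [hinv]
  have e2 : (∫⋯∫⁻_{d}, (fun x : ι → X => ∫⁻ y, F x y ∂ν) ∂(fun _ => ν)) =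
      fun x => ∫⁻ y, F x y ∂ν := by
    rw [lmarginal_singleton]
    funext x
    simp [hinv]
  have hu : (Finset.univ : Finset ι) = Finset.univ.erase d ∪ {d} := by
    ext j; simp
  have hdis : Disjoint (Finset.univ.erase d) ({d} : Finset ι) := by simp
  rw [lintegral_eq_lmarginal_univ x₀, lintegral_eq_lmarginal_univ x₀, hu,
    lmarginal_union _ _ hf hdis, lmarginal_union _ _ hH hdis, e1, e2]

/-! ### The inner loop -/

/-- The iterate `η_{t,d}` uses only the samples with index below `d`, so sample `d` is fresh for the
next step. -/
theorem Problem.inner_update (p : Problem n m lam Ξ) (γ : ℝ) {D : ℕ}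
    (θ : EuclideanSpace ℝ (Fin n)) (η₀ : Fin m → ℝ) (x : Fin D → Fin m → Ξ) (j : Fin D)
    (y : Fin m → Ξ) {d : ℕ} (hd : d ≤ j) :
    p.inner γ θ η₀ (Function.update x j y) d = p.inner γ θ η₀ x d := by
  induction d with
  | zero => rfl
  | succ d ih =>
    have h1 := ih (by omega)
    funext i
    simp only [Problem.inner, h1]
    split_ifs with h
    · rw [Function.update_of_ne]
      intro h2
      rw [← h2] at hd
      simp at hd
    · rfl

/-- The mean squared `η`-derivative along the inner loop, averaged over the iterates. -/
def Problem.innerError (p : Problem n m lam Ξ) (γ : ℝ) {D : ℕ} (θ : EuclideanSpace ℝ (Fin n))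
    (η₀ : Fin m → ℝ) (x : Fin D → Fin m → Ξ) : ℝ :=
  (D : ℝ)⁻¹ * ∑ i, ∑ d : Fin D, p.meanGradEta i θ (p.inner γ θ η₀ x d i) ^ 2

theorem Problem.innerError_nonneg (p : Problem n m lam Ξ) (γ : ℝ) {D : ℕ}
    (θ : EuclideanSpace ℝ (Fin n)) (η₀ : Fin m → ℝ) (x : Fin D → Fin m → Ξ) :
    0 ≤ p.innerError γ θ η₀ x :=
  mul_nonneg (by positivity) (Finset.sum_nonneg fun _ _ => Finset.sum_nonneg fun _ _ => sq_nonneg _)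

namespace Problem.Regular

variable {p : Problem n m lam Ξ} {G L M κ : ℝ}

theorem measurable_inner (h : p.Regular G L M κ) (hlam : lam ≠ 0) (γ : ℝ) {D : ℕ} (d : ℕ)
    (i : Fin m) {α : Type*} [MeasurableSpace α] {θ : α → EuclideanSpace ℝ (Fin n)}
    {η₀ : α → Fin m → ℝ} {x : α → Fin D → Fin m → Ξ} (hθ : Measurable θ) (hη : Measurable η₀)
    (hx : Measurable x) : Measurable fun a => p.inner γ (θ a) (η₀ a) (x a) d i := by
  induction d with
  | zero => exact (measurable_pi_apply i).comp hη
  | succ d ih =>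
    simp only [Problem.inner]
    split_ifs with hd
    · refine ih.sub (Measurable.const_mul ?_ γ)
      simp_rw [h.gradEta_eq hlam]
      refine measurable_const.sub (h.measurable_weight_comp i hθ ih ?_)
      exact (measurable_pi_apply i).comp ((measurable_pi_apply (⟨d, hd⟩ : Fin D)).comp hx)
    · exact ih

theorem measurable_inner_right (h : p.Regular G L M κ) (hlam : lam ≠ 0) (γ : ℝ) {D : ℕ} (d : ℕ)
    (i : Fin m) (θ : EuclideanSpace ℝ (Fin n)) (η₀ : Fin m → ℝ) :
    Measurable fun x : Fin D → Fin m → Ξ => p.inner γ θ η₀ x d i :=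
  h.measurable_inner hlam γ d i measurable_const measurable_const measurable_id

theorem lintegral_inner_succ_le (h : p.Regular G L M κ) (hlam : 0 < lam) (hM : 0 < M)
    {γ : ℝ} (hγ : 0 ≤ γ) (hγN : M / lam * γ ≤ 1 / 2) {D : ℕ} (ν : Measure (Fin m → Ξ))
    [IsProbabilityMeasure ν] (hν : ∀ i, ν.map (fun x => x i) = p.P i) (i : Fin m)
    (θ : EuclideanSpace ℝ (Fin n)) (η₀ : Fin m → ℝ) (d : Fin D) :
    ∫⁻ x, ENNReal.ofReal (p.obj i θ (p.inner γ θ η₀ x (d + 1) i) - p.phi i θ)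
        ∂(Measure.pi fun _ : Fin D => ν) +
      ENNReal.ofReal (γ / 2) * ∫⁻ x, ENNReal.ofReal (p.meanGradEta i θ (p.inner γ θ η₀ x d i) ^ 2)
        ∂(Measure.pi fun _ : Fin D => ν) ≤
    ∫⁻ x, ENNReal.ofReal (p.obj i θ (p.inner γ θ η₀ x d i) - p.phi i θ)
        ∂(Measure.pi fun _ : Fin D => ν) +
      ENNReal.ofReal (M / lam * γ ^ 2 * (M / lam * κ) ^ 2) := by
  have hin := h.measurable_inner_right hlam.ne' γ (D := D) d i θ η₀
  have hs : ∀ {A : Type _} [MeasurableSpace A] {η : A → ℝ} {ξ : A → Ξ}, Measurable η →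
      Measurable ξ → Measurable fun y =>
        ENNReal.ofReal (p.obj i θ (η y - γ * (1 - p.weight i θ (η y) (ξ y))) - p.phi i θ) :=
    fun hη hξ => ((h.measurable_obj_comp i measurable_const (hη.sub ((measurable_const.sub
      (h.measurable_weight_comp i measurable_const hη hξ)).const_mul γ))).sub_const
      _).ennreal_ofReal
  set F : (Fin D → Fin m → Ξ) → (Fin m → Ξ) → ℝ≥0∞ := fun x y =>
    ENNReal.ofReal (p.obj i θ (p.inner γ θ η₀ x d i -
        γ * (1 - p.weight i θ (p.inner γ θ η₀ x d i) (y i))) - p.phi i θ) with hF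
  have hFm : Measurable (Function.uncurry F) := by
    have h1 : Measurable fun z : (Fin D → Fin m → Ξ) × (Fin m → Ξ) =>
        p.inner γ θ η₀ z.1 d i :=
      h.measurable_inner hlam.ne' γ d i measurable_const measurable_const measurable_fst
    exact hs h1 ((measurable_pi_apply i).comp measurable_snd)
  have hFinv : ∀ x y z, F (Function.update x d y) z = F x z := fun x y z => by
    simp only [hF, p.inner_update γ θ η₀ x d y le_rfl]
  have e4 : ∀ x, ENNReal.ofReal (p.obj i θ (p.inner γ θ η₀ x (d + 1) i) - p.phi i θ) =
      F x (x d) := fun x => by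
    simp only [hF, Problem.inner, d.2, dif_pos, h.gradEta_eq hlam.ne']
  -- One task sees only its own component of the sample, so only the marginals of `ν` matter and the
  -- components may be dependent.
  have e5 : ∀ x, ∫⁻ y, F x y ∂ν = ∫⁻ ξ, ENNReal.ofReal (p.obj i θ (p.inner γ θ η₀ x d i -
        γ * (1 - p.weight i θ (p.inner γ θ η₀ x d i) ξ)) - p.phi i θ) ∂(p.P i) := fun x => by
    rw [← hν i, lintegral_map (hs (η := fun _ => p.inner γ θ η₀ x d i) measurable_const
      measurable_id') (measurable_pi_apply i)]
  have e1 : ∫⁻ x, ENNReal.ofReal (p.obj i θ (p.inner γ θ η₀ x (d + 1) i) - p.phi i θ)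
        ∂(Measure.pi fun _ : Fin D => ν) =
      ∫⁻ x, ∫⁻ ξ, ENNReal.ofReal (p.obj i θ (p.inner γ θ η₀ x d i -
        γ * (1 - p.weight i θ (p.inner γ θ η₀ x d i) ξ)) - p.phi i θ) ∂(p.P i)
        ∂(Measure.pi fun _ : Fin D => ν) := by
    simp_rw [e4, ← e5]
    exact lintegral_pi_eq_lintegral_lintegral ν d hFm hFinv
  have hq : Measurable fun x : Fin D → Fin m → Ξ =>
      ENNReal.ofReal (p.meanGradEta i θ (p.inner γ θ η₀ x d i) ^ 2) :=
    ((h.measurable_meanGradEta_comp i measurable_const hin).pow_const 2).ennreal_ofReal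
  have e3 : ENNReal.ofReal (M / lam * γ ^ 2 * (M / lam * κ) ^ 2) =
      ∫⁻ _, ENNReal.ofReal (M / lam * γ ^ 2 * (M / lam * κ) ^ 2)
        ∂(Measure.pi fun _ : Fin D => ν) := by simp
  rw [e1, e3, ← lintegral_const_mul _ hq, ← lintegral_add_right _ (hq.const_mul _),
    ← lintegral_add_right _ measurable_const]
  refine lintegral_mono fun x => ?_
  simp only
  rw [← ENNReal.ofReal_mul (by positivity)]
  exact h.lintegral_obj_sgd_step_le hlam hM hγ hγN i θ _

/-- Telescoping of `lintegral_inner_succ_le`; the final gap is dropped. -/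
theorem lintegral_sum_meanGradEta_sq_le (h : p.Regular G L M κ) (hlam : 0 < lam) (hM : 0 < M)
    {γ : ℝ} (hγ : 0 ≤ γ) (hγN : M / lam * γ ≤ 1 / 2) {D : ℕ} (ν : Measure (Fin m → Ξ))
    [IsProbabilityMeasure ν] (hν : ∀ i, ν.map (fun x => x i) = p.P i) (i : Fin m)
    (θ : EuclideanSpace ℝ (Fin n)) (η₀ : Fin m → ℝ) :
    ENNReal.ofReal (γ / 2) * ∑ d : Fin D,
      ∫⁻ x, ENNReal.ofReal (p.meanGradEta i θ (p.inner γ θ η₀ x d i) ^ 2)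
        ∂(Measure.pi fun _ : Fin D => ν) ≤
    ENNReal.ofReal (p.obj i θ (η₀ i) - p.phi i θ) +
      D * ENNReal.ofReal (M / lam * γ ^ 2 * (M / lam * κ) ^ 2) := by
  set π := Measure.pi fun _ : Fin D => ν
  set a : ℕ → ℝ≥0∞ := fun d =>
    ∫⁻ x, ENNReal.ofReal (p.obj i θ (p.inner γ θ η₀ x d i) - p.phi i θ) ∂π with ha
  set c : ℕ → ℝ≥0∞ := fun d =>
    ∫⁻ x, ENNReal.ofReal (p.meanGradEta i θ (p.inner γ θ η₀ x d i) ^ 2) ∂π with hc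
  set r := ENNReal.ofReal (M / lam * γ ^ 2 * (M / lam * κ) ^ 2)
  have key : ∀ k ≤ D, a k + ENNReal.ofReal (γ / 2) * ∑ d ∈ Finset.range k, c d ≤ a 0 + k * r := by
    intro k hk
    induction k with
    | zero => simp
    | succ k ih =>
      have h1 := h.lintegral_inner_succ_le hlam hM hγ hγN ν hν i θ η₀ (⟨k, hk⟩ : Fin D)
      change a (k + 1) + ENNReal.ofReal (γ / 2) * c k ≤ a k + r at h1
      rw [Finset.sum_range_succ, mul_add, Nat.cast_succ]
      calc _ = (a (k + 1) + ENNReal.ofReal (γ / 2) * c k) +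
            ENNReal.ofReal (γ / 2) * ∑ d ∈ Finset.range k, c d := by ring
        _ ≤ (a k + r) + ENNReal.ofReal (γ / 2) * ∑ d ∈ Finset.range k, c d := by gcongr
        _ = (a k + ENNReal.ofReal (γ / 2) * ∑ d ∈ Finset.range k, c d) + r := by ring
        _ ≤ (a 0 + k * r) + r := by exact add_le_add_left (ih (by omega)) r
        _ = _ := by ring
  have h0 : a 0 = ENNReal.ofReal (p.obj i θ (η₀ i) - p.phi i θ) := by
    simp [ha, Problem.inner, π]
  rw [← h0, Fin.sum_univ_eq_sum_range c D]
  exact le_trans le_add_self (key D le_rfl)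

theorem measurable_innerError (h : p.Regular G L M κ) (hlam : lam ≠ 0) (γ : ℝ) {D : ℕ}
    (θ : EuclideanSpace ℝ (Fin n)) (η₀ : Fin m → ℝ) :
    Measurable fun x : Fin D → Fin m → Ξ => p.innerError γ θ η₀ x := by
  refine Measurable.const_mul (Finset.measurable_sum _ fun i _ => Finset.measurable_sum _
    fun d _ => ?_) _
  exact (h.measurable_meanGradEta_comp i measurable_const
    (h.measurable_inner_right hlam γ d i θ η₀)).pow_const 2

theorem lintegral_innerError_le (h : p.Regular G L M κ) (hlam : 0 < lam) (hM : 0 < M)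
    {γ : ℝ} (hγ : 0 < γ) (hγN : M / lam * γ ≤ 1 / 2) {D : ℕ} (hD : 0 < D)
    (ν : Measure (Fin m → Ξ))
    [IsProbabilityMeasure ν] (hν : ∀ i, ν.map (fun x => x i) = p.P i)
    (θ : EuclideanSpace ℝ (Fin n)) (η₀ : Fin m → ℝ) :
    ∫⁻ x, ENNReal.ofReal (p.innerError γ θ η₀ x) ∂(Measure.pi fun _ : Fin D => ν) ≤
      ENNReal.ofReal (2 / (γ * D)) * ∑ i, ENNReal.ofReal (p.obj i θ (η₀ i) - p.phi i θ) +
        ENNReal.ofReal (m * (2 * (M / lam) * γ * (M / lam * κ) ^ 2)) := by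
  have hD' : (0 : ℝ) < D := by exact_mod_cast hD
  have hmeas : ∀ i (d : Fin D), Measurable fun x : Fin D → Fin m → Ξ =>
      ENNReal.ofReal (p.meanGradEta i θ (p.inner γ θ η₀ x d i) ^ 2) := fun i d =>
    ((h.measurable_meanGradEta_comp i measurable_const
      (h.measurable_inner_right hlam.ne' γ d i θ η₀)).pow_const 2).ennreal_ofReal
  have e1 : ∫⁻ x, ENNReal.ofReal (p.innerError γ θ η₀ x) ∂(Measure.pi fun _ : Fin D => ν) =
      ENNReal.ofReal (D : ℝ)⁻¹ * ∑ i, ∑ d : Fin D,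
        ∫⁻ x, ENNReal.ofReal (p.meanGradEta i θ (p.inner γ θ η₀ x d i) ^ 2)
        ∂(Measure.pi fun _ : Fin D => ν) := by
    have e2 : ∀ x : Fin D → Fin m → Ξ, ENNReal.ofReal (p.innerError γ θ η₀ x) =
        ENNReal.ofReal (D : ℝ)⁻¹ * ∑ i, ∑ d : Fin D,
          ENNReal.ofReal (p.meanGradEta i θ (p.inner γ θ η₀ x d i) ^ 2) := by
      intro x
      rw [Problem.innerError, ENNReal.ofReal_mul (by positivity), ENNReal.ofReal_sum_of_nonneg
        fun _ _ => Finset.sum_nonneg fun _ _ => sq_nonneg _]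
      congr 1
      exact Finset.sum_congr rfl fun i _ => ENNReal.ofReal_sum_of_nonneg fun _ _ => sq_nonneg _
    simp_rw [e2]
    rw [lintegral_const_mul _ (Finset.measurable_sum _ fun i _ => Finset.measurable_sum _
      fun d _ => hmeas i d), lintegral_finsetSum _ fun i _ => Finset.measurable_sum _
      fun d _ => hmeas i d]
    congr 1
    exact Finset.sum_congr rfl fun i _ => lintegral_finsetSum _ fun d _ => hmeas i d
  have e3 : ENNReal.ofReal (2 / (γ * D)) * ENNReal.ofReal (γ / 2) = ENNReal.ofReal (D : ℝ)⁻¹ := by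
    rw [← ENNReal.ofReal_mul (by positivity)]
    congr 1
    field_simp
  rw [e1, ← e3, mul_assoc, Finset.mul_sum]
  calc _ ≤ ENNReal.ofReal (2 / (γ * D)) * ∑ i : Fin m,
        (ENNReal.ofReal (p.obj i θ (η₀ i) - p.phi i θ) +
          D * ENNReal.ofReal (M / lam * γ ^ 2 * (M / lam * κ) ^ 2)) :=
      mul_le_mul_right (Finset.sum_le_sum fun i _ =>
        h.lintegral_sum_meanGradEta_sq_le hlam hM hγ.le hγN ν hν i θ η₀) _
    _ = _ := by
      rw [Finset.sum_add_distrib, mul_add]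
      congr 1
      rw [Finset.sum_const, Finset.card_univ, Fintype.card_fin, nsmul_eq_mul,
        ← ENNReal.ofReal_natCast, ← ENNReal.ofReal_natCast, ← ENNReal.ofReal_mul (by positivity),
        ← ENNReal.ofReal_mul (by positivity), ← ENNReal.ofReal_mul (by positivity)]
      congr 1
      field_simp

/-! ### Measurability of the algorithm -/

theorem measurable_estimate (h : p.Regular G L M κ) (hlam : lam ≠ 0) (γ : ℝ) {D : ℕ} (j : Fin 3)
    (i : Fin m) :
    Measurable fun y : State n m × Batch m D Ξ => p.estimate γ y.1 y.2 j i := by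
  have h1 : Measurable fun y : (State n m × Batch m D Ξ) × Fin D =>
      p.inner γ y.1.1.1 y.1.1.2.2 y.1.2.1 y.2 i :=
    measurable_from_prod_countable_left fun d => h.measurable_inner hlam γ d i
      (by fun_prop) (by fun_prop) (by fun_prop)
  have h2 : Measurable fun y : State n m × Batch m D Ξ => (y, y.2.2.2 j) := by fun_prop
  have h3 : Measurable fun y : State n m × Batch m D Ξ => y.2.2.1 j i := by fun_prop
  exact h.measurable_gradTheta_comp hlam i (measurable_fst.comp measurable_fst) (h1.comp h2) h3

theorem measurable_step (h : p.Regular G L M κ) (hlam : lam ≠ 0) (hm : 0 < m) (a : Params)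
    {start : (Fin m → ℝ) → Fin m → ℝ} (hstart : Measurable start) {D : ℕ} :
    Measurable fun y : State n m × Batch m D Ξ => p.step a start y.1 y.2 := by
  have he := fun j i => h.measurable_estimate hlam a.γ (D := D) j i
  have hw : Measurable fun y : State n m × Batch m D Ξ => y.1.2.1 :=
    (measurable_fst.comp measurable_snd).comp measurable_fst
  have hwi : ∀ i, Measurable fun y : State n m × Batch m D Ξ => y.1.2.1 i := fun i =>
    (measurable_pi_apply i).comp ((WithLp.measurable_ofLp 2 _).comp hw)
  have hsum : ∀ j, Measurable fun y : State n m × Batch m D Ξ =>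
      ∑ i, y.1.2.1 i • p.estimate a.γ y.1 y.2 j i := fun j =>
    Finset.measurable_sum _ fun i _ => (hwi i).smul (he j i)
  refine Measurable.prodMk ?_ (Measurable.prodMk ?_ ?_)
  · exact (measurable_fst.comp measurable_fst).sub ((hsum 0).const_smul a.α)
  · refine (continuous_proj hm).measurable.comp (hw.sub (Measurable.const_smul
      (Measurable.add ?_ (hw.const_smul a.ρ)) a.β))
    exact (WithLp.measurable_toLp 2 _).comp
      (measurable_pi_iff.2 fun i => (he 1 i).inner (hsum 2))
  · exact hstart.comp (measurable_pi_iff.2 fun i => h.measurable_inner hlam a.γ D i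
      (by fun_prop) (by fun_prop) (by fun_prop))

end Problem.Regular

/-! ### Expectations over independent copies -/

section Independent

variable {Z : Type*} [MeasurableSpace Z] {κ : Measure Z} [IsProbabilityMeasure κ]

theorem integral_pi_eval {E : Type*} [NormedAddCommGroup E] [NormedSpace ℝ E] {g : Z → E}
    (hg : AEStronglyMeasurable g κ) (j : Fin 3) :
    ∫ ζ, g (ζ j) ∂(Measure.pi fun _ : Fin 3 => κ) = ∫ z, g z ∂κ := by
  have hp := measurePreserving_eval (fun _ : Fin 3 => κ) j
  have h1 := integral_map (f := g) hp.measurable.aemeasurable (by rw [hp.map_eq]; exact hg)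
  rw [hp.map_eq] at h1
  exact h1.symm

theorem integrable_pi_eval {E : Type*} [NormedAddCommGroup E] {g : Z → E}
    (hg : Integrable g κ) (j : Fin 3) :
    Integrable (fun ζ : Fin 3 → Z => g (ζ j)) (Measure.pi fun _ : Fin 3 => κ) :=
  (measurePreserving_eval (fun _ : Fin 3 => κ) j).integrable_comp_of_integrable hg

theorem indepFun_pi_eval {E F : Type*} [MeasurableSpace E] [MeasurableSpace F] {g : Z → E}
    {g' : Z → F} (hg : Measurable g) (hg' : Measurable g') {j k : Fin 3} (hjk : j ≠ k) :
    IndepFun (fun ζ : Fin 3 → Z => g (ζ j)) (fun ζ => g' (ζ k))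
      (Measure.pi fun _ : Fin 3 => κ) := by
  have h1 := iIndepFun_pi (μ := fun _ : Fin 3 => κ) (X := fun _ z => z) fun _ => aemeasurable_id
  exact (h1.indepFun hjk).comp hg hg'

variable {E : Type*} [NormedAddCommGroup E] [InnerProductSpace ℝ E] [CompleteSpace E]
  [MeasurableSpace E] [BorelSpace E]

theorem integral_inner_pi_eval {g g' : Z → E} (hg : Measurable g) (hg' : Measurable g')
    (hgi : Integrable g κ) (hgi' : Integrable g' κ) {j k : Fin 3} (hjk : j ≠ k) :
    Integrable (fun ζ : Fin 3 → Z => Inner.inner ℝ (g (ζ j)) (g' (ζ k)))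
      (Measure.pi fun _ : Fin 3 => κ) ∧
    ∫ ζ, Inner.inner ℝ (g (ζ j)) (g' (ζ k)) ∂(Measure.pi fun _ : Fin 3 => κ) =
      Inner.inner ℝ (∫ z, g z ∂κ) (∫ z, g' z ∂κ) := by
  have hi := indepFun_pi_eval (κ := κ) hg hg' hjk
  have h1 := integrable_pi_eval hgi j
  have h2 := integrable_pi_eval hgi' k
  refine ⟨hi.integrable_bilin h1 h2 (innerSL ℝ), ?_⟩
  have h3 := hi.integral_bilin h1 h2 (innerSL ℝ)
  rw [integral_pi_eval hgi.aestronglyMeasurable, integral_pi_eval hgi'.aestronglyMeasurable] at h3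
  exact h3

theorem integral_mul_pi_eval {g g' : Z → ℝ} (hg : Measurable g) (hg' : Measurable g')
    (hgi : Integrable g κ) (hgi' : Integrable g' κ) {j k : Fin 3} (hjk : j ≠ k) :
    Integrable (fun ζ : Fin 3 → Z => g (ζ j) * g' (ζ k)) (Measure.pi fun _ : Fin 3 => κ) ∧
    ∫ ζ, g (ζ j) * g' (ζ k) ∂(Measure.pi fun _ : Fin 3 => κ) =
      (∫ z, g z ∂κ) * ∫ z, g' z ∂κ := by
  have h1 := integral_inner_pi_eval (E := ℝ) hg' hg hgi' hgi hjk.symm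
  simpa only [RCLike.inner_apply, conj_trivial] using h1

theorem sq_integral_le {a : Z → ℝ} (ha : MemLp a 2 κ) :
    (∫ z, a z ∂κ) ^ 2 ≤ ∫ z, a z ^ 2 ∂κ := by
  have h1 := variance_nonneg a κ
  rw [variance_eq_sub ha] at h1
  simp only [Pi.pow_apply] at h1
  linarith

/-- Integration over three independent copies of a bound built from a linear term, a bilinear
term in two independent copies, and the moments of a common envelope `a`. -/
theorem lintegral_three_copies_le {F : (Fin 3 → Z) → ℝ} {y₀ y₁ y₂ : Z → E} {a : Z → ℝ} {c : E}
    {b k r₁ r₂ A : ℝ} (hy₀ : Integrable y₀ κ) (hy₁ : Integrable y₁ κ)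
    (hy₂ : Integrable y₂ κ) (hm₁ : Measurable y₁) (hm₂ : Measurable y₂) (ha : Measurable a)
    (ha2 : MemLp a 2 κ) (hA : ∫ z, a z ^ 2 ∂κ ≤ A) (hk : 0 ≤ k) (hr₁ : 0 ≤ r₁) (hr₂ : 0 ≤ r₂)
    (hF0 : ∀ ζ, 0 ≤ F ζ)
    (hF : ∀ ζ, F ζ ≤ b - Inner.inner ℝ c (y₀ (ζ 0)) + k * a (ζ 0) ^ 2
      - Inner.inner ℝ (y₁ (ζ 1)) (y₂ (ζ 2)) + r₁ * (a (ζ 1) ^ 2 * a (ζ 2) ^ 2)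
      + r₂ * (a (ζ 1) * a (ζ 2))) :
    ∃ X ≤ b - Inner.inner ℝ c (∫ z, y₀ z ∂κ) + k * A
        - Inner.inner ℝ (∫ z, y₁ z ∂κ) (∫ z, y₂ z ∂κ) + r₁ * A ^ 2 + r₂ * A,
      0 ≤ X ∧ ∫⁻ ζ, ENNReal.ofReal (F ζ) ∂(Measure.pi fun _ : Fin 3 => κ) ≤
        ENNReal.ofReal X := by
  set τ := Measure.pi fun _ : Fin 3 => κ
  have h12 : (1 : Fin 3) ≠ 2 := by decide
  have hai : Integrable a κ := ha2.integrable one_le_two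
  have hasq : Integrable (fun z => a z ^ 2) κ := ha2.integrable_sq
  have i0 : Integrable (fun ζ : Fin 3 → Z => Inner.inner ℝ c (y₀ (ζ 0))) τ :=
    integrable_pi_eval (g := fun z => Inner.inner ℝ c (y₀ z)) (hy₀.const_inner c) 0
  have e0 : ∫ ζ, Inner.inner ℝ c (y₀ (ζ 0)) ∂τ = Inner.inner ℝ c (∫ z, y₀ z ∂κ) := by
    rw [← integral_inner hy₀ c]
    exact integral_pi_eval (g := fun z => Inner.inner ℝ c (y₀ z)) (hy₀.const_inner c).aestronglyMeasurable 0
  have i1 : Integrable (fun ζ : Fin 3 → Z => a (ζ 0) ^ 2) τ :=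
    integrable_pi_eval (g := fun z => a z ^ 2) hasq 0
  have e1 : ∫ ζ, a (ζ 0) ^ 2 ∂τ = ∫ z, a z ^ 2 ∂κ :=
    integral_pi_eval (g := fun z => a z ^ 2) hasq.aestronglyMeasurable 0
  obtain ⟨i2, e2⟩ := integral_inner_pi_eval hm₁ hm₂ hy₁ hy₂ h12
  obtain ⟨i3, e3⟩ := integral_mul_pi_eval (ha.pow_const 2) (ha.pow_const 2) hasq hasq h12
  obtain ⟨i4, e4⟩ := integral_mul_pi_eval ha ha hai hai h12
  set R : (Fin 3 → Z) → ℝ := fun ζ => b - Inner.inner ℝ c (y₀ (ζ 0)) + k * a (ζ 0) ^ 2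
      - Inner.inner ℝ (y₁ (ζ 1)) (y₂ (ζ 2)) + r₁ * (a (ζ 1) ^ 2 * a (ζ 2) ^ 2)
      + r₂ * (a (ζ 1) * a (ζ 2)) with hR
  have j1 : Integrable (fun ζ : Fin 3 → Z => b - Inner.inner ℝ c (y₀ (ζ 0))) τ :=
    (integrable_const b).sub i0
  have j2 : Integrable (fun ζ : Fin 3 → Z => b - Inner.inner ℝ c (y₀ (ζ 0)) + k * a (ζ 0) ^ 2) τ :=
    j1.add (i1.const_mul k)
  have j3 : Integrable (fun ζ : Fin 3 → Z => b - Inner.inner ℝ c (y₀ (ζ 0)) + k * a (ζ 0) ^ 2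
      - Inner.inner ℝ (y₁ (ζ 1)) (y₂ (ζ 2))) τ := j2.sub i2
  have j4 : Integrable (fun ζ : Fin 3 → Z => b - Inner.inner ℝ c (y₀ (ζ 0)) + k * a (ζ 0) ^ 2
      - Inner.inner ℝ (y₁ (ζ 1)) (y₂ (ζ 2)) + r₁ * (a (ζ 1) ^ 2 * a (ζ 2) ^ 2)) τ :=
    j3.add (i3.const_mul r₁)
  have j5 : Integrable R τ := j4.add (i4.const_mul r₂)
  -- The witness is the integral of the majorant. It is nonnegative because `F` is, so it can later
  -- be merged with another term under one `ENNReal.ofReal`.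
  refine ⟨∫ ζ, R ζ ∂τ, ?_, integral_nonneg fun ζ => (hF0 ζ).trans (hF ζ), ?_⟩
  · rw [hR, integral_add j4 (i4.const_mul r₂), integral_add j3 (i3.const_mul r₁),
      integral_sub j2 i2, integral_add j1 (i1.const_mul k),
      integral_sub (integrable_const b) i0, integral_const_mul, integral_const_mul,
      integral_const_mul, e0, e1, e2, e3, e4, integral_const, probReal_univ, one_smul]
    have h0 : 0 ≤ ∫ z, a z ^ 2 ∂κ := integral_nonneg fun z => sq_nonneg _
    have h1 := mul_le_mul_of_nonneg_left hA hk
    have h2 : r₁ * ((∫ z, a z ^ 2 ∂κ) * ∫ z, a z ^ 2 ∂κ) ≤ r₁ * A ^ 2 := by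
      rw [sq]
      exact mul_le_mul_of_nonneg_left (mul_le_mul hA hA h0 (h0.trans hA)) hr₁
    have h3 : r₂ * ((∫ z, a z ∂κ) * ∫ z, a z ∂κ) ≤ r₂ * A := by
      rw [← sq]
      exact mul_le_mul_of_nonneg_left ((sq_integral_le ha2).trans hA) hr₂
    linarith
  · rw [ofReal_integral_eq_lintegral_ofReal j5
      (Eventually.of_forall fun ζ => (hF0 ζ).trans (hF ζ))]
    exact lintegral_mono fun ζ => ENNReal.ofReal_le_ofReal (hF ζ)

end Independent

/-! ### The deterministic part of one outer step -/

theorem norm_toLp_le_sum_abs (v : Fin m → ℝ) : ‖WithLp.toLp 2 v‖ ≤ ∑ i, |v i| := by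
  have h0 : 0 ≤ ∑ i, |v i| := Finset.sum_nonneg fun i _ => abs_nonneg _
  refine le_of_sq_le_sq ?_ h0
  rw [EuclideanSpace.norm_sq_eq]
  exact Finset.sum_sq_le_sq_sum_of_nonneg fun i _ => norm_nonneg _

theorem norm_sum_smul_le_sum_norm {E : Type*} [NormedAddCommGroup E] [NormedSpace ℝ E]
    {w : EuclideanSpace ℝ (Fin m)} (hw : w ∈ simplex m) (y : Fin m → E) :
    ‖∑ i, w i • y i‖ ≤ ∑ i, ‖y i‖ := by
  refine (norm_sum_le _ _).trans (Finset.sum_le_sum fun i _ => ?_)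
  rw [norm_smul, Real.norm_eq_abs, abs_of_nonneg (hw.1 i)]
  have h1 : w i ≤ 1 :=
    hw.2 ▸ Finset.single_le_sum (f := fun i => w i) (fun j _ => hw.1 j) (Finset.mem_univ i)
  exact mul_le_of_le_one_left (norm_nonneg _) h1

theorem norm_sum_smul_sq_le {E : Type*} [NormedAddCommGroup E] [NormedSpace ℝ E]
    {w : EuclideanSpace ℝ (Fin m)} (hw : w ∈ simplex m) {y : Fin m → E} {r : ℝ} (hr : 0 ≤ r)
    (hy : ∀ i, ‖y i‖ ^ 2 ≤ r) : ‖∑ i, w i • y i‖ ^ 2 ≤ r := by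
  have h1 : ‖∑ i, w i • y i‖ ≤ √r := by
    refine (norm_sum_le _ _).trans ?_
    calc ∑ i, ‖w i • y i‖ ≤ ∑ i, w i * √r := by
          refine Finset.sum_le_sum fun i _ => ?_
          rw [norm_smul, Real.norm_eq_abs, abs_of_nonneg (hw.1 i)]
          exact mul_le_mul_of_nonneg_left (Real.le_sqrt_of_sq_le (hy i)) (hw.1 i)
      _ = √r := by rw [← Finset.sum_mul, hw.2, one_mul]
  calc _ ≤ √r ^ 2 := pow_le_pow_left₀ (norm_nonneg _) h1 2
    _ = r := Real.sq_sqrt hr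

/-- The standard projected-gradient inequality has the error `⟪g, w - v⟫ - ‖w - v‖²/(2β)`, with `v`
the new point. Completing the square gives the first entry of the minimum, and `‖w - v‖ ≤ 2` on the
simplex gives the second, which is linear in `‖g‖`. -/
theorem norm_proj_sub_sq_le (hm : 0 < m) {w u : EuclideanSpace ℝ (Fin m)} (hw : w ∈ simplex m)
    (hu : u ∈ simplex m) (g : EuclideanSpace ℝ (Fin m)) {β : ℝ} (hβ : 0 < β) :
    ‖proj (w - β • g) - u‖ ^ 2 / (2 * β) ≤ ‖w - u‖ ^ 2 / (2 * β) - Inner.inner ℝ g (w - u) +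
      min (β / 2 * ‖g‖ ^ 2) (2 * ‖g‖) := by
  set v := proj (w - β • g) with hv
  have hvs : v ∈ simplex m := (proj_spec hm _).1
  have h1 := inner_sub_proj_le hm (w - β • g) hu
  rw [← hv] at h1
  have e1 : ‖v - u‖ ^ 2 = ‖w - u‖ ^ 2 - 2 * β * Inner.inner ℝ g (w - u) +
      2 * β * Inner.inner ℝ g (w - v) - ‖w - v‖ ^ 2 +
      2 * Inner.inner ℝ (w - β • g - v) (u - v) := by
    simp only [← real_inner_self_eq_norm_sq, inner_sub_left, inner_sub_right,
      real_inner_smul_left]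
    rw [real_inner_comm v u, real_inner_comm v w, real_inner_comm u w]
    ring
  have h2 : Inner.inner ℝ g (w - v) ≤ ‖g‖ * ‖w - v‖ := real_inner_le_norm _ _
  have h3 : ‖w - v‖ ≤ 2 := (norm_sub_le _ _).trans (by
    linarith [norm_le_one_of_mem_simplex hw, norm_le_one_of_mem_simplex hvs])
  have h4 : 2 * β * Inner.inner ℝ g (w - v) ≤ 2 * β * (‖g‖ * ‖w - v‖) :=
    mul_le_mul_of_nonneg_left h2 (by positivity)
  have h5 : 2 * β * (‖g‖ * ‖w - v‖) - ‖w - v‖ ^ 2 ≤ 2 * β * (β / 2 * ‖g‖ ^ 2) := by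
    nlinarith [sq_nonneg (β * ‖g‖ - ‖w - v‖)]
  have h6 : 2 * β * (‖g‖ * ‖w - v‖) - ‖w - v‖ ^ 2 ≤ 2 * β * (2 * ‖g‖) := by
    have : 2 * β * (‖g‖ * ‖w - v‖) ≤ 2 * β * (‖g‖ * 2) :=
      mul_le_mul_of_nonneg_left (mul_le_mul_of_nonneg_left h3 (norm_nonneg _)) (by positivity)
    nlinarith [sq_nonneg ‖w - v‖]
  have h7 : 2 * β * (‖g‖ * ‖w - v‖) - ‖w - v‖ ^ 2 ≤
      2 * β * min (β / 2 * ‖g‖ ^ 2) (2 * ‖g‖) := by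
    rcases min_choice (β / 2 * ‖g‖ ^ 2) (2 * ‖g‖) with h | h <;> rw [h] <;> assumption
  rw [div_le_iff₀ (by positivity)]
  have e2 : (‖w - u‖ ^ 2 / (2 * β) - Inner.inner ℝ g (w - u) +
      min (β / 2 * ‖g‖ ^ 2) (2 * ‖g‖)) * (2 * β) = ‖w - u‖ ^ 2 - 2 * β * Inner.inner ℝ g (w - u) +
      2 * β * min (β / 2 * ‖g‖ ^ 2) (2 * ‖g‖) := by
    field_simp
  rw [e2]
  linarith

/-- The Lyapunov function of the outer loop, relative to a fixed weight vector `u`. -/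
def Problem.potential (p : Problem n m lam Ξ) (a : Params) (u : EuclideanSpace ℝ (Fin m))
    (s : State n m) : ℝ :=
  (∑ i, u i * (p.phi i s.1 - ⨅ θ, p.phi i θ)) / a.α + ‖s.2.1 - u‖ ^ 2 / (2 * a.β)

theorem Problem.potential_nonneg {p : Problem n m lam Ξ}
    (hb : ∀ i, BddBelow (Set.range (p.phi i))) {a : Params} (hα : 0 ≤ a.α) (hβ : 0 ≤ a.β)
    {u : EuclideanSpace ℝ (Fin m)} (hu : u ∈ simplex m) (s : State n m) :
    0 ≤ p.potential a u s := by
  refine add_nonneg (div_nonneg (Finset.sum_nonneg fun i _ => mul_nonneg (hu.1 i) ?_) hα)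
    (by positivity)
  exact sub_nonneg.2 (ciInf_le (hb i) s.1)

theorem Problem.Regular.potential_step_le {p : Problem n m lam Ξ} {G L M κ : ℝ}
    (h : p.Regular G L M κ) (hG : 0 ≤ G) (hL : 0 ≤ L) (hlam : 0 < lam) (hM : 0 < M)
    (hm : 0 < m) {a : Params} (hα : 0 < a.α) (hβ : 0 < a.β) (hρ : 0 ≤ a.ρ)
    {start : (Fin m → ℝ) → Fin m → ℝ} {D : ℕ} {s : State n m} (b : Batch m D Ξ)
    (hw : s.2.1 ∈ simplex m) {u : EuclideanSpace ℝ (Fin m)} (hu : u ∈ simplex m)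
    {c : Fin 3 → ℝ} (hc : ∀ j, c j = ∑ i, ‖p.estimate a.γ s b j i‖) :
    p.potential a u (p.step a start s b) ≤ p.potential a u s + a.ρ
      - Inner.inner ℝ (p.gradPhi s.1 u) (∑ i, s.2.1 i • p.estimate a.γ s b 0 i)
      + (L + G ^ 2 * (M / lam)) * a.α * c 0 ^ 2
      - Inner.inner ℝ (∑ i, (s.2.1 - u) i • p.estimate a.γ s b 1 i)
          (∑ i, s.2.1 i • p.estimate a.γ s b 2 i)
      + min (a.β * (c 1 ^ 2 * c 2 ^ 2 + a.ρ ^ 2)) (2 * (c 1 * c 2 + a.ρ)) := by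
  set y := p.estimate a.γ s b
  set w := s.2.1
  have hc0 : ∀ j, 0 ≤ c j := fun j => by
    rw [hc]; exact Finset.sum_nonneg fun i _ => norm_nonneg _
  set K := L + G ^ 2 * (M / lam) with hK
  have hK0 : 0 ≤ K := by positivity
  set v₀ := ∑ i, w i • y 0 i with hv₀
  set v₂ := ∑ i, w i • y 2 i with hv₂
  have hv₀c : ‖v₀‖ ≤ c 0 := (norm_sum_smul_le_sum_norm hw _).trans_eq (hc 0).symm
  have hv₂c : ‖v₂‖ ≤ c 2 := (norm_sum_smul_le_sum_norm hw _).trans_eq (hc 2).symm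
  set θ' := s.1 - a.α • v₀ with hθ'
  -- descent of the weighted objective
  have h1 : ∀ i, p.phi i θ' - (⨅ θ, p.phi i θ) ≤ p.phi i s.1 - (⨅ θ, p.phi i θ)
      - a.α * Inner.inner ℝ (gradient (p.phi i) s.1) v₀ + K * a.α ^ 2 * c 0 ^ 2 := by
    intro i
    have h2 := h.phi_le hG hL hlam hM
      (h.norm_meanGradTheta_sub_gradient_le hG hL hlam hM i s.1) θ'
    have e1 : θ' - s.1 = -(a.α • v₀) := by rw [hθ']; abel
    rw [e1, inner_neg_right, real_inner_smul_right, norm_neg, norm_smul, mul_pow,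
      Real.norm_eq_abs, sq_abs, ← hK] at h2
    have h3 : ‖v₀‖ ^ 2 ≤ c 0 ^ 2 := pow_le_pow_left₀ (norm_nonneg _) hv₀c 2
    have h4 := mul_le_mul_of_nonneg_left h3 (by positivity : 0 ≤ K * a.α ^ 2)
    linarith
  have h5 : (∑ i, u i * (p.phi i θ' - ⨅ θ, p.phi i θ)) / a.α ≤
      (∑ i, u i * (p.phi i s.1 - ⨅ θ, p.phi i θ)) / a.α
        - Inner.inner ℝ (p.gradPhi s.1 u) v₀ + K * a.α * c 0 ^ 2 := by
    have h6 : ∑ i, u i * (p.phi i θ' - ⨅ θ, p.phi i θ) ≤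
        ∑ i, u i * (p.phi i s.1 - ⨅ θ, p.phi i θ) -
          a.α * Inner.inner ℝ (p.gradPhi s.1 u) v₀ + K * a.α ^ 2 * c 0 ^ 2 := by
      have e2 : a.α * Inner.inner ℝ (p.gradPhi s.1 u) v₀ =
          ∑ i, u i * (a.α * Inner.inner ℝ (gradient (p.phi i) s.1) v₀) := by
        rw [Problem.gradPhi, sum_inner, Finset.mul_sum]
        refine Finset.sum_congr rfl fun i _ => ?_
        rw [real_inner_smul_left]; ring
      have e3 : K * a.α ^ 2 * c 0 ^ 2 = ∑ i, u i * (K * a.α ^ 2 * c 0 ^ 2) := by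
        rw [← Finset.sum_mul, hu.2, one_mul]
      rw [e2, e3, ← Finset.sum_sub_distrib, ← Finset.sum_add_distrib]
      refine Finset.sum_le_sum fun i _ => ?_
      have := mul_le_mul_of_nonneg_left (h1 i) (hu.1 i)
      linarith
    rw [div_le_iff₀ hα]
    refine h6.trans (le_of_eq ?_)
    field_simp
  -- the projected step
  set g₀ : EuclideanSpace ℝ (Fin m) := WithLp.toLp 2 fun i => Inner.inner ℝ (y 1 i) v₂ with hg₀
  have h7 := norm_proj_sub_sq_le hm hw hu (g₀ + a.ρ • w) hβ
  have h8 : ‖g₀ + a.ρ • w‖ ≤ c 1 * c 2 + a.ρ := by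
    refine (norm_add_le _ _).trans (add_le_add ?_ ?_)
    · refine (norm_toLp_le_sum_abs _).trans ?_
      rw [hc 1, Finset.sum_mul]
      exact Finset.sum_le_sum fun i _ => (abs_real_inner_le_norm _ _).trans
        (mul_le_mul_of_nonneg_left hv₂c (norm_nonneg _))
    · rw [norm_smul, Real.norm_eq_abs, abs_of_nonneg hρ]
      exact mul_le_of_le_one_right hρ (norm_le_one_of_mem_simplex hw)
  have h9 : min (a.β / 2 * ‖g₀ + a.ρ • w‖ ^ 2) (2 * ‖g₀ + a.ρ • w‖) ≤
      min (a.β * (c 1 ^ 2 * c 2 ^ 2 + a.ρ ^ 2)) (2 * (c 1 * c 2 + a.ρ)) := by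
    refine min_le_min ?_ (by linarith)
    have h10 : ‖g₀ + a.ρ • w‖ ^ 2 ≤ (c 1 * c 2 + a.ρ) ^ 2 :=
      pow_le_pow_left₀ (norm_nonneg _) h8 2
    have h11 : (c 1 * c 2 + a.ρ) ^ 2 ≤ 2 * (c 1 ^ 2 * c 2 ^ 2 + a.ρ ^ 2) := by
      nlinarith [sq_nonneg (c 1 * c 2 - a.ρ)]
    nlinarith
  have h12 : Inner.inner ℝ (g₀ + a.ρ • w) (w - u) =
      Inner.inner ℝ (∑ i, (w - u) i • y 1 i) v₂ + a.ρ * Inner.inner ℝ w (w - u) := by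
    rw [inner_add_left, real_inner_smul_left, sum_inner]
    congr 1
    rw [hg₀, PiLp.inner_apply]
    refine Finset.sum_congr rfl fun i _ => ?_
    rw [real_inner_smul_left]
    simp
  -- The regularization of the `w`-step therefore costs at most `ρ` in the potential.
  have h13 : -1 ≤ Inner.inner ℝ w (w - u) := by
    rw [inner_sub_right]
    have h14 := real_inner_le_norm w u
    have h15 : ‖w‖ * ‖u‖ ≤ 1 := mul_le_one₀ (norm_le_one_of_mem_simplex hw) (norm_nonneg _)
      (norm_le_one_of_mem_simplex hu)
    have h16 : 0 ≤ Inner.inner ℝ w w := real_inner_self_nonneg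
    linarith
  have h17 := mul_le_mul_of_nonneg_left h13 hρ
  rw [h12] at h7
  change (∑ i, u i * (p.phi i θ' - ⨅ θ, p.phi i θ)) / a.α +
    ‖proj (w - a.β • (g₀ + a.ρ • w)) - u‖ ^ 2 / (2 * a.β) ≤
    (∑ i, u i * (p.phi i s.1 - ⨅ θ, p.phi i θ)) / a.α + ‖w - u‖ ^ 2 / (2 * a.β) + a.ρ - _ + _ - _ + _
  linarith

/-! ### One outer sample with its uniformly drawn inner index -/

instance isProbabilityMeasure_uniformOn_univ {D : ℕ} [NeZero D] :
    IsProbabilityMeasure (uniformOn (Set.univ : Set (Fin D))) :=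
  isProbabilityMeasure_uniformOn Set.finite_univ Set.univ_nonempty

theorem uniformOn_univ_eq_smul_count {D : ℕ} :
    uniformOn (Set.univ : Set (Fin D)) = (D : ℝ≥0∞)⁻¹ • Measure.count := by
  simp [uniformOn, ProbabilityTheory.cond, Measure.count_univ]

theorem integral_prod_uniformOn {X : Type*} [MeasurableSpace X] {ν : Measure X}
    [IsProbabilityMeasure ν] {D : ℕ} [NeZero D] {E : Type*} [NormedAddCommGroup E]
    [NormedSpace ℝ E] [CompleteSpace E] {g : X × Fin D → E}
    (hgm : AEStronglyMeasurable g (ν.prod (uniformOn (Set.univ : Set (Fin D)))))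
    (hg : ∀ d, Integrable (fun x => g (x, d)) ν) :
    Integrable g (ν.prod (uniformOn (Set.univ : Set (Fin D)))) ∧
    ∫ z, g z ∂(ν.prod (uniformOn (Set.univ : Set (Fin D)))) =
      (D : ℝ)⁻¹ • ∑ d : Fin D, ∫ x, g (x, d) ∂ν := by
  have hi : Integrable g (ν.prod (uniformOn (Set.univ : Set (Fin D)))) :=
    (integrable_prod_iff' hgm).2 ⟨Eventually.of_forall hg, Integrable.of_finite⟩
  refine ⟨hi, ?_⟩
  rw [integral_prod_symm _ hi, uniformOn_univ_eq_smul_count, integral_smul_measure,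
    integral_count]
  simp

/-- A bound for the second moment of the total length of the columns of a stochastic gradient
matrix, relative to `1 +` the inner error; here `σ` bounds the deviation of the weights. -/
def momentConst (m : ℕ) (G σ : ℝ) : ℝ := m * G ^ 2 * (m * (2 + σ ^ 2) + 2)

theorem momentConst_nonneg (m : ℕ) (G σ : ℝ) : 0 ≤ momentConst m G σ := by
  unfold momentConst; positivity

/-- The factor of the inner error in the one-step inequality. -/
def errorConst (G K C : ℝ) : ℝ := G ^ 2 + K * C + 4 * C + 2

/-- To be read with `P = ∇Φ w`, `Q = ∇Φ u` and `V`, `V'` the corresponding mean estimates. The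
left-hand side equals `⟪V' - Q, V⟫ - ‖V‖²`, at most `r/2 - ‖V‖²/2`, and `‖P‖² ≤ 2‖V‖² + 2r`. -/
theorem neg_inner_sub_inner_le {E : Type*} [NormedAddCommGroup E] [InnerProductSpace ℝ E]
    {P Q V V' : E} {r : ℝ} (hP : ‖V - P‖ ^ 2 ≤ r) (hQ : ‖V' - Q‖ ^ 2 ≤ r) :
    - Inner.inner ℝ Q V - Inner.inner ℝ (V - V') V ≤ - (1 / 4 * ‖P‖ ^ 2) + r := by
  have h1 : - Inner.inner ℝ Q V - Inner.inner ℝ (V - V') V =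
      Inner.inner ℝ (V' - Q) V - ‖V‖ ^ 2 := by
    rw [inner_sub_left, inner_sub_left, real_inner_self_eq_norm_sq]; ring
  have h2 := real_inner_le_norm (V' - Q) V
  have h3 : ‖P‖ ≤ ‖V‖ + ‖V - P‖ := by
    have := norm_sub_le V (V - P)
    rwa [sub_sub_cancel] at this
  have h4 : ‖P‖ ^ 2 ≤ (‖V‖ + ‖V - P‖) ^ 2 := pow_le_pow_left₀ (norm_nonneg _) h3 2
  nlinarith [sq_nonneg (‖V‖ - ‖V - P‖), sq_nonneg (‖V' - Q‖ - ‖V‖)]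

namespace Problem.Regular

variable {p : Problem n m lam Ξ} {G L M κ : ℝ}

section Sample

variable {ν : Measure (Fin m → Ξ)} {D : ℕ}

theorem measurable_sampleGrad (h : p.Regular G L M κ) (hlam : lam ≠ 0) (i : Fin m)
    (θ : EuclideanSpace ℝ (Fin n)) (e : Fin D → Fin m → ℝ) :
    Measurable fun z : (Fin m → Ξ) × Fin D => p.gradTheta i θ (e z.2 i) (z.1 i) :=
  h.measurable_gradTheta_comp hlam i measurable_const
    ((measurable_from_top (f := fun d => e d i)).comp measurable_snd)
    ((measurable_pi_apply i).comp measurable_fst)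

theorem measurable_gradTheta_right (h : p.Regular G L M κ) (hlam : lam ≠ 0) (i : Fin m)
    (θ : EuclideanSpace ℝ (Fin n)) (η : ℝ) : Measurable (p.gradTheta i θ η) :=
  h.measurable_gradTheta_comp hlam i measurable_const measurable_const measurable_id'

theorem integrable_gradTheta (h : p.Regular G L M κ) (hG : 0 ≤ G) (hlam : lam ≠ 0)
    (hν : ∀ i, ν.map (fun x => x i) = p.P i) (i : Fin m)
    (θ : EuclideanSpace ℝ (Fin n)) (η : ℝ) :
    Integrable (fun x : Fin m → Ξ => p.gradTheta i θ η (x i)) ν ∧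
      ∫ x, p.gradTheta i θ η (x i) ∂ν = p.meanGradTheta i θ η := by
  have h1 : Integrable (p.gradTheta i θ η) (p.P i) := by
    refine (h.integrable_weight_smul hG i θ θ η).congr (Eventually.of_forall fun ξ => ?_)
    exact (h.gradTheta_eq hlam i θ η ξ).symm
  rw [← hν i] at h1
  refine ⟨h1.comp_measurable (measurable_pi_apply i), ?_⟩
  have h2 := integral_map (μ := ν) (φ := fun x : Fin m → Ξ => x i)
    (measurable_pi_apply i).aemeasurable h1.aestronglyMeasurable
  rw [← h2, hν i]
  exact integral_congr_ae (Eventually.of_forall fun ξ => h.gradTheta_eq hlam i θ η ξ)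

theorem integrable_norm_gradTheta_sq (h : p.Regular G L M κ) (hG : 0 ≤ G) (hlam : lam ≠ 0)
    (hν : ∀ i, ν.map (fun x => x i) = p.P i) (i : Fin m)
    (θ : EuclideanSpace ℝ (Fin n)) (η : ℝ) :
    Integrable (fun x : Fin m → Ξ => ‖p.gradTheta i θ η (x i)‖ ^ 2) ν ∧
      ∫ x, ‖p.gradTheta i θ η (x i)‖ ^ 2 ∂ν ≤
        G ^ 2 * (2 + (M / lam * κ) ^ 2 + 2 * p.meanGradEta i θ η ^ 2) := by
  have hm := h.measurable_gradTheta_right hlam i θ η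
  have h1 : Integrable (fun ξ => ‖p.gradTheta i θ η ξ‖ ^ 2) (p.P i) := by
    refine ((h.memLp_weight i θ η).integrable_sq.const_mul (G ^ 2)).mono'
      (hm.norm.pow_const 2).aestronglyMeasurable (Eventually.of_forall fun ξ => ?_)
    rw [Real.norm_eq_abs, abs_of_nonneg (sq_nonneg _), h.gradTheta_eq hlam, norm_smul, mul_pow,
      mul_comm, Real.norm_eq_abs, sq_abs]
    exact mul_le_mul_of_nonneg_right
      (pow_le_pow_left₀ (norm_nonneg _) (h.norm_lossGrad_le hG i θ ξ) 2) (sq_nonneg _)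
  have h3 : ∫ ξ, ‖p.gradTheta i θ η ξ‖ ^ 2 ∂(p.P i) ≤
      G ^ 2 * (2 + (M / lam * κ) ^ 2 + 2 * p.meanGradEta i θ η ^ 2) := by
    refine le_trans (le_of_eq ?_) (h.integral_norm_weight_smul_sq_le hG i θ η)
    exact integral_congr_ae (Eventually.of_forall fun ξ => by
      simp only [h.gradTheta_eq hlam])
  rw [← hν i] at h1
  refine ⟨h1.comp_measurable (measurable_pi_apply i), ?_⟩
  have h2 := integral_map (μ := ν) (φ := fun x : Fin m → Ξ => x i)
    (measurable_pi_apply i).aemeasurable h1.aestronglyMeasurable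
  refine (h2.symm.trans ?_).trans_le h3
  rw [hν i]

/-- Averaging over the uniform index turns bounds in terms of `d²` at a single iterate into bounds
in terms of `q`. The bias uses Cauchy–Schwarz over the `D` indices, the second moment Cauchy–Schwarz
over the `m` columns. -/
theorem sampleGrad_moments [IsProbabilityMeasure ν] [NeZero D] (h : p.Regular G L M κ)
    (hG : 0 ≤ G) (hL : 0 ≤ L) (hlam : 0 < lam)
    (hM : 0 < M) (hν : ∀ i, ν.map (fun x => x i) = p.P i)
    (θ : EuclideanSpace ℝ (Fin n)) (e : Fin D → Fin m → ℝ) {q : ℝ}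
    (hq : q = (D : ℝ)⁻¹ * ∑ i, ∑ d : Fin D, p.meanGradEta i θ (e d i) ^ 2) :
    (∀ i, Integrable (fun z : (Fin m → Ξ) × Fin D => p.gradTheta i θ (e z.2 i) (z.1 i))
      (ν.prod (uniformOn (Set.univ : Set (Fin D))))) ∧
    (∀ i, ‖∫ z : (Fin m → Ξ) × Fin D, p.gradTheta i θ (e z.2 i) (z.1 i)
      ∂(ν.prod (uniformOn (Set.univ : Set (Fin D)))) - gradient (p.phi i) θ‖ ^ 2 ≤ G ^ 2 * q) ∧
    MemLp (fun z : (Fin m → Ξ) × Fin D => ∑ i, ‖p.gradTheta i θ (e z.2 i) (z.1 i)‖) 2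
      (ν.prod (uniformOn (Set.univ : Set (Fin D)))) ∧
    ∫ z : (Fin m → Ξ) × Fin D, (∑ i, ‖p.gradTheta i θ (e z.2 i) (z.1 i)‖) ^ 2
      ∂(ν.prod (uniformOn (Set.univ : Set (Fin D)))) ≤
        momentConst m G (M / lam * κ) * (1 + q) := by
  set U := ν.prod (uniformOn (Set.univ : Set (Fin D)))
  have hD : (0 : ℝ) < D := by exact_mod_cast NeZero.pos D
  have hym := fun i => h.measurable_sampleGrad (Ξ := Ξ) hlam.ne' i θ e
  have hfirst := fun i => integral_prod_uniformOn (ν := ν) (hym i).aestronglyMeasurable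
    fun d => (h.integrable_gradTheta hG hlam.ne' hν i θ (e d i)).1
  have hsecond := fun i => integral_prod_uniformOn (ν := ν)
    (g := fun z : (Fin m → Ξ) × Fin D => ‖p.gradTheta i θ (e z.2 i) (z.1 i)‖ ^ 2)
    ((hym i).norm.pow_const 2).aestronglyMeasurable
    fun d => (h.integrable_norm_gradTheta_sq hG hlam.ne' hν i θ (e d i)).1
  have hmem : ∀ i, MemLp (fun z : (Fin m → Ξ) × Fin D =>
      ‖p.gradTheta i θ (e z.2 i) (z.1 i)‖) 2 U := fun i =>
    (memLp_two_iff_integrable_sq (hym i).norm.aestronglyMeasurable).2 (hsecond i).1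
  have hmemsum : MemLp (fun z : (Fin m → Ξ) × Fin D =>
      ∑ i, ‖p.gradTheta i θ (e z.2 i) (z.1 i)‖) 2 U := memLp_finsetSum _ fun i _ => hmem i
  refine ⟨fun i => (hfirst i).1, fun i => ?_, hmemsum, ?_⟩
  · have e1 : ∫ z : (Fin m → Ξ) × Fin D, p.gradTheta i θ (e z.2 i) (z.1 i) ∂U
        - gradient (p.phi i) θ =
        (D : ℝ)⁻¹ • ∑ d : Fin D, (p.meanGradTheta i θ (e d i) - gradient (p.phi i) θ) := by
      rw [(hfirst i).2, Finset.sum_sub_distrib, smul_sub]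
      congr 1
      · congr 1
        exact Finset.sum_congr rfl fun d _ =>
          (h.integrable_gradTheta hG hlam.ne' hν i θ (e d i)).2
      · rw [Finset.sum_const, Finset.card_univ, Fintype.card_fin, ← Nat.cast_smul_eq_nsmul ℝ,
          smul_smul, inv_mul_cancel₀ hD.ne', one_smul]
    rw [e1]
    have h1 : ‖(D : ℝ)⁻¹ • ∑ d : Fin D, (p.meanGradTheta i θ (e d i) - gradient (p.phi i) θ)‖ ≤
        (D : ℝ)⁻¹ * ∑ d : Fin D, G * |p.meanGradEta i θ (e d i)| := by
      rw [norm_smul, Real.norm_eq_abs, abs_of_nonneg (by positivity)]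
      refine mul_le_mul_of_nonneg_left ((norm_sum_le _ _).trans (Finset.sum_le_sum fun d _ =>
        h.norm_meanGradTheta_sub_gradient_le hG hL hlam hM i θ _)) (by positivity)
    refine (pow_le_pow_left₀ (norm_nonneg _) h1 2).trans ?_
    have h2 : (∑ d : Fin D, G * |p.meanGradEta i θ (e d i)|) ^ 2 ≤
        D * ∑ d : Fin D, (G * |p.meanGradEta i θ (e d i)|) ^ 2 := by
      have := sq_sum_le_card_mul_sum_sq (s := (Finset.univ : Finset (Fin D)))
        (f := fun d => G * |p.meanGradEta i θ (e d i)|)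
      simpa using this
    rw [mul_pow]
    refine (mul_le_mul_of_nonneg_left h2 (by positivity)).trans ?_
    have h3 : ∑ d : Fin D, p.meanGradEta i θ (e d i) ^ 2 ≤
        ∑ i, ∑ d : Fin D, p.meanGradEta i θ (e d i) ^ 2 :=
      Finset.single_le_sum (f := fun i => ∑ d : Fin D, p.meanGradEta i θ (e d i) ^ 2)
        (fun j _ => Finset.sum_nonneg fun _ _ => sq_nonneg _) (Finset.mem_univ i)
    simp_rw [mul_pow, sq_abs]
    rw [← Finset.mul_sum, hq]
    have h4 : (D : ℝ)⁻¹ ^ 2 * (D * (G ^ 2 * ∑ d : Fin D, p.meanGradEta i θ (e d i) ^ 2)) =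
        G ^ 2 * ((D : ℝ)⁻¹ * ∑ d : Fin D, p.meanGradEta i θ (e d i) ^ 2) := by
      field_simp
    rw [h4]
    gcongr
  · have h1 : ∫ z : (Fin m → Ξ) × Fin D, (∑ i, ‖p.gradTheta i θ (e z.2 i) (z.1 i)‖) ^ 2 ∂U ≤
        ∫ z : (Fin m → Ξ) × Fin D, m * ∑ i, ‖p.gradTheta i θ (e z.2 i) (z.1 i)‖ ^ 2 ∂U := by
      refine integral_mono hmemsum.integrable_sq ((integrable_finsetSum _ fun i _ =>
        (hsecond i).1).const_mul _) fun z => ?_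
      have := sq_sum_le_card_mul_sum_sq (s := (Finset.univ : Finset (Fin m)))
        (f := fun i => ‖p.gradTheta i θ (e z.2 i) (z.1 i)‖)
      simpa using this
    refine h1.trans ?_
    rw [integral_const_mul, integral_finsetSum _ fun i _ => (hsecond i).1]
    have h2 : ∀ i, ∫ z : (Fin m → Ξ) × Fin D, ‖p.gradTheta i θ (e z.2 i) (z.1 i)‖ ^ 2 ∂U ≤
        G ^ 2 * (2 + (M / lam * κ) ^ 2) +
          2 * G ^ 2 * ((D : ℝ)⁻¹ * ∑ d : Fin D, p.meanGradEta i θ (e d i) ^ 2) := by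
      intro i
      rw [(hsecond i).2, smul_eq_mul]
      calc _ ≤ (D : ℝ)⁻¹ * ∑ d : Fin D,
            G ^ 2 * (2 + (M / lam * κ) ^ 2 + 2 * p.meanGradEta i θ (e d i) ^ 2) :=
          mul_le_mul_of_nonneg_left (Finset.sum_le_sum fun d _ =>
            (h.integrable_norm_gradTheta_sq hG hlam.ne' hν i θ (e d i)).2) (by positivity)
        _ = _ := by
          rw [← Finset.mul_sum, Finset.sum_add_distrib, Finset.sum_const, Finset.card_univ,
            Fintype.card_fin, nsmul_eq_mul, ← Finset.mul_sum]
          field_simp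
    have h3 : ∑ i, ∫ z : (Fin m → Ξ) × Fin D, ‖p.gradTheta i θ (e z.2 i) (z.1 i)‖ ^ 2 ∂U ≤
        m * (G ^ 2 * (2 + (M / lam * κ) ^ 2)) + 2 * G ^ 2 * q := by
      refine (Finset.sum_le_sum fun i _ => h2 i).trans (le_of_eq ?_)
      rw [Finset.sum_add_distrib, Finset.sum_const, Finset.card_univ, Fintype.card_fin,
        nsmul_eq_mul, ← Finset.mul_sum, ← Finset.mul_sum, hq]
    have hq0 : 0 ≤ q := by
      rw [hq]
      exact mul_nonneg (by positivity)
        (Finset.sum_nonneg fun _ _ => Finset.sum_nonneg fun _ _ => sq_nonneg _)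
    have h4 := mul_le_mul_of_nonneg_left h3 (Nat.cast_nonneg (α := ℝ) m)
    refine h4.trans ?_
    have h5 : 0 ≤ (m : ℝ) * G ^ 2 * (m * (2 + (M / lam * κ) ^ 2)) * q := by positivity
    have h6 : 0 ≤ (m : ℝ) * G ^ 2 * 2 := by positivity
    rw [momentConst]
    linarith

end Sample

/-! ### One outer step in expectation -/

/-- This is the step conditioned on the inner samples `x`: the inner iterates and `q` are fixed, and
the three pairs of sample and index are independent copies. The right-hand side is linear in `q`. -/
theorem lintegral_potential_step_fixed_inner_le (h : p.Regular G L M κ) (hG : 0 ≤ G) (hL : 0 ≤ L)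
    (hlam : 0 < lam) (hM : 0 < M) (hm : 0 < m) (hb : ∀ i, BddBelow (Set.range (p.phi i)))
    {ν : Measure (Fin m → Ξ)} [IsProbabilityMeasure ν] {D : ℕ} [NeZero D]
    (hν : ∀ i, ν.map (fun x => x i) = p.P i) {a : Params} (hα : 0 < a.α) (hα1 : a.α ≤ 1)
    (hβ : 0 < a.β) (hρ : 0 ≤ a.ρ) (hρ1 : a.ρ ≤ 1) (start : (Fin m → ℝ) → Fin m → ℝ)
    {s : State n m} (hw : s.2.1 ∈ simplex m) {u : EuclideanSpace ℝ (Fin m)} (hu : u ∈ simplex m)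
    {K C : ℝ} (hK : K = L + G ^ 2 * (M / lam)) (hC : C = momentConst m G (M / lam * κ))
    (x : Fin D → Fin m → Ξ) :
    ENNReal.ofReal (1 / 4 * ‖p.gradPhi s.1 s.2.1‖ ^ 2) +
      ∫⁻ ζ : Fin 3 → (Fin m → Ξ) × Fin D, ENNReal.ofReal (p.potential a u
        (p.step a start s (x, (fun j => (ζ j).1), fun j => (ζ j).2)))
        ∂(Measure.pi fun _ : Fin 3 => ν.prod (uniformOn (Set.univ : Set (Fin D)))) ≤
    ENNReal.ofReal (p.potential a u s + errorConst G K C * p.innerError a.γ s.1 s.2.2 x +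
      (K * C * a.α + a.ρ + a.β * (4 * C ^ 2 + 1))) := by
  set U := ν.prod (uniformOn (Set.univ : Set (Fin D)))
  set θ := s.1
  set w := s.2.1
  set e : Fin D → Fin m → ℝ := fun d i => p.inner a.γ θ s.2.2 x d i with he
  set q := p.innerError a.γ θ s.2.2 x with hq
  have hq0 : 0 ≤ q := p.innerError_nonneg a.γ θ s.2.2 x
  set y : Fin m → (Fin m → Ξ) × Fin D → EuclideanSpace ℝ (Fin n) := fun i z =>
    p.gradTheta i θ (e z.2 i) (z.1 i) with hy
  obtain ⟨hint, hbias, hmem, hA⟩ := h.sampleGrad_moments hG hL hlam hM hν θ e (q := q) rfl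
  rw [← hC] at hA
  have hC0 : 0 ≤ C := hC ▸ momentConst_nonneg _ _ _
  have hK0 : 0 ≤ K := by rw [hK]; positivity
  have hym : ∀ i, Measurable (y i) := fun i => h.measurable_sampleGrad hlam.ne' i θ e
  have hcomb : ∀ v : EuclideanSpace ℝ (Fin m), Measurable (fun z => ∑ i, v i • y i z) ∧
      Integrable (fun z => ∑ i, v i • y i z) U ∧
      ∫ z, ∑ i, v i • y i z ∂U = ∑ i, v i • ∫ z, y i z ∂U := fun v =>
    ⟨Finset.measurable_sum _ fun i _ => (hym i).const_smul (v i),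
      integrable_finsetSum _ fun i _ => (hint i).smul (v i), by
      rw [integral_finsetSum (f := fun i z => v i • y i z) _ fun i _ => (hint i).smul (v i)]
      exact Finset.sum_congr rfl fun i _ => integral_smul _ _⟩
  have ham : Measurable fun z => ∑ i, ‖y i z‖ := Finset.measurable_sum _ fun i _ => (hym i).norm
  -- the pathwise inequality
  set F : (Fin 3 → (Fin m → Ξ) × Fin D) → ℝ := fun ζ => p.potential a u
    (p.step a start s (x, (fun j => (ζ j).1), fun j => (ζ j).2)) with hF
  have hF0 : ∀ ζ, 0 ≤ F ζ := fun ζ => potential_nonneg hb hα.le hβ.le hu _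
  have hpath : ∀ ζ : Fin 3 → (Fin m → Ξ) × Fin D, F ζ ≤ p.potential a u s + a.ρ
      - Inner.inner ℝ (p.gradPhi θ u) (∑ i, w i • y i (ζ 0))
      + K * a.α * (∑ i, ‖y i (ζ 0)‖) ^ 2
      - Inner.inner ℝ (∑ i, (w - u) i • y i (ζ 1)) (∑ i, w i • y i (ζ 2))
      + min (a.β * ((∑ i, ‖y i (ζ 1)‖) ^ 2 * (∑ i, ‖y i (ζ 2)‖) ^ 2 + a.ρ ^ 2))
        (2 * ((∑ i, ‖y i (ζ 1)‖) * (∑ i, ‖y i (ζ 2)‖) + a.ρ)) := fun ζ => by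
    rw [hK]
    exact h.potential_step_le hG hL hlam hM hm hα hβ hρ
      (x, (fun j => (ζ j).1), fun j => (ζ j).2) hw hu (c := fun j => ∑ i, ‖y i (ζ j)‖)
      fun j => rfl
  -- the bias
  have hr : 0 ≤ G ^ 2 * q := by positivity
  have hbias' : ∀ v ∈ simplex m, ‖∑ i, v i • ∫ z, y i z ∂U - p.gradPhi θ v‖ ^ 2 ≤ G ^ 2 * q := by
    intro v hv
    rw [gradPhi, ← Finset.sum_sub_distrib]
    simp_rw [← smul_sub]
    exact norm_sum_smul_sq_le hv hr hbias
  have hdir := neg_inner_sub_inner_le (hbias' w hw) (hbias' u hu)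
  have hdiff : ∑ i, (w - u) i • ∫ z, y i z ∂U =
      ∑ i, w i • ∫ z, y i z ∂U - ∑ i, u i • ∫ z, y i z ∂U := by
    rw [← Finset.sum_sub_distrib]
    exact Finset.sum_congr rfl fun i _ => by rw [PiLp.sub_apply, sub_smul]
  rw [← hdiff] at hdir
  have hAq : K * a.α * (C * (1 + q)) ≤ K * C * a.α + K * C * q := by
    have : K * C * q * a.α ≤ K * C * q := mul_le_of_le_one_right (by positivity) hα1
    linarith
  have hρsq : a.ρ ^ 2 ≤ 1 := pow_le_one₀ hρ hρ1
  obtain ⟨X, hX, hX0, hXF⟩ : ∃ X ≤ p.potential a u s + errorConst G K C * q +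
      (K * C * a.α + a.ρ + a.β * (4 * C ^ 2 + 1)) - 1 / 4 * ‖p.gradPhi θ w‖ ^ 2, 0 ≤ X ∧
      ∫⁻ ζ, ENNReal.ofReal (F ζ) ∂(Measure.pi fun _ : Fin 3 => U) ≤ ENNReal.ofReal X := by
    -- For `q ≤ 1` the quadratic entry of the minimum has mean at most `β(4C² + 1)`. For `q > 1` the
    -- linear one has mean at most `2C(1 + q) + 2ρ ≤ 4Cq + 2q`. This is the source of `4 * C + 2` in
    -- `errorConst`; `G ^ 2` comes from the bias and `K * C` from the `θ`-step with `α ≤ 1`.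
    rcases le_or_gt q 1 with hq1 | hq1
    · obtain ⟨X, hX, hX'⟩ := lintegral_three_copies_le (F := F) (κ := U)
        (b := p.potential a u s + a.ρ + a.β * a.ρ ^ 2) (k := K * a.α) (r₁ := a.β) (r₂ := 0)
        (c := p.gradPhi θ u) (hcomb w).2.1 (hcomb (w - u)).2.1 (hcomb w).2.1 (hcomb (w - u)).1
        (hcomb w).1 ham hmem hA (by positivity) hβ.le le_rfl hF0 fun ζ => by
          have h1 := hpath ζ
          have h2 := min_le_left (a.β * ((∑ i, ‖y i (ζ 1)‖) ^ 2 * (∑ i, ‖y i (ζ 2)‖) ^ 2 + a.ρ ^ 2))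
            (2 * ((∑ i, ‖y i (ζ 1)‖) * (∑ i, ‖y i (ζ 2)‖) + a.ρ))
          linarith
      refine ⟨X, hX.trans ?_, hX'⟩
      rw [(hcomb w).2.2, (hcomb (w - u)).2.2, errorConst]
      have h1 : (C * (1 + q)) ^ 2 ≤ 4 * C ^ 2 := by
        have : C * (1 + q) ≤ C * 2 := mul_le_mul_of_nonneg_left (by linarith) hC0
        have := pow_le_pow_left₀ (by positivity) this 2
        linarith
      have h2 := mul_le_mul_of_nonneg_left h1 hβ.le
      have h3 := mul_le_mul_of_nonneg_left hρsq hβ.le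
      have h4 : 0 ≤ C * q := by positivity
      linarith
    · obtain ⟨X, hX, hX'⟩ := lintegral_three_copies_le (F := F) (κ := U)
        (b := p.potential a u s + a.ρ + 2 * a.ρ) (k := K * a.α) (r₁ := 0) (r₂ := 2)
        (c := p.gradPhi θ u) (hcomb w).2.1 (hcomb (w - u)).2.1 (hcomb w).2.1 (hcomb (w - u)).1
        (hcomb w).1 ham hmem hA (by positivity) le_rfl zero_le_two hF0 fun ζ => by
          have h1 := hpath ζ
          have h2 := min_le_right (a.β * ((∑ i, ‖y i (ζ 1)‖) ^ 2 * (∑ i, ‖y i (ζ 2)‖) ^ 2 + a.ρ ^ 2))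
            (2 * ((∑ i, ‖y i (ζ 1)‖) * (∑ i, ‖y i (ζ 2)‖) + a.ρ))
          linarith
      refine ⟨X, hX.trans ?_, hX'⟩
      rw [(hcomb w).2.2, (hcomb (w - u)).2.2, errorConst]
      have h1 : 0 ≤ a.β * (4 * C ^ 2 + 1) := by positivity
      have h2 : C ≤ C * q := le_mul_of_one_le_right hC0 hq1.le
      linarith
  calc _ ≤ ENNReal.ofReal (1 / 4 * ‖p.gradPhi θ w‖ ^ 2) + ENNReal.ofReal X :=
        add_le_add_right hXF _
    _ = ENNReal.ofReal (1 / 4 * ‖p.gradPhi θ w‖ ^ 2 + X) :=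
        (ENNReal.ofReal_add (by positivity) hX0).symm
    _ ≤ _ := ENNReal.ofReal_le_ofReal (by linarith)

theorem measurable_potential (h : p.Regular G L M κ) (hG : 0 ≤ G) (hL : 0 ≤ L)
    (hlam : 0 < lam) (hM : 0 < M) (a : Params) (u : EuclideanSpace ℝ (Fin m)) :
    Measurable (p.potential a u) := by
  refine Measurable.add (Measurable.div_const (Finset.measurable_sum _ fun i _ =>
    Measurable.const_mul (Measurable.sub_const ?_ _) _) _) (Measurable.div_const ?_ _)
  · exact (h.differentiable_phi hG hL hlam hM i).continuous.measurable.comp measurable_fst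
  · exact (((measurable_fst.comp measurable_snd).sub_const u).norm).pow_const 2

/-- The three samples and three indices are regrouped into three independent pairs, each used by one
estimate. -/
theorem lintegral_batchLaw {ν : Measure (Fin m → Ξ)} [IsProbabilityMeasure ν] {D : ℕ} [NeZero D]
    {F : Batch m D Ξ → ℝ≥0∞} (hF : Measurable F) :
    ∫⁻ b, F b ∂(batchLaw ν D) = ∫⁻ x, ∫⁻ ζ : Fin 3 → (Fin m → Ξ) × Fin D,
      F (x, (fun j => (ζ j).1), fun j => (ζ j).2)
      ∂(Measure.pi fun _ : Fin 3 => ν.prod (uniformOn (Set.univ : Set (Fin D))))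
      ∂(Measure.pi fun _ : Fin D => ν) := by
  rw [batchLaw, lintegral_prod _ hF.aemeasurable]
  refine lintegral_congr fun x => ?_
  have h1 := measurePreserving_arrowProdEquivProdArrow (Fin m → Ξ) (Fin D) (Fin 3) (fun _ => ν)
    (fun _ => uniformOn (Set.univ : Set (Fin D)))
  rw [← h1.lintegral_comp (f := fun y => F (x, y))
    (hF.comp (measurable_const.prodMk measurable_id))]
  rfl

theorem lintegral_potential_step_le (h : p.Regular G L M κ) (hG : 0 ≤ G) (hL : 0 ≤ L)
    (hlam : 0 < lam) (hM : 0 < M) (hm : 0 < m) (hb : ∀ i, BddBelow (Set.range (p.phi i)))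
    {ν : Measure (Fin m → Ξ)} [IsProbabilityMeasure ν] {D : ℕ} [NeZero D]
    (hν : ∀ i, ν.map (fun x => x i) = p.P i) {a : Params} (hα : 0 < a.α) (hα1 : a.α ≤ 1)
    (hβ : 0 < a.β) (hγ : 0 < a.γ) (hγN : M / lam * a.γ ≤ 1 / 2) (hρ : 0 ≤ a.ρ) (hρ1 : a.ρ ≤ 1)
    {start : (Fin m → ℝ) → Fin m → ℝ} (hstart : Measurable start)
    {s : State n m} (hw : s.2.1 ∈ simplex m) {u : EuclideanSpace ℝ (Fin m)} (hu : u ∈ simplex m)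
    {K C : ℝ} (hK : K = L + G ^ 2 * (M / lam)) (hC : C = momentConst m G (M / lam * κ)) :
    ENNReal.ofReal (1 / 4 * ‖p.gradPhi s.1 s.2.1‖ ^ 2) +
      ∫⁻ b, ENNReal.ofReal (p.potential a u (p.step a start s b)) ∂(batchLaw ν D) ≤
    ENNReal.ofReal (p.potential a u s) +
      (ENNReal.ofReal (errorConst G K C * (2 / (a.γ * D))) *
        ∑ i, ENNReal.ofReal (p.obj i s.1 (s.2.2 i) - p.phi i s.1) +
      ENNReal.ofReal (errorConst G K C * (m * (2 * (M / lam) * a.γ * (M / lam * κ) ^ 2)) +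
        (K * C * a.α + a.ρ + a.β * (4 * C ^ 2 + 1)))) := by
  have hC0 : 0 ≤ C := hC ▸ momentConst_nonneg _ _ _
  have hK0 : 0 ≤ K := by rw [hK]; positivity
  have hE0 : 0 ≤ errorConst G K C := by unfold errorConst; positivity
  have hN0 : 0 < M / lam := by positivity
  have hpot := potential_nonneg hb hα.le hβ.le hu s
  have hstep : Measurable fun b : Batch m D Ξ =>
      ENNReal.ofReal (p.potential a u (p.step a start s b)) :=
    ((h.measurable_potential hG hL hlam hM a u).comp ((h.measurable_step hlam.ne' hm a
      hstart).comp (measurable_const.prodMk measurable_id))).ennreal_ofReal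
  have hierr := h.measurable_innerError (D := D) hlam.ne' a.γ s.1 s.2.2
  set r := K * C * a.α + a.ρ + a.β * (4 * C ^ 2 + 1) with hr
  have hr0 : 0 ≤ r := by positivity
  set π := Measure.pi fun _ : Fin D => ν
  set g := ENNReal.ofReal (1 / 4 * ‖p.gradPhi s.1 s.2.1‖ ^ 2)
  rw [lintegral_batchLaw hstep]
  have e1 : g = ∫⁻ _, g ∂π := by simp [π]
  have hinner := h.lintegral_innerError_le hlam hM hγ hγN (NeZero.pos D) ν hν s.1 s.2.2
  calc _ = ∫⁻ x, (g + ∫⁻ ζ : Fin 3 → (Fin m → Ξ) × Fin D, ENNReal.ofReal (p.potential a u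
        (p.step a start s (x, (fun j => (ζ j).1), fun j => (ζ j).2)))
        ∂(Measure.pi fun _ : Fin 3 => ν.prod (uniformOn (Set.univ : Set (Fin D))))) ∂π := by
        rw [lintegral_add_left measurable_const]
        congr 1
    _ ≤ ∫⁻ x, (ENNReal.ofReal (errorConst G K C) * ENNReal.ofReal (p.innerError a.γ s.1 s.2.2 x) +
        ENNReal.ofReal (p.potential a u s + r)) ∂π := by
        refine lintegral_mono fun x => ?_
        refine (h.lintegral_potential_step_fixed_inner_le hG hL hlam hM hm hb hν hα hα1 hβ hρ hρ1
          start hw hu hK hC x).trans (le_of_eq ?_)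
        rw [← ENNReal.ofReal_mul hE0, ← ENNReal.ofReal_add
          (mul_nonneg hE0 (p.innerError_nonneg _ _ _ _)) (by positivity)]
        congr 1
        ring
    _ = ENNReal.ofReal (errorConst G K C) * ∫⁻ x, ENNReal.ofReal (p.innerError a.γ s.1 s.2.2 x) ∂π +
        ENNReal.ofReal (p.potential a u s + r) := by
        rw [lintegral_add_right _ measurable_const, lintegral_const_mul _ hierr.ennreal_ofReal]
        simp [π]
    _ ≤ ENNReal.ofReal (errorConst G K C) * (ENNReal.ofReal (2 / (a.γ * D)) *
          ∑ i, ENNReal.ofReal (p.obj i s.1 (s.2.2 i) - p.phi i s.1) +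
          ENNReal.ofReal (m * (2 * (M / lam) * a.γ * (M / lam * κ) ^ 2))) +
        ENNReal.ofReal (p.potential a u s + r) :=
        add_le_add_left (mul_le_mul_right hinner _) _
    _ = _ := by
        rw [ENNReal.ofReal_add hpot hr0, ENNReal.ofReal_add (mul_nonneg hE0 (by positivity)) hr0,
          ENNReal.ofReal_mul hE0, ENNReal.ofReal_mul hE0]
        ring

end Problem.Regular

/-! ### The law of the outer iterates -/

theorem Problem.run_congr (p : Problem n m lam Ξ) (a : Params)
    (start : (Fin m → ℝ) → Fin m → ℝ) {D : ℕ} (s₀ : State n m) {b b' : ℕ → Batch m D Ξ} {t : ℕ}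
    (hb : ∀ k < t, b k = b' k) : p.run a start s₀ b t = p.run a start s₀ b' t := by
  induction t with
  | zero => rfl
  | succ t ih =>
    simp only [Problem.run]
    rw [ih fun k hk => hb k (by omega), hb t (by omega)]

theorem Problem.run_mem_simplex (p : Problem n m lam Ξ) (hm : 0 < m) (a : Params)
    (start : (Fin m → ℝ) → Fin m → ℝ) {D : ℕ} {s₀ : State n m} (hs₀ : s₀.2.1 ∈ simplex m)
    (b : ℕ → Batch m D Ξ) (t : ℕ) : (p.run a start s₀ b t).2.1 ∈ simplex m := by
  cases t with
  | zero => exact hs₀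
  | succ t => exact (proj_spec hm _).1

namespace Problem.Regular

variable {p : Problem n m lam Ξ} {G L M κ : ℝ}

theorem measurable_run (h : p.Regular G L M κ) (hlam : lam ≠ 0) (hm : 0 < m) (a : Params)
    {start : (Fin m → ℝ) → Fin m → ℝ} (hstart : Measurable start) {D : ℕ} (s₀ : State n m)
    (t : ℕ) : Measurable fun b : ℕ → Batch m D Ξ => p.run a start s₀ b t := by
  induction t with
  | zero => exact measurable_const
  | succ t ih =>
    exact (h.measurable_step hlam hm a hstart).comp (ih.prodMk (measurable_pi_apply t))

variable {Ω : Type*} [MeasurableSpace Ω] {μ : Measure Ω} [IsProbabilityMeasure μ]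

/-- The state at time `t` is a function of the draws before `t` only. -/
theorem indepFun_run (h : p.Regular G L M κ) (hlam : lam ≠ 0) (hm : 0 < m) (a : Params)
    {start : (Fin m → ℝ) → Fin m → ℝ} (hstart : Measurable start) {D : ℕ} (s₀ : State n m)
    {b : ℕ → Ω → Batch m D Ξ} (hbm : ∀ t, Measurable (b t)) (hbi : iIndepFun b μ) (t : ℕ) :
    IndepFun (fun ω => p.run a start s₀ (fun k => b k ω) t) (b t) μ := by
  have hΩ : Nonempty Ω := nonempty_of_isProbabilityMeasure μ
  obtain ⟨ω₀⟩ := hΩ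
  have h1 := hbi.indepFun_finset (Finset.range t) {t} (by simp) hbm
  -- The finite past is padded with an arbitrary constant draw to give the full sequence that `run`
  -- expects.
  set ext : (Finset.range t → Batch m D Ξ) → ℕ → Batch m D Ξ := fun v k =>
    if hk : k ∈ Finset.range t then v ⟨k, hk⟩ else b 0 ω₀ with hext
  have hextm : Measurable ext := by
    refine measurable_pi_iff.2 fun k => ?_
    simp only [hext]
    split_ifs with hk
    · exact measurable_pi_apply _
    · exact measurable_const
  have h2 := h1.comp ((h.measurable_run hlam hm a hstart s₀ t).comp hextm)
    (measurable_pi_apply (⟨t, Finset.mem_singleton_self t⟩ : ({t} : Finset ℕ)))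
  have e1 : (fun ω => p.run a start s₀ (fun k => b k ω) t) =
      ((fun b : ℕ → Batch m D Ξ => p.run a start s₀ b t) ∘ ext) ∘
        fun ω (i : Finset.range t) => b i ω := by
    funext ω
    refine p.run_congr a start s₀ fun k hk => ?_
    simp only [hext, Finset.mem_range.2 hk, dif_pos]
  rw [e1]
  exact h2

theorem lintegral_run_succ (h : p.Regular G L M κ) (hlam : lam ≠ 0) (hm : 0 < m) (a : Params)
    {start : (Fin m → ℝ) → Fin m → ℝ} (hstart : Measurable start) {D : ℕ} (s₀ : State n m)
    {b : ℕ → Ω → Batch m D Ξ} (hbm : ∀ t, Measurable (b t)) (hbi : iIndepFun b μ)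
    {law : Measure (Batch m D Ξ)} [SFinite law] (hlaw : ∀ t, μ.map (b t) = law)
    {F : State n m → ℝ≥0∞} (hF : Measurable F) (t : ℕ) :
    Measurable (fun ω => ∫⁻ y, F (p.step a start (p.run a start s₀ (fun k => b k ω) t) y) ∂law) ∧
    ∫⁻ ω, F (p.run a start s₀ (fun k => b k ω) (t + 1)) ∂μ =
      ∫⁻ ω, ∫⁻ y, F (p.step a start (p.run a start s₀ (fun k => b k ω) t) y) ∂law ∂μ := by
  set S : Ω → State n m := fun ω => p.run a start s₀ (fun k => b k ω) t
  have hS : Measurable S :=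
    (h.measurable_run hlam hm a hstart s₀ t).comp (measurable_pi_iff.2 fun k => hbm k)
  have hstep : Measurable fun z : State n m × Batch m D Ξ => F (p.step a start z.1 z.2) :=
    hF.comp (h.measurable_step hlam hm a hstart)
  have hint : Measurable fun s : State n m => ∫⁻ y, F (p.step a start s y) ∂law :=
    hstep.lintegral_prod_right'
  refine ⟨hint.comp hS, ?_⟩
  have h1 := (indepFun_iff_map_prod_eq_prod_map_map hS.aemeasurable (hbm t).aemeasurable).1
    (h.indepFun_run hlam hm a hstart s₀ hbm hbi t)
  rw [hlaw t] at h1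
  calc _ = ∫⁻ z, F (p.step a start z.1 z.2) ∂(μ.map fun ω => (S ω, b t ω)) :=
        (lintegral_map hstep (hS.prodMk (hbm t))).symm
    _ = ∫⁻ s, ∫⁻ y, F (p.step a start s y) ∂law ∂(μ.map S) := by
        rw [h1, lintegral_prod _ hstep.aemeasurable]
    _ = _ := lintegral_map hint hS

/-! ### Summing the one-step inequality along the run -/

theorem continuous_gradient_phi (h : p.Regular G L M κ) (hG : 0 ≤ G) (hL : 0 ≤ L)
    (hlam : 0 < lam) (hM : 0 < M) (i : Fin m) : Continuous (gradient (p.phi i)) := by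
  refine (LipschitzWith.of_dist_le_mul (K := (L + 2 * (G ^ 2 * (M / lam))).toNNReal)
    fun θ θ' => ?_).continuous
  rw [dist_eq_norm, dist_eq_norm, Real.coe_toNNReal _ (by positivity)]
  exact h.norm_sub_le_of_meanGradTheta hG hlam hM
    (h.norm_meanGradTheta_sub_gradient_le hG hL hlam hM i θ')
    (h.norm_meanGradTheta_sub_gradient_le hG hL hlam hM i θ)

theorem measurable_gradPhi (h : p.Regular G L M κ) (hG : 0 ≤ G) (hL : 0 ≤ L)
    (hlam : 0 < lam) (hM : 0 < M) : Measurable fun s : State n m => p.gradPhi s.1 s.2.1 := by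
  refine Finset.measurable_sum _ fun i _ => ?_
  have h1 : Measurable fun s : State n m => s.2.1 i :=
    (measurable_pi_apply i).comp ((WithLp.measurable_ofLp 2 _).comp
      (measurable_fst.comp measurable_snd))
  have h2 : Measurable fun s : State n m => gradient (p.phi i) s.1 :=
    (h.continuous_gradient_phi hG hL hlam hM i).measurable.comp measurable_fst
  exact h1.smul h2

/-- The expected squared norms of the weighted gradients along the run, for a run whose inner
loops start with expected gaps at most `Δη`. -/
theorem sum_lintegral_gradPhi_le (h : p.Regular G L M κ) (hG : 0 ≤ G) (hL : 0 ≤ L)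
    (hlam : 0 < lam) (hM : 0 < M) (hm : 0 < m) (hb : ∀ i, BddBelow (Set.range (p.phi i)))
    {ν : Measure (Fin m → Ξ)} [IsProbabilityMeasure ν] {D : ℕ} [NeZero D]
    (hν : ∀ i, ν.map (fun x => x i) = p.P i) {a : Params} (hα : 0 < a.α) (hα1 : a.α ≤ 1)
    (hβ : 0 < a.β) (hγ : 0 < a.γ) (hγN : M / lam * a.γ ≤ 1 / 2) (hρ : 0 ≤ a.ρ) (hρ1 : a.ρ ≤ 1)
    {start : (Fin m → ℝ) → Fin m → ℝ} (hstart : Measurable start)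
    {s₀ : State n m} (hw : s₀.2.1 ∈ simplex m)
    {K C : ℝ} (hK : K = L + G ^ 2 * (M / lam)) (hC : C = momentConst m G (M / lam * κ))
    {b : ℕ → Ω → Batch m D Ξ} (hbm : ∀ t, Measurable (b t)) (hbi : iIndepFun b μ)
    (hlaw : ∀ t, μ.map (b t) = batchLaw ν D) {T : ℕ} {Δη : ℝ} (hΔ : 0 ≤ Δη)
    (hgap : ∀ t < T, ∀ i, ∫⁻ ω, ENNReal.ofReal
      (p.obj i (p.run a start s₀ (fun k => b k ω) t).1
        ((p.run a start s₀ (fun k => b k ω) t).2.2 i) -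
        p.phi i (p.run a start s₀ (fun k => b k ω) t).1) ∂μ ≤ ENNReal.ofReal Δη) :
    ∑ t ∈ Finset.range T, ∫⁻ ω, ENNReal.ofReal (1 / 4 *
      ‖p.gradPhi (p.run a start s₀ (fun k => b k ω) t).1
        (p.run a start s₀ (fun k => b k ω) t).2.1‖ ^ 2) ∂μ ≤
    ENNReal.ofReal (p.gap s₀.1 / a.α + T * (errorConst G K C * (2 / (a.γ * D)) * (m * Δη) +
      (errorConst G K C * (m * (2 * (M / lam) * a.γ * (M / lam * κ) ^ 2)) +
        (K * C * a.α + a.ρ + a.β * (4 * C ^ 2 + 1))))) := by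
  have hC0 : 0 ≤ C := hC ▸ momentConst_nonneg _ _ _
  have hK0 : 0 ≤ K := by rw [hK]; positivity
  have hE0 : 0 ≤ errorConst G K C := by unfold errorConst; positivity
  set S : ℕ → Ω → State n m := fun t ω => p.run a start s₀ (fun k => b k ω) t with hSdef
  -- With the comparison point `u = w₀` the distance term of the initial potential vanishes, and
  -- only the weighted initial gap over `α` is left.
  set u := s₀.2.1
  have hS : ∀ t, Measurable (S t) := fun t =>
    (h.measurable_run hlam.ne' hm a hstart s₀ t).comp (measurable_pi_iff.2 fun k => hbm k)
  have hSw : ∀ t ω, (S t ω).2.1 ∈ simplex m := fun t ω =>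
    p.run_mem_simplex hm a start hw _ t
  set c₁ := errorConst G K C * (2 / (a.γ * D)) with hc₁
  have hc₁0 : 0 ≤ c₁ := by positivity
  set c₂ := errorConst G K C * (m * (2 * (M / lam) * a.γ * (M / lam * κ) ^ 2)) +
        (K * C * a.α + a.ρ + a.β * (4 * C ^ 2 + 1)) with hc₂
  have hc₂0 : 0 ≤ c₂ := by positivity
  set g : ℕ → ℝ≥0∞ := fun t =>
    ∫⁻ ω, ENNReal.ofReal (1 / 4 * ‖p.gradPhi (S t ω).1 (S t ω).2.1‖ ^ 2) ∂μ with hg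
  set B : ℕ → ℝ≥0∞ := fun t => ∫⁻ ω, ENNReal.ofReal (p.potential a u (S t ω)) ∂μ with hB
  have hpotm : Measurable fun s : State n m => ENNReal.ofReal (p.potential a u s) :=
    (h.measurable_potential hG hL hlam hM a u).ennreal_ofReal
  have : IsProbabilityMeasure (batchLaw ν D) := by unfold batchLaw; infer_instance
  have hstep : ∀ t < T, g t + B (t + 1) ≤ B t + ENNReal.ofReal (c₁ * (m * Δη) + c₂) := by
    intro t ht
    obtain ⟨hmeas, hsucc⟩ := h.lintegral_run_succ hlam.ne' hm a hstart s₀ hbm hbi hlaw hpotm t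
    have hpS : Measurable fun ω => ENNReal.ofReal (p.potential a u (S t ω)) := hpotm.comp (hS t)
    have hom : ∀ i, Measurable fun ω => ENNReal.ofReal
        (p.obj i (S t ω).1 ((S t ω).2.2 i) - p.phi i (S t ω).1) := fun i =>
      ((h.measurable_obj_comp i (measurable_fst.comp (hS t)) ((measurable_pi_apply i).comp
        ((measurable_snd.comp measurable_snd).comp (hS t)))).sub
        ((h.differentiable_phi hG hL hlam hM i).continuous.measurable.comp
          (measurable_fst.comp (hS t)))).ennreal_ofReal
    calc g t + B (t + 1) = ∫⁻ ω, (ENNReal.ofReal (1 / 4 * ‖p.gradPhi (S t ω).1 (S t ω).2.1‖ ^ 2) +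
          ∫⁻ y, ENNReal.ofReal (p.potential a u (p.step a start (S t ω) y)) ∂(batchLaw ν D)) ∂μ := by
          rw [lintegral_add_right _ hmeas]
          congr 1
      _ ≤ ∫⁻ ω, (ENNReal.ofReal (p.potential a u (S t ω)) + (ENNReal.ofReal c₁ *
          ∑ i, ENNReal.ofReal (p.obj i (S t ω).1 ((S t ω).2.2 i) - p.phi i (S t ω).1) +
          ENNReal.ofReal c₂)) ∂μ :=
          lintegral_mono fun ω => h.lintegral_potential_step_le hG hL hlam hM hm hb hν hα hα1 hβ hγ
            hγN hρ hρ1 hstart (hSw t ω) hw hK hC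
      _ = B t + (ENNReal.ofReal c₁ * ∑ i, ∫⁻ ω, ENNReal.ofReal
          (p.obj i (S t ω).1 ((S t ω).2.2 i) - p.phi i (S t ω).1) ∂μ + ENNReal.ofReal c₂) := by
          rw [lintegral_add_left hpS, lintegral_add_right _ measurable_const,
            lintegral_const_mul _ (Finset.measurable_sum _ fun i _ => hom i),
            lintegral_finsetSum _ fun i _ => hom i]
          simp [hB]
      _ ≤ B t + (ENNReal.ofReal c₁ * ∑ _i : Fin m, ENNReal.ofReal Δη + ENNReal.ofReal c₂) := by
          gcongr with i
          exact hgap t ht i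
      _ = _ := by
          rw [ENNReal.ofReal_add (by positivity) hc₂0, ENNReal.ofReal_mul (p := c₁) hc₁0,
            ENNReal.ofReal_mul (p := (m : ℝ)) (by positivity), ENNReal.ofReal_natCast]
          simp
  set r := ENNReal.ofReal (c₁ * (m * Δη) + c₂)
  have key : ∀ t ≤ T, ∑ k ∈ Finset.range t, g k + B t ≤ B 0 + t * r := by
    intro t ht
    induction t with
    | zero => simp
    | succ t ih =>
      rw [Finset.sum_range_succ, Nat.cast_succ]
      calc _ = ∑ k ∈ Finset.range t, g k + (g t + B (t + 1)) := by ring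
        _ ≤ ∑ k ∈ Finset.range t, g k + (B t + r) := add_le_add_right (hstep t (by omega)) _
        _ = (∑ k ∈ Finset.range t, g k + B t) + r := by ring
        _ ≤ (B 0 + t * r) + r := add_le_add_left (ih (by omega)) _
        _ = _ := by ring
  have hgap0 : ∀ i, p.phi i s₀.1 - (⨅ θ, p.phi i θ) ≤ p.gap s₀.1 := fun i =>
    le_ciSup (f := fun i => p.phi i s₀.1 - ⨅ θ, p.phi i θ) (Set.finite_range _).bddAbove i
  have hB0 : B 0 ≤ ENNReal.ofReal (p.gap s₀.1 / a.α) := by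
    have e1 : B 0 = ENNReal.ofReal (p.potential a u s₀) := by simp [hB, hSdef, Problem.run]
    rw [e1]
    refine ENNReal.ofReal_le_ofReal ?_
    rw [potential, sub_self, norm_zero]
    have h1 : ∑ i, u i * (p.phi i s₀.1 - ⨅ θ, p.phi i θ) ≤ p.gap s₀.1 := by
      refine (Finset.sum_le_sum fun i _ => mul_le_mul_of_nonneg_left (hgap0 i) (hw.1 i)).trans_eq ?_
      rw [← Finset.sum_mul, hw.2, one_mul]
    have h2 := div_le_div_of_nonneg_right h1 hα.le
    simpa using h2
  have hgapnn : 0 ≤ p.gap s₀.1 :=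
    (sub_nonneg.2 (ciInf_le (hb ⟨0, hm⟩) s₀.1)).trans (hgap0 ⟨0, hm⟩)
  calc ∑ t ∈ Finset.range T, g t ≤ B 0 + T * r := le_trans le_self_add (key T le_rfl)
    _ ≤ ENNReal.ofReal (p.gap s₀.1 / a.α) + T * r := add_le_add_left hB0 _
    _ = _ := by
      rw [ENNReal.ofReal_add (by positivity) (by positivity), ENNReal.ofReal_mul (by positivity),
        ENNReal.ofReal_natCast]

end Problem.Regular

/-! ### From expectation to probability -/

/-- Markov's inequality for the average of nonnegative functions. -/
theorem one_sub_le_measureReal_average_le {Ω : Type*} [MeasurableSpace Ω] {μ : Measure Ω}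
    [IsProbabilityMeasure μ] {T : ℕ} (hT : 0 < T) {X : ℕ → Ω → ℝ} (hX : ∀ t, Measurable (X t))
    (hX0 : ∀ t ω, 0 ≤ X t ω) {r δ : ℝ} (hr : 0 < r) (hδ : 0 ≤ δ)
    (h : ∑ t ∈ Finset.range T, ∫⁻ ω, ENNReal.ofReal (X t ω) ∂μ ≤ ENNReal.ofReal (T * (r * δ))) :
    1 - δ ≤ μ.real {ω | (1 / (T : ℝ)) * ∑ t ∈ Finset.range T, X t ω ≤ r} := by
  have hT' : (0 : ℝ) < T := by exact_mod_cast hT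
  set f : Ω → ℝ := fun ω => (1 / (T : ℝ)) * ∑ t ∈ Finset.range T, X t ω with hf
  have hfm : Measurable f := (Finset.measurable_sum _ fun t _ => hX t).const_mul _
  have hlint : ∫⁻ ω, ENNReal.ofReal (f ω) ∂μ ≤ ENNReal.ofReal (r * δ) := by
    have e1 : ∀ ω, ENNReal.ofReal (f ω) =
        ENNReal.ofReal (1 / T) * ∑ t ∈ Finset.range T, ENNReal.ofReal (X t ω) := fun ω => by
      rw [hf, ENNReal.ofReal_mul (by positivity), ENNReal.ofReal_sum_of_nonneg
        fun t _ => hX0 t ω]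
    simp_rw [e1]
    rw [lintegral_const_mul _ (Finset.measurable_sum _ fun t _ => (hX t).ennreal_ofReal),
      lintegral_finsetSum _ fun t _ => (hX t).ennreal_ofReal]
    refine (mul_le_mul_right h _).trans (le_of_eq ?_)
    rw [← ENNReal.ofReal_mul (by positivity)]
    congr 1
    field_simp
  have hmarkov := mul_meas_ge_le_lintegral₀ (μ := μ) hfm.ennreal_ofReal.aemeasurable
    (ENNReal.ofReal r)
  have hbad : μ {ω | f ω ≤ r}ᶜ ≤ ENNReal.ofReal δ := by
    have h1 : μ {ω | f ω ≤ r}ᶜ ≤ μ {ω | ENNReal.ofReal r ≤ ENNReal.ofReal (f ω)} :=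
      measure_mono fun ω hω => ENNReal.ofReal_le_ofReal (not_le.1 (show ¬f ω ≤ r from hω)).le
    refine h1.trans ?_
    have h2 := hmarkov.trans hlint
    rw [ENNReal.ofReal_mul hr.le] at h2
    exact (ENNReal.mul_le_mul_iff_right (by simpa using hr) ENNReal.ofReal_ne_top).1 h2
  have hms : MeasurableSet {ω | f ω ≤ r} := measurableSet_le hfm measurable_const
  have h3 : μ.real {ω | f ω ≤ r}ᶜ ≤ δ := by
    rw [Measure.real]
    exact ENNReal.toReal_le_of_le_ofReal hδ hbad
  rw [probReal_compl_eq_one_sub hms] at h3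
  linarith

end DRMOO

end

/-! ### The choice of the constants and the main theorem -/

theorem theorem1 (m : ℕ) (G L M lam κ : ℝ) (hG : 0 < G) (hL : 0 < L) (hM : 0 < M)
    (hlam : 0 < lam) (hκ : 0 ≤ κ) :
    ∃ cρ cα cβ cγ cT cD : ℝ,
      0 < cρ ∧ 0 < cα ∧ 0 < cβ ∧ 0 < cγ ∧ 0 < cT ∧ 0 < cD ∧
      ∀ (n : ℕ) (Ξ : Type*) [MeasurableSpace Ξ] (p : DRMOO.Problem n m lam Ξ),
        p.Regular G L M κ →
        (∀ i, BddBelow (Set.range (p.phi i))) →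
        (∀ i, Differentiable ℝ (p.phi i)) ∧
        ∀ (ε δ : ℝ), 0 < ε → ε < 1 → 0 < δ → δ < 1 →
        ∀ (θ₀ : EuclideanSpace ℝ (Fin n)) (w₀ : EuclideanSpace ℝ (Fin m)) (η₀ : Fin m → ℝ)
          (start : (Fin m → ℝ) → Fin m → ℝ) (a : DRMOO.Params) (Δη : ℝ) (T D : ℕ),
        w₀ ∈ DRMOO.simplex m → Measurable start → 0 ≤ Δη →
        a.ρ = cρ * (δ ^ 2 * ε ^ 2) →
        a.α = cα * (δ ^ 2 * ε ^ 2) →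
        a.β = cβ * (δ ^ 2 * ε ^ 2) →
        a.γ = cγ * (δ ^ 2 * ε ^ 4) →
        T = ⌈cT * max (p.gap θ₀ * (a.α * δ * ε ^ 2)⁻¹) ((a.β * δ * ε ^ 2)⁻¹)⌉₊ →
        D = max 1 ⌈cD * (Δη * (a.γ * δ ^ 2 * ε ^ 4)⁻¹)⌉₊ →
        ∀ (Ω : Type*) [MeasurableSpace Ω] (μ : Measure Ω) [IsProbabilityMeasure μ]
          (ν : Measure (Fin m → Ξ)) [IsProbabilityMeasure ν]
          (b : ℕ → Ω → DRMOO.Batch m D Ξ),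
        (∀ i, ν.map (fun x => x i) = p.P i) →
        (∀ t, Measurable (b t)) →
        (∀ t, μ.map (b t) = DRMOO.batchLaw ν D) →
        iIndepFun b μ →
        (∀ t < T, ∀ i,
          ∫⁻ ω, ENNReal.ofReal
            (let s := p.run a start (θ₀, w₀, η₀) (fun k => b k ω) t
             p.obj i s.1 (s.2.2 i) - p.phi i s.1) ∂μ ≤ ENNReal.ofReal Δη) →
        1 - δ ≤ μ.real {ω |
          let s := p.run a start (θ₀, w₀, η₀) (fun k => b k ω)
          (1 / (T : ℝ)) * ∑ t ∈ Finset.range T, ‖p.gradPhi (s t).1 (s t).2.1‖ ^ 2 ≤ 78 * ε ^ 2 ∧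
          ∃ t < T, p.IsParetoStationary (√78 * ε) (s t).1} := by
  set N := M / lam with hNdef
  set K := L + G ^ 2 * N with hK
  set C := DRMOO.momentConst m G (N * κ) with hC
  set E := DRMOO.errorConst G K C with hE
  have hN0 : 0 < N := by positivity
  have hK0 : 0 ≤ K := by positivity
  have hC0 : 0 ≤ C := DRMOO.momentConst_nonneg _ _ _
  have hE0 : 0 < E := by rw [hE, DRMOO.errorConst]; positivity
  -- Each constant is chosen to make one error term at most `δ ε²`: `cα`, `cρ`, `cβ` for `K C α`,
  -- `ρ`, `β(4C² + 1)`, and `cγ`, `cD` for the inner noise and the inner initial gap. The summands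
  -- `1` in `cα` and `cγ` also ensure `α ≤ 1` and `N γ ≤ 1/2`; `m + 1` keeps `cD` positive before `m
  -- > 0` is known.
  refine ⟨1, 1 / (1 + K * C), 1 / (4 * C ^ 2 + 1), 1 / (2 * N * (1 + m * (N * κ) ^ 2 * E)), 1,
    2 * (m + 1) * E, one_pos, by positivity, by positivity, by positivity, one_pos, by positivity,
    ?_⟩
  intro n Ξ _ p h hb
  refine ⟨h.differentiable_phi hG.le hL.le hlam hM, ?_⟩
  intro ε δ hε hε1 hδ hδ1 θ₀ w₀ η₀ start a Δη T D hw hstart hΔ hρ hα hβ hγ hT hD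
    Ω _ μ _ ν _ b hν hbm hlaw hbi hgap
  have hm : 0 < m := by
    rcases Nat.eq_zero_or_pos m with rfl | hm
    · have := hw.2
      simp at this
    · exact hm
  have hDpos : 0 < D := by rw [hD]; exact lt_of_lt_of_le one_pos (le_max_left _ _)
  have : NeZero D := ⟨hDpos.ne'⟩
  have hD' : (0 : ℝ) < D := by exact_mod_cast hDpos
  -- sizes of the parameters
  have hε2 : ε ^ 2 ≤ 1 := pow_le_one₀ hε.le hε1.le
  have hx0 : 0 < δ * ε ^ 2 := by positivity
  have hxx : δ ^ 2 * ε ^ 2 ≤ δ * ε ^ 2 := by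
    have : δ * (δ * ε ^ 2) ≤ 1 * (δ * ε ^ 2) := mul_le_mul_of_nonneg_right hδ1.le hx0.le
    linarith
  have hyy : δ ^ 2 * ε ^ 4 ≤ δ * ε ^ 2 := by
    have : δ ^ 2 * ε ^ 2 * ε ^ 2 ≤ δ ^ 2 * ε ^ 2 * 1 :=
      mul_le_mul_of_nonneg_left hε2 (by positivity)
    linarith
  have hx1 : δ * ε ^ 2 ≤ 1 := mul_le_one₀ hδ1.le (by positivity) hε2
  have hα0 : 0 < a.α := by rw [hα]; positivity
  have hβ0 : 0 < a.β := by rw [hβ]; positivity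
  have hγ0 : 0 < a.γ := by rw [hγ]; positivity
  have hρ0 : 0 ≤ a.ρ := by rw [hρ]; positivity
  have hKC : (1 + K * C) * a.α = δ ^ 2 * ε ^ 2 := by rw [hα]; field_simp
  have hβC : a.β * (4 * C ^ 2 + 1) = δ ^ 2 * ε ^ 2 := by rw [hβ]; field_simp
  have hγE : 2 * N * (1 + m * (N * κ) ^ 2 * E) * a.γ = δ ^ 2 * ε ^ 4 := by rw [hγ]; field_simp
  rw [one_mul] at hρ
  have hKCα : 0 ≤ K * C * a.α := by positivity
  have hα1 : a.α ≤ 1 := by linarith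
  have hρ1 : a.ρ ≤ 1 := by linarith
  have hNE : 0 ≤ N * (m * (N * κ) ^ 2 * E) * a.γ := by positivity
  have hγN : N * a.γ ≤ 1 / 2 := by linarith
  -- Only positivity is drawn from the second entry of the maximum in `T`, since the choice `u = w₀`
  -- leaves no term of order `1/β`.
  have hTpos : 0 < T := by
    rw [hT]
    refine Nat.ceil_pos.2 (mul_pos one_pos (lt_max_of_lt_right ?_))
    positivity
  have hT' : (0 : ℝ) < T := by exact_mod_cast hTpos
  have hgapT : p.gap θ₀ / a.α ≤ T * (δ * ε ^ 2) := by
    have h1 : p.gap θ₀ * (a.α * δ * ε ^ 2)⁻¹ ≤ T := by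
      rw [hT]
      refine le_trans ?_ (Nat.le_ceil _)
      rw [one_mul]
      exact le_max_left _ _
    rw [← div_eq_mul_inv, div_le_iff₀ (by positivity)] at h1
    rw [div_le_iff₀ hα0]
    linarith
  have hinner : E * (2 / (a.γ * D)) * (m * Δη) ≤ δ * ε ^ 2 := by
    have h1 : 2 * (m + 1) * E * (Δη * (a.γ * δ ^ 2 * ε ^ 4)⁻¹) ≤ D := by
      refine (Nat.le_ceil _).trans ?_
      rw [hD]
      exact_mod_cast le_max_right _ _
    rw [← div_eq_mul_inv, ← mul_div_assoc, div_le_iff₀ (by positivity)] at h1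
    have h2 : E * (2 / (a.γ * D)) * (m * Δη) = 2 * m * E * Δη / (a.γ * D) := by ring
    have h3 : 0 ≤ E * Δη := by positivity
    rw [h2, div_le_iff₀ (by positivity)]
    have h4 : δ ^ 2 * ε ^ 4 * (a.γ * D) ≤ δ * ε ^ 2 * (a.γ * D) :=
      mul_le_mul_of_nonneg_right hyy (by positivity)
    linarith
  have hnoise : E * (m * (2 * N * a.γ * (N * κ) ^ 2)) ≤ δ * ε ^ 2 := by
    have h1 : 0 ≤ N * a.γ := by positivity
    linarith
  have hsum := h.sum_lintegral_gradPhi_le (K := K) (C := C) hG.le hL.le hlam hM hm hb hν hα0 hα1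
    hβ0 hγ0 hγN hρ0 hρ1 hstart (s₀ := (θ₀, w₀, η₀)) hw rfl rfl hbm hbi hlaw hΔ hgap
  have hSm : ∀ t, Measurable fun ω => p.run a start (θ₀, w₀, η₀) (fun k => b k ω) t := fun t =>
    (h.measurable_run hlam.ne' hm a hstart (θ₀, w₀, η₀) t).comp
      (measurable_pi_iff.2 fun k => hbm k)
  have hXm : ∀ t, Measurable fun ω =>
      1 / 4 * ‖p.gradPhi (p.run a start (θ₀, w₀, η₀) (fun k => b k ω) t).1
        (p.run a start (θ₀, w₀, η₀) (fun k => b k ω) t).2.1‖ ^ 2 := fun t =>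
    ((((h.measurable_gradPhi hG.le hL.le hlam hM).comp (hSm t)).norm).pow_const 2).const_mul _
  -- The five error terms and the initial gap add up to `6 T δ ε²`, well below the `(78/4) T δ ε²`
  -- that Markov's inequality allows; the factor `1/4` comes from the one-step inequality.
  have hmarkov := DRMOO.one_sub_le_measureReal_average_le hTpos hXm
    (fun t ω => by positivity) (r := 78 / 4 * ε ^ 2) (δ := δ) (by positivity) hδ.le
    (hsum.trans (ENNReal.ofReal_le_ofReal (by
      have h1 : E * (2 / (a.γ * D)) * (m * Δη) + (E * (m * (2 * N * a.γ * (N * κ) ^ 2)) +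
          (K * C * a.α + a.ρ + a.β * (4 * C ^ 2 + 1))) ≤ 5 * (δ * ε ^ 2) := by linarith
      have h2 := mul_le_mul_of_nonneg_left h1 hT'.le
      have h3 : 0 ≤ (T : ℝ) * (δ * ε ^ 2) := by positivity
      change p.gap θ₀ / a.α + _ ≤ _
      linarith)))
  refine hmarkov.trans (measureReal_mono fun ω hω => ?_)
  simp only [Set.mem_ofPred_eq, ← Finset.mul_sum] at hω ⊢
  have hω' : 1 / (T : ℝ) * ∑ t ∈ Finset.range T,
      ‖p.gradPhi (p.run a start (θ₀, w₀, η₀) (fun k => b k ω) t).1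
        (p.run a start (θ₀, w₀, η₀) (fun k => b k ω) t).2.1‖ ^ 2 ≤ 78 * ε ^ 2 := by
    linarith
  refine ⟨hω', ?_⟩
  -- If no iterate were stationary, the weights `w_t` themselves would give terms all above `78 ε²`,
  -- contradicting the bound on their average.
  by_contra! hcon
  have hlt : ∀ t ∈ Finset.range T, 78 * ε ^ 2 <
      ‖p.gradPhi (p.run a start (θ₀, w₀, η₀) (fun k => b k ω) t).1
        (p.run a start (θ₀, w₀, η₀) (fun k => b k ω) t).2.1‖ ^ 2 := by
    intro t ht
    have h1 : √78 * ε < ‖p.gradPhi (p.run a start (θ₀, w₀, η₀) (fun k => b k ω) t).1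
        (p.run a start (θ₀, w₀, η₀) (fun k => b k ω) t).2.1‖ := by
      by_contra! hle
      exact hcon t (Finset.mem_range.1 ht)
        ⟨_, p.run_mem_simplex hm a start (s₀ := (θ₀, w₀, η₀)) hw _ t, hle⟩
    have h2 := pow_lt_pow_left₀ h1 (by positivity) two_ne_zero
    rwa [mul_pow, Real.sq_sqrt (by norm_num)] at h2
  have h3 := Finset.sum_lt_sum_of_nonempty (Finset.nonempty_range_iff.2 hTpos.ne') hlt
  rw [Finset.sum_const, Finset.card_range, nsmul_eq_mul] at h3
  rw [one_div, inv_mul_le_iff₀ hT'] at hω'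
  linarith
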